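/- \textbf{Conventions.} A \emph{singular hermitian inner product} on a finite-dimensional complex vector space $V$ is a function $\|\cdot\|:V\to[0,+\infty]$ with $\|0\|=0$, $\|\lambda v\|=|\lambda|\,\|v\|$ for $\lambda\in\mathbb C\setminus\{0\}$, $\|v+w\|\le\|v\|+\|w\|$ and $\|v+w\|^2+\|v-w\|^2=2\|v\|^2+2\|w\|^2$. Let $\mathcal A$ be a holomorphic vector bundle on a complex manifold $Y$. A \emph{singular hermitian metric with semi-negative curvature} on $\mathcal A$ is a family $h$ of singular hermitian inner products $\|\cdot\|_{h,y}$ on the fibres $\mathcal A_y$, $y\in Y$, such that $\|\cdot\|_{h,y}$ is finite and positive definite for all $y$ outside a set of measure zero, and such that for every open $U\subset Y$ and every $s\in H^0(U,\mathcal A)$ the function $y\mapsto\log\|s(y)\|_{h,y}$ is plurisubharmonic on $U$ (with values in $[-\infty,+\infty)$, the function $-\infty$ being allowed). \textbf{Proposition.} Let $X$ be a complex manifold of dimension $n$ and let $D\subset X$ be a normal crossing divisor, i.e. around every point of $X$ there are centred holomorphic coordinates $z_1,\dots,z_n$ in which $D=\{\prod_{i\in S}z_i=0\}$ for some $S\subset\{1,\dots,n\}$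 (with $S=\emptyset$ at points outside $D$). Let $T_X(-\log D)$ be the logarithmic tangent bundle, i.e. the locally free sheaf of holomorphic vector fields preserving the ideal sheaf of $D$, locally generated by $z_i\,\partial/\partial z_i$ $(i\in S)$ and $\partial/\partial z_j$ $(j\notin S)$. Let $h$ be a singular hermitian metric with semi-negative curvature on $T_X|_{X-D}$. Assume that there are a closed analytic subset $Z\subset X-D$ with dense complement in $X-D$ and a real number $A>0$ such that on $X-D-Z$ the metric $h$ is a smooth (positive definite) hermitian metric whose holomorphic sectional curvature $h(\Theta(v,\bar v)v,v)/\|v\|_h^4$ ($\Theta$ being the Chern curvature, $v\neq0$) is at most $-A$. Then there exists a unique singular hermitian metric with semi-negative curvature on $T_X(-\log D)$ whose restriction to $X-D$ is $h$, under the canonical identification $T_X(-\log D)|_{X-D}=T_X|_{X-D}$. -/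

import Mathlib

open Set Filter Topology MeasureTheory
open scoped Manifold ContDiff ENNReal ComplexConjugate

noncomputable section

namespace LogMetric

/-! ### Plurisubharmonic functions -/

/-- The integral `∫ f⁺ - ∫ f⁻` of an extended real valued function. -/
def erealIntegral {α : Type*} [MeasurableSpace α] (μ : Measure α) (f : α → EReal) : EReal :=
  ((∫⁻ a, (f a).toENNReal ∂μ : ℝ≥0∞) : EReal) - ((∫⁻ a, (-f a).toENNReal ∂μ : ℝ≥0∞) : EReal)

/-- `u` is plurisubharmonic on the open set `Ω ⊆ ℂⁿ`: it takes values in `[-∞, ∞)`, is upper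
semicontinuous, and satisfies the sub-mean value inequality on every closed affine complex disc
contained in `Ω`. The function `-∞` is allowed. -/
structure IsPshOn {n : ℕ} (Ω : Set (Fin n → ℂ)) (u : (Fin n → ℂ) → EReal) : Prop where
  lt_top : ∀ z ∈ Ω, u z < ⊤
  usc : UpperSemicontinuousOn u Ω
  submean : ∀ a b : Fin n → ℂ, (∀ t : ℂ, ‖t‖ ≤ 1 → a + t • b ∈ Ω) →
    u a ≤ erealIntegral (volume.restrict (Ioc (0 : ℝ) 1))
      (fun θ => u (a + Complex.exp (2 * Real.pi * θ * Complex.I) • b))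

section Manifold

variable {n : ℕ} {X : Type*} [TopologicalSpace X] [ChartedSpace (Fin n → ℂ) X]

variable (n) in
/-- The holomorphic charts of a complex manifold of dimension `n`. -/
def holCharts (X : Type*) [TopologicalSpace X] [ChartedSpace (Fin n → ℂ) X] :
    Set (OpenPartialHomeomorph X (Fin n → ℂ)) :=
  IsManifold.maximalAtlas 𝓘(ℂ, Fin n → ℂ) ω X

variable (n) in
/-- Plurisubharmonicity on an open subset `W` of a complex manifold: in every holomorphic chart. -/
def IsPshOnManifold (W : Set X) (u : X → EReal) : Prop :=
  ∀ φ ∈ holCharts n X, IsPshOn (φ.target ∩ φ.symm ⁻¹' W) (u ∘ φ.symm)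

variable (n) in
/-- Sets of measure zero of a complex manifold. -/
def IsNullSet (N : Set X) : Prop :=
  ∀ φ ∈ holCharts n X, volume (φ.target ∩ φ.symm ⁻¹' N) = 0

variable (n) in
/-- `f` is a holomorphic function on the open set `W`. -/
def IsHolFun (W : Set X) (f : X → ℂ) : Prop :=
  MDifferentiableOn 𝓘(ℂ, Fin n → ℂ) 𝓘(ℂ, ℂ) f W

variable (n) in
/-- `Z` is a closed analytic subset of the open subset `U`: every point of `U` has an open
neighbourhood in which `Z` is the common zero set of finitely many holomorphic functions. -/
def IsAnalyticSubset (U Z : Set X) : Prop :=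
  Z ⊆ U ∧ ∀ x ∈ U, ∃ W : Set X, IsOpen W ∧ x ∈ W ∧ W ⊆ U ∧
    ∃ (k : ℕ) (f : Fin k → X → ℂ), (∀ j, IsHolFun n W (f j)) ∧
      ∀ y ∈ W, y ∈ Z ↔ ∀ j, f j y = 0

variable (n) in
/-- `D` is (the support of) a normal crossing divisor: around every point there are centred
holomorphic coordinates `z` with `D = {∏_{i ∈ S} z_i = 0}` for a set `S` of indices
(`S = ∅` at the points outside `D`). -/
def IsNormalCrossingDivisor (D : Set X) : Prop :=
  ∀ x : X, ∃ φ ∈ holCharts n X, x ∈ φ.source ∧ φ x = 0 ∧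
    ∃ S : Finset (Fin n), ∀ y ∈ φ.source, y ∈ D ↔ ∏ i ∈ S, φ y i = 0

end Manifold

/-! ### Singular hermitian metrics of semi-negative curvature -/

/-- Singular hermitian inner products on a complex vector space. -/
structure IsSingularHermitianInner {V : Type*} [AddCommGroup V] [Module ℂ V]
    (N : V → ℝ≥0∞) : Prop where
  map_zero : N 0 = 0
  map_smul : ∀ (c : ℂ) (v : V), c ≠ 0 → N (c • v) = ‖c‖ₑ * N v
  triangle : ∀ v w : V, N (v + w) ≤ N v + N w
  parallelogram : ∀ v w : V, N (v + w) ^ 2 + N (v - w) ^ 2 = 2 * N v ^ 2 + 2 * N w ^ 2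

/-- `N` is finite and positive definite. -/
def IsFinitePosDef {V : Type*} [AddCommGroup V] (N : V → ℝ≥0∞) : Prop :=
  (∀ v, N v ≠ ⊤) ∧ ∀ v, N v = 0 → v = 0

variable {n : ℕ} {X : Type*} [TopologicalSpace X] [ChartedSpace (Fin n → ℂ) X]

variable (n) in
/-- `h` is a singular hermitian metric with semi-negative curvature, over the open subset `U`, on
the holomorphic vector bundle with fibres `V x`, whose holomorphic sections over an open set `W`
are the elements of `Γ W`. Only the values of `h` over `U` matter. -/
structure IsSemiNegativeMetric {V : X → Type*} [∀ x, AddCommGroup (V x)] [∀ x, Module ℂ (V x)]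
    (Γ : Set X → Set (∀ x, V x)) (U : Set X) (h : ∀ x, V x → ℝ≥0∞) : Prop where
  inner : ∀ x ∈ U, IsSingularHermitianInner (h x)
  ae_finitePosDef : IsNullSet n {x ∈ U | ¬ IsFinitePosDef (h x)}
  psh : ∀ W : Set X, IsOpen W → W ⊆ U → ∀ s ∈ Γ W,
    IsPshOnManifold n W (fun x => ENNReal.log (h x (s x)))

/-! ### Smooth hermitian metrics on the tangent bundle and holomorphic sectional curvature -/

/-- The sesquilinear form (linear in `u`, antilinear in `v`) attached to a finite hermitian norm by
polarization. -/
def polarForm {V : Type*} [AddCommGroup V] [Module ℂ V] (N : V → ℝ≥0∞) (u v : V) : ℂ :=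
  (1 / 4 : ℂ) * ((((N (u + v)).toReal ^ 2 - (N (u - v)).toReal ^ 2 : ℝ) : ℂ) +
    Complex.I * (((N (u + Complex.I • v)).toReal ^ 2 -
      (N (u - Complex.I • v)).toReal ^ 2 : ℝ) : ℂ))

/-- The tangent vector `∑ v_i ∂/∂z_i` at the point of coordinates `z` in the chart `φ`. -/
def coordVec (φ : OpenPartialHomeomorph X (Fin n → ℂ)) (z v : Fin n → ℂ) :
    TangentSpace 𝓘(ℂ, Fin n → ℂ) (φ.symm z) :=
  mfderiv 𝓘(ℂ, Fin n → ℂ) 𝓘(ℂ, Fin n → ℂ) φ.symm z v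

/-- The matrix `H_{ij} = ⟨∂/∂z_i, ∂/∂z_j⟩_h` as a function of the coordinates `z` of `φ`. -/
def gram (h : ∀ x : X, TangentSpace 𝓘(ℂ, Fin n → ℂ) x → ℝ≥0∞)
    (φ : OpenPartialHomeomorph X (Fin n → ℂ)) (z : Fin n → ℂ) : Matrix (Fin n) (Fin n) ℂ :=
  Matrix.of fun i j =>
    polarForm (h (φ.symm z)) (coordVec φ z (Pi.single i 1)) (coordVec φ z (Pi.single j 1))

/-- `h` is a smooth (positive definite) hermitian metric on the tangent bundle over the open set
`U`. -/
def IsSmoothMetricOn (U : Set X) (h : ∀ x : X, TangentSpace 𝓘(ℂ, Fin n → ℂ) x → ℝ≥0∞) : Prop :=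
  (∀ x ∈ U, IsSingularHermitianInner (h x) ∧ IsFinitePosDef (h x)) ∧
  ∀ φ ∈ holCharts n X, ∀ i j : Fin n,
    ContDiffOn ℝ ∞ (fun z => gram h φ z i j) (φ.target ∩ φ.symm ⁻¹' U)

/-- `∂_v f = ∑ v_k ∂f/∂z_k`. -/
def dHol (v : Fin n → ℂ) (f : (Fin n → ℂ) → ℂ) (z : Fin n → ℂ) : ℂ :=
  (1 / 2 : ℂ) * (fderiv ℝ f z v - Complex.I * fderiv ℝ f z (Complex.I • v))

/-- `∂̄_v f = ∑ conj v_k ∂f/∂z̄_k`. -/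
def dBar (v : Fin n → ℂ) (f : (Fin n → ℂ) → ℂ) (z : Fin n → ℂ) : ℂ :=
  (1 / 2 : ℂ) * (fderiv ℝ f z v + Complex.I * fderiv ℝ f z (Complex.I • v))

/-- The Chern curvature `h(Θ(v, v̄) v, v)`, where
`Θ(v, v̄) = ∂̄(∂H H⁻¹)(v, v̄)`, that is
`R(v, v̄, v, v̄) = ∑ (-∂_v ∂̄_v H + (∂_v H) H⁻¹ (∂̄_v H))_{ij} v_i conj v_j`. -/
def chernR (h : ∀ x : X, TangentSpace 𝓘(ℂ, Fin n → ℂ) x → ℝ≥0∞)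
    (φ : OpenPartialHomeomorph X (Fin n → ℂ)) (z v : Fin n → ℂ) : ℂ :=
  ∑ i, ∑ j, (- dHol v (dBar v fun w => gram h φ w i j) z +
    ∑ p, ∑ q, dHol v (fun w => gram h φ w i q) z * (gram h φ z)⁻¹ q p *
      dBar v (fun w => gram h φ w p j) z) * v i * conj (v j)

/-- The holomorphic sectional curvature `R(v, v̄, v, v̄) / ‖v‖⁴` of a smooth hermitian metric in
the direction `∑ v_i ∂/∂z_i`. -/
def holSecCurv (h : ∀ x : X, TangentSpace 𝓘(ℂ, Fin n → ℂ) x → ℝ≥0∞)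
    (φ : OpenPartialHomeomorph X (Fin n → ℂ)) (z v : Fin n → ℂ) : ℝ :=
  (chernR h φ z v).re / (h (φ.symm z) (coordVec φ z v)).toReal ^ 4

/-- The holomorphic sectional curvature of `h` is at most `c` over `U`. -/
def HolSecCurvLE (U : Set X) (h : ∀ x : X, TangentSpace 𝓘(ℂ, Fin n → ℂ) x → ℝ≥0∞) (c : ℝ) :
    Prop :=
  ∀ φ ∈ holCharts n X, ∀ z ∈ φ.target, φ.symm z ∈ U → ∀ v : Fin n → ℂ, v ≠ 0 →
    holSecCurv h φ z v ≤ c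

/-! ### The tangent bundle and the logarithmic tangent bundle -/

variable [IsManifold 𝓘(ℂ, Fin n → ℂ) ω X]

/-- The holomorphic vector fields on the open set `W`. -/
def holVectorFields (W : Set X) : Set (∀ x : X, TangentSpace 𝓘(ℂ, Fin n → ℂ) x) :=
  {θ | MDifferentiableOn 𝓘(ℂ, Fin n → ℂ) (𝓘(ℂ, Fin n → ℂ).prod 𝓘(ℂ, Fin n → ℂ))
    (fun x => (⟨x, θ x⟩ : TangentBundle 𝓘(ℂ, Fin n → ℂ) X)) W}

/-- `θ` is a holomorphic vector field on the open set `W` that maps the ideal sheaf of `D` (the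
holomorphic functions vanishing on `D`) into itself, that is a section of the sheaf `T_X(-log D)`
over `W`. -/
def IsLogVectorField (D W : Set X) (θ : ∀ x : X, TangentSpace 𝓘(ℂ, Fin n → ℂ) x) : Prop :=
  θ ∈ holVectorFields W ∧
  ∀ (W' : Set X) (g : X → ℂ), IsOpen W' → W' ⊆ W → IsHolFun n W' g →
    (∀ y ∈ W' ∩ D, g y = 0) →
    ∀ y ∈ W' ∩ D, mfderiv 𝓘(ℂ, Fin n → ℂ) 𝓘(ℂ, ℂ) g y (θ y) = 0

/-- Logarithmic vector fields defined near `x`. -/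
def logGerms (D : Set X) (x : X) :
    Submodule ℂ (∀ y : X, TangentSpace 𝓘(ℂ, Fin n → ℂ) y) where
  carrier := {θ | ∃ W : Set X, IsOpen W ∧ x ∈ W ∧ IsLogVectorField D W θ}
  zero_mem' := by
    refine ⟨univ, isOpen_univ, mem_univ _, ?_, ?_⟩
    · intro y _
      exact Bundle.mdifferentiableWithinAt_zeroSection ℂ
        (TangentSpace 𝓘(ℂ, Fin n → ℂ) : X → Type _)
    · intro W' g _ _ _ _ y _
      exact map_zero (mfderiv 𝓘(ℂ, Fin n → ℂ) 𝓘(ℂ, ℂ) g y)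
  add_mem' := by
    rintro θ τ ⟨W₁, o₁, m₁, h₁⟩ ⟨W₂, o₂, m₂, h₂⟩
    refine ⟨W₁ ∩ W₂, o₁.inter o₂, ⟨m₁, m₂⟩, ?_, ?_⟩
    · exact mdifferentiableOn_add_section (MDifferentiableOn.mono h₁.1 inter_subset_left)
        (MDifferentiableOn.mono h₂.1 inter_subset_right)
    · intro W' g o hW hg hv y hy
      have e₁ := h₁.2 W' g o (hW.trans inter_subset_left) hg hv y hy
      have e₂ := h₂.2 W' g o (hW.trans inter_subset_right) hg hv y hy
      have e := map_add (mfderiv 𝓘(ℂ, Fin n → ℂ) 𝓘(ℂ, ℂ) g y) (θ y) (τ y)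
      rw [e₁, e₂, add_zero] at e
      exact e
  smul_mem' := by
    rintro c θ ⟨W, o, m, hW⟩
    refine ⟨W, o, m, ?_, ?_⟩
    · exact MDifferentiableOn.smul_const_section (a := c) hW.1
    · intro W' g o hW' hg hv y hy
      have e := map_smul (mfderiv 𝓘(ℂ, Fin n → ℂ) 𝓘(ℂ, ℂ) g y) c (θ y)
      rw [hW.2 W' g o hW' hg hv y hy, smul_zero] at e
      exact e

/-- The subspace `𝔪_x · T_X(-log D)_x` of the stalk, spanned by the germs `f σ` with `f`
holomorphic near `x`, `f x = 0`, and `σ` logarithmic near `x`. (With `σ = 0` it contains the vector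
fields that vanish near `x`, so the quotient below is a quotient of the space of germs.) -/
def logVanishing (D : Set X) (x : X) : Submodule ℂ (logGerms (n := n) D x) :=
  Submodule.span ℂ {τ | ∃ (W : Set X) (f : X → ℂ), IsOpen W ∧ x ∈ W ∧ IsHolFun n W f ∧ f x = 0 ∧
    ∃ σ ∈ logGerms (n := n) D x, ∀ y ∈ W, τ.1 y = f y • σ y}

/-- The fibre at `x` of the vector bundle `T_X(-log D)`: the stalk of the locally free sheaf of
logarithmic vector fields modulo the maximal ideal of `x`. -/
abbrev LogFiber (D : Set X) (x : X) : Type _ :=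
  logGerms (n := n) D x ⧸ logVanishing (n := n) D x

/-- The holomorphic sections of the vector bundle `T_X(-log D)` over the open set `W`: locally they
are given by logarithmic vector fields. -/
def logSections (D : Set X) (W : Set X) : Set (∀ x : X, LogFiber (n := n) D x) :=
  {s | ∀ x ∈ W, ∃ θ : ∀ y : X, TangentSpace 𝓘(ℂ, Fin n → ℂ) y,
    ∀ᶠ y in 𝓝 x, ∃ hy : θ ∈ logGerms D y, s y = Submodule.Quotient.mk ⟨θ, hy⟩}

/-- The canonical map `T_X(-log D) → T_X` on fibres (an isomorphism outside `D`). -/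
def logToTangent (D : Set X) (x : X) :
    LogFiber (n := n) D x →ₗ[ℂ] TangentSpace 𝓘(ℂ, Fin n → ℂ) x :=
  (logVanishing (n := n) D x).liftQ
    ((LinearMap.proj x).comp (logGerms (n := n) D x).subtype) (by
      refine Submodule.span_le.2 ?_
      rintro τ ⟨W, f, _, hx, _, hf, σ, _, hτ⟩
      have e := hτ x hx
      rw [hf, zero_smul] at e
      exact e)

end LogMetric

end

open LogMetric

noncomputable section

namespace LogMetric

open Metric

/-! ### The integral of extended real valued functions -/

/-! Negative curvature makes logarithmic vector fields bounded near `D`. Plurisubharmonic functions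
bounded above extend across a hypersurface, in only one way, and this extends the metric.

Boundedness. Along an affine disc `t ↦ a + t b` of a chart, let G be the squared norm of the
constant field b. Cauchy–Schwarz for the dual hermitian form turns the curvature bound into Δ log G
≥ 4AG on the smooth locus (`laplacian_log_ge_of_curvature_le`). At a maximum of G(1-|t|²)² this
gives G(1-|t|²)² ≤ 2/A, the Ahlfors–Schwarz comparison with the Poincaré metric, so b has norm at
most √(2/A) at the centre of every such disc avoiding `D` (`chartNorm_le_of_disc_subset`). The set
`Z` meets a disc centred off it in finitely many points, which a factor |F|^ε with zeros there
hides; centres on `Z` follow from the sub-mean value inequality. In coordinates adapted to `D`, a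
disc of radius |z_i|/2 in a normal direction avoids `D`, so z_i ∂/∂z_i is bounded; in the other
directions a fixed radius works. The normal components of a logarithmic field vanish on the branches
of `D`, hence are O(|z_i|) by the Schwarz lemma (`logField_bounded`).

Extension. The norm of a class in the logarithmic fibre at x is the upper limit, over y → x off `D`,
of the norm of a representing field. It does not depend on the field, because a function vanishing
at x times a bounded field has norm tending to 0 (`logMetric_mk`). Its logarithm along a section is
the extension of a plurisubharmonic function by upper limits (`isPshOn_limsupExt`). Homogeneity and
the triangle inequality pass to upper limits. One inequality in the parallelogram law comes from the
sub-mean value inequality for squared norms on a small circle leaving `D`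
(`logMetric_parallelogram_le`), and the other follows by applying it to the sum and difference of
the two vectors.

Uniqueness. At a point of `D` a plurisubharmonic function equals its upper limit from outside `D`
(`IsPshOn.eq_limsupExt`), and every fibre vector is the value of a local holomorphic section.

Sub-mean value inequalities are handled throughout by comparison with real parts of holomorphic
functions (`SubAt`), which makes their local nature a maximum principle (`subAt_of_local`). -/

theorem erealIntegral_mono {α : Type*} [MeasurableSpace α] {μ : Measure α} {f g : α → EReal}
    (h : ∀ᵐ a ∂μ, f a ≤ g a) : erealIntegral μ f ≤ erealIntegral μ g := by
  unfold erealIntegral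
  apply EReal.sub_le_sub
  · exact_mod_cast lintegral_mono_ae (h.mono fun a ha => EReal.toENNReal_le_toENNReal ha)
  · exact_mod_cast lintegral_mono_ae
      (h.mono fun a ha => EReal.toENNReal_le_toENNReal (EReal.neg_le_neg_iff.2 ha))

theorem erealIntegral_coe {α : Type*} [MeasurableSpace α] {μ : Measure α} {f : α → ℝ}
    (hf : Integrable f μ) : erealIntegral μ (fun a => (f a : EReal)) = ((∫ a, f a ∂μ : ℝ) : EReal) := by
  unfold erealIntegral
  rw [integral_eq_lintegral_pos_part_sub_lintegral_neg_part hf]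
  have h1 : ∫⁻ a, ENNReal.ofReal (f a) ∂μ ≠ ⊤ := hf.lintegral_lt_top.ne
  have h2 : ∫⁻ a, ENNReal.ofReal (-f a) ∂μ ≠ ⊤ := hf.neg.lintegral_lt_top.ne
  simp only [← EReal.coe_neg, EReal.toENNReal_of_ne_top (EReal.coe_ne_top _), EReal.toReal_coe,
    EReal.coe_sub, EReal.coe_ennreal_toReal h1, EReal.coe_ennreal_toReal h2]

/-- The point `e^{2πiθ}` of the unit circle. -/
def circ (θ : ℝ) : ℂ := Complex.exp (2 * Real.pi * θ * Complex.I)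

theorem continuous_circ : Continuous circ := by unfold circ; fun_prop

theorem norm_circ (θ : ℝ) : ‖circ θ‖ = 1 := by
  have : (2 * Real.pi * θ * Complex.I : ℂ) = ((2 * Real.pi * θ : ℝ) : ℂ) * Complex.I := by
    push_cast; ring
  rw [circ, this, Complex.norm_exp_ofReal_mul_I]

/-- The mean value property of holomorphic functions, rescaled from angles in [0, 2π] to parameters
in [0, 1]. -/
theorem integral_circ_eq {g : ℂ → ℂ} (hg : DiffContOnCl ℂ g (ball 0 1)) :
    ∫ θ in Ioc (0 : ℝ) 1, (g (circ θ)).re = (g 0).re := by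
  have hcont : ContinuousOn g (closedBall 0 1) := by
    have := hg.continuousOn
    rwa [closure_ball _ one_ne_zero] at this
  have hc : Continuous fun θ => g (circ θ) := by
    apply hcont.comp_continuous continuous_circ
    intro x; simp [norm_circ]
  have h1 : Real.circleAverage g 0 1 = g 0 := by
    apply DiffContOnCl.circleAverage; simpa using hg
  have h2 : Real.circleAverage g 0 1 = ∫ θ in (0 : ℝ)..1, g (circ θ) := by
    rw [Real.circleAverage_def]
    have := intervalIntegral.smul_integral_comp_mul_left (a := 0) (b := 1)
      (fun θ => g (circleMap 0 1 θ)) (2 * Real.pi)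
    rw [mul_zero, mul_one] at this
    rw [← this, smul_smul, inv_mul_cancel₀ (by positivity), one_smul]
    congr 1; ext θ
    simp [circleMap, circ]
  rw [← intervalIntegral.integral_of_le zero_le_one, ← h1, h2]
  have := Complex.reCLM.intervalIntegral_comp_comm (a := 0) (b := 1) (μ := volume)
    (hc.intervalIntegrable 0 1)
  simpa using this

theorem integrableOn_circ {g : ℂ → ℝ} (hg : ContinuousOn g (sphere 0 1)) :
    Integrable (fun θ => g (circ θ)) (volume.restrict (Ioc (0 : ℝ) 1)) := by
  have hc : Continuous fun θ => g (circ θ) :=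
    hg.comp_continuous continuous_circ fun x => by simp [norm_circ]
  exact (hc.integrableOn_Icc (a := 0) (b := 1)).mono_set Ioc_subset_Icc_self

/-! ### Subharmonicity by harmonic majorants -/

/-- At the centre of the disc, `v` is bounded by the harmonic functions that bound it on the
boundary circle. -/
def SubAt (v : ℂ → EReal) (c : ℂ) (r : ℝ) : Prop :=
  ∀ g : ℂ → ℂ, DiffContOnCl ℂ g (ball c r) → (∀ t ∈ sphere c r, v t ≤ ((g t).re : EReal)) →
    v c ≤ ((g c).re : EReal)

/-- The integral is monotone, and for the majorant Re g it equals the value at the centre by the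
mean value property. -/
theorem subAt_of_le_erealIntegral {v : ℂ → EReal} {c : ℂ} {r : ℝ} (hr : 0 < r)
    (h : v c ≤ erealIntegral (volume.restrict (Ioc (0 : ℝ) 1)) (fun θ => v (c + circ θ * r))) :
    SubAt v c r := by
  intro g hg hle
  have hmaps : MapsTo (fun t : ℂ => c + t * r) (ball 0 1) (ball c r) := by
    intro t ht
    simp only [mem_ball, dist_zero_right] at ht
    simp only [mem_ball, dist_self_add_left, norm_mul, Complex.norm_real, Real.norm_eq_abs,
      abs_of_pos hr]
    nlinarith
  have hdiff : DiffContOnCl ℂ (fun t : ℂ => g (c + t * r)) (ball 0 1) :=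
    hg.comp (g := fun t : ℂ => c + t * r)
      (Differentiable.diffContOnCl (by fun_prop)) hmaps
  refine h.trans ?_
  have h0 := integral_circ_eq hdiff
  simp only [zero_mul, add_zero] at h0
  rw [← h0]
  have hcont : ContinuousOn (fun t : ℂ => (g (c + t * r)).re) (sphere 0 1) := by
    have := hdiff.continuousOn
    rw [closure_ball _ one_ne_zero] at this
    exact Complex.continuous_re.comp_continuousOn (this.mono sphere_subset_closedBall)
  rw [← erealIntegral_coe (integrableOn_circ hcont)]
  apply erealIntegral_mono
  refine ae_of_all _ fun θ => ?_
  apply hle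
  simp [norm_circ, abs_of_pos hr]

/-- On the unit circle, continuous real functions are uniform limits of real parts of entire
functions. -/
theorem exists_entire_approx {g : ℂ → ℝ} (hg : Continuous g) {ε : ℝ} (hε : 0 < ε) :
    ∃ p : ℂ → ℂ, Differentiable ℂ p ∧ ∀ t : ℂ, ‖t‖ = 1 → |(p t).re - g t| < ε := by
  let G : C(AddCircle (1 : ℝ), ℂ) := ⟨fun x => (g (AddCircle.toCircle x : ℂ) : ℂ), by
    exact Complex.continuous_ofReal.comp (hg.comp
      (continuous_subtype_val.comp AddCircle.continuous_toCircle))⟩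
  have : Fact (0 < (1 : ℝ)) := ⟨one_pos⟩
  have hmem : G ∈ (Submodule.span ℂ (range <| @fourier 1)).topologicalClosure := by
    rw [span_fourier_closure_eq_top]; trivial
  obtain ⟨q, hq, hd⟩ := Metric.mem_closure_iff.1 hmem ε hε
  -- On the circle a negative power is the conjugate of a positive one, so a trigonometric
  -- polynomial is a polynomial plus a conjugate polynomial.
  have key : ∃ p₁ p₂ : ℂ → ℂ, Differentiable ℂ p₁ ∧ Differentiable ℂ p₂ ∧
      ∀ x : AddCircle (1 : ℝ), q x = p₁ (AddCircle.toCircle x) + conj (p₂ (AddCircle.toCircle x)) := by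
    refine Submodule.span_induction ?_ ?_ ?_ ?_ (show q ∈ Submodule.span ℂ (range <| @fourier 1) from hq)
    · rintro _ ⟨n, rfl⟩
      obtain ⟨k, rfl | rfl⟩ := n.eq_nat_or_neg
      · refine ⟨fun z => z ^ k, fun _ => 0, by fun_prop, by fun_prop, fun x => ?_⟩
        simp [fourier_apply, AddCircle.toCircle_nsmul]
      · refine ⟨fun _ => 0, fun z => z ^ k, by fun_prop, by fun_prop, fun x => ?_⟩
        rw [fourier_neg]
        simp [fourier_apply, AddCircle.toCircle_nsmul]
    · exact ⟨fun _ => 0, fun _ => 0, by fun_prop, by fun_prop, fun x => by simp⟩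
    · rintro a b _ _ ⟨p₁, p₂, h1, h2, h⟩ ⟨q₁, q₂, k1, k2, k⟩
      refine ⟨p₁ + q₁, p₂ + q₂, h1.add k1, h2.add k2, fun x => ?_⟩
      simp only [ContinuousMap.add_apply, h, k, Pi.add_apply, map_add]; ring
    · rintro c a _ ⟨p₁, p₂, h1, h2, h⟩
      refine ⟨fun z => c * p₁ z, fun z => conj c * p₂ z, h1.const_mul _, h2.const_mul _, fun x => ?_⟩
      simp only [ContinuousMap.smul_apply, h, smul_eq_mul, map_mul, Complex.conj_conj]; ring
  obtain ⟨p₁, p₂, h1, h2, h⟩ := key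
  -- Conjugating the second summand does not change the real part, so the entire function `p₁ + p₂`
  -- does the same work.
  refine ⟨p₁ + p₂, h1.add h2, fun t ht => ?_⟩
  obtain ⟨x, hx⟩ := (AddCircle.homeomorphCircle (T := 1) one_ne_zero).surjective
    ⟨t, by simpa [Submonoid.unitSphere] using ht⟩
  have hx' : ((AddCircle.toCircle x : Circle) : ℂ) = t := by
    have := congrArg (Subtype.val) hx
    simpa [AddCircle.homeomorphCircle_apply] using this
  have hqx := h x
  have hn : ‖G x - q x‖ < ε := by
    rw [← dist_eq_norm]; exact (ContinuousMap.dist_apply_le_dist x).trans_lt hd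
  have hr := (Complex.abs_re_le_norm (G x - q x)).trans_lt hn
  have : (G x - q x).re = g t - (p₁ t + p₂ t).re := by
    rw [hqx, hx']
    simp [G, hx']
  rw [this, abs_sub_comm] at hr
  exact hr

theorem exists_real_bound_of_usc {α : Type*} [TopologicalSpace α] {K : Set α} (hK : IsCompact K)
    {v : α → EReal} (hv : UpperSemicontinuousOn v K) (hlt : ∀ t ∈ K, v t < ⊤) :
    ∃ M : ℝ, 0 ≤ M ∧ ∀ t ∈ K, v t ≤ M := by
  rcases K.eq_empty_or_nonempty with rfl | hne
  · exact ⟨0, le_rfl, by simp⟩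
  obtain ⟨t₀, h₀, hmax⟩ := hv.exists_isMaxOn hne hK
  obtain ⟨r, hr, -⟩ := EReal.lt_iff_exists_real_btwn.1 (hlt t₀ h₀)
  exact ⟨max r 0, le_max_right _ _, fun t ht =>
    (hmax ht).trans (hr.le.trans (EReal.coe_le_coe_iff.2 (le_max_left _ _)))⟩

/-- Upper semicontinuous functions on a compact set are limits of decreasing sequences of
continuous functions. -/
theorem exists_antitone_continuous_approx {K : Set ℂ} (hK : IsCompact K) (hne : K.Nonempty)
    {v : ℂ → EReal} (hv : UpperSemicontinuousOn v K) (hlt : ∀ t ∈ K, v t < ⊤) :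
    ∃ (g : ℕ → ℂ → ℝ) (M : ℝ), 0 ≤ M ∧ (∀ k, Continuous (g k)) ∧ (∀ t, Antitone fun k => g k t) ∧
      (∀ k t, g k t ≤ M) ∧ (∀ k, ∀ t ∈ K, v t ≤ (g k t : EReal)) ∧
      ∀ t ∈ K, Tendsto (fun k => (g k t : EReal)) atTop (𝓝 (v t)) := by
  obtain ⟨M, hM0, hM⟩ := exists_real_bound_of_usc hK hv hlt
  have : Nonempty K := hne.to_subtype
  -- Truncation at level -k makes the values real and is decreasing in k.
  let f : ℕ → K → ℝ := fun k s => (max (v s) ((-(k : ℝ) : ℝ) : EReal)).toReal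
  have hfne : ∀ k (s : K), ((f k s : ℝ) : EReal) = max (v s) ((-(k : ℝ) : ℝ) : EReal) := by
    intro k s
    apply EReal.coe_toReal
    · exact (max_lt (hlt s s.2) (EReal.coe_lt_top _)).ne
    · exact ((EReal.bot_lt_coe _).trans_le (le_max_right _ _)).ne'
  have hfM : ∀ k s, f k s ≤ M := by
    intro k s
    rw [← EReal.coe_le_coe_iff, hfne]
    refine max_le (hM s s.2) (EReal.coe_le_coe_iff.2 ?_)
    have : (0 : ℝ) ≤ k := k.cast_nonneg
    linarith
  have hfanti : ∀ s, Antitone fun k => f k s := by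
    intro s k l hkl
    change f l s ≤ f k s
    rw [← EReal.coe_le_coe_iff, hfne, hfne]
    apply max_le_max le_rfl
    rw [EReal.coe_le_coe_iff]
    have : (k : ℝ) ≤ l := by exact_mod_cast hkl
    linarith
  -- The k-Lipschitz envelope from above of the truncation: continuous, and decreasing in k because
  -- the penalty grows.
  let g : ℕ → ℂ → ℝ := fun k t => ⨆ s : K, (f k s - k * dist t s)
  have hterm : ∀ (k : ℕ) (t : ℂ) (s : K), f k s - k * dist t s ≤ M := by
    intro k t s
    have : 0 ≤ (k : ℝ) * dist t s := by positivity
    linarith [hfM k s]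
  have hbdd : ∀ (k : ℕ) (t : ℂ), BddAbove (range fun s : K => f k s - k * dist t s) := by
    rintro k t
    exact ⟨M, by rintro _ ⟨s, rfl⟩; exact hterm k t s⟩
  have hgv : ∀ k, ∀ t ∈ K, v t ≤ (g k t : EReal) := by
    intro k t ht
    have h1 : f k ⟨t, ht⟩ ≤ g k t := by
      have := le_ciSup (hbdd k t) ⟨t, ht⟩
      simpa using this
    refine le_trans ?_ (EReal.coe_le_coe_iff.2 h1)
    rw [hfne]; exact le_max_left _ _
  refine ⟨g, M, hM0, ?_, ?_, ?_, hgv, ?_⟩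
  · intro k
    have : LipschitzWith (Real.toNNReal k) (g k) := by
      apply LipschitzWith.of_le_add_mul
      intro x y
      apply ciSup_le
      intro s
      have h1 := le_ciSup (hbdd k y) s
      have h2 : dist y s ≤ dist x y + dist x s := by
        rw [dist_comm x y]; exact dist_triangle _ _ _
      have h3 : ((Real.toNNReal k : NNReal) : ℝ) = k := by simp
      rw [h3]
      have h4 : (k : ℝ) * dist y s ≤ k * (dist x y + dist x s) := by gcongr
      change f k s - k * dist y s ≤ g k y at h1
      linarith
    exact this.continuous
  · intro t k l hkl
    change g l t ≤ g k t
    apply ciSup_le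
    intro s
    refine le_trans ?_ (le_ciSup (hbdd k t) s)
    have h1 := hfanti s hkl
    have h2 : (k : ℝ) * dist t s ≤ l * dist t s := by gcongr
    change f l s ≤ f k s at h1
    change _ ≤ f k s - k * dist t s
    linarith
  · intro k t
    exact ciSup_le fun s => hterm k t s
  · intro t ht
    rw [tendsto_order]
    refine ⟨fun y hy => Eventually.of_forall fun k => hy.trans_le (hgv k t ht), fun y hy => ?_⟩
    obtain ⟨r, hr1, hr2⟩ := EReal.lt_iff_exists_real_btwn.1 hy
    obtain ⟨δ, hδ, hball⟩ := Metric.mem_nhdsWithin_iff.1 (hv t ht r hr1)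
    -- `N₁` puts the truncation level below r, which handles the points where v < r. For points at
    -- distance at least δ, `N₂` makes the penalty exceed M - r.
    obtain ⟨N₁, hN₁⟩ := exists_nat_ge (-r)
    obtain ⟨N₂, hN₂⟩ := exists_nat_ge ((M - r) / δ)
    filter_upwards [eventually_ge_atTop (max N₁ N₂)] with k hk
    have hk1 : -r ≤ (k : ℝ) := hN₁.trans (by exact_mod_cast (le_max_left _ _).trans hk)
    have hk2 : (M - r) / δ ≤ (k : ℝ) := hN₂.trans (by exact_mod_cast (le_max_right _ _).trans hk)
    refine lt_of_le_of_lt ?_ hr2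
    rw [EReal.coe_le_coe_iff]
    apply ciSup_le
    intro s
    by_cases hs : dist (s : ℂ) t < δ
    · have h1 : v s < r := hball ⟨hs, s.2⟩
      have h2 : f k s ≤ r := by
        rw [← EReal.coe_le_coe_iff, hfne]
        exact max_le h1.le (EReal.coe_le_coe_iff.2 (by linarith))
      have : 0 ≤ (k : ℝ) * dist t s := by positivity
      linarith
    · push Not at hs
      rw [dist_comm] at hs
      have h1 : (M - r) ≤ k * δ := (div_le_iff₀ hδ).1 hk2
      have h2 : (k : ℝ) * δ ≤ k * dist t s := by gcongr
      linarith [hfM k s]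

/-- The converse of `subAt_of_le_erealIntegral`: it is enough to test against entire functions. -/
theorem le_erealIntegral_of_entire {v : ℂ → EReal} (hv : UpperSemicontinuousOn v (sphere 0 1))
    (hlt : ∀ t ∈ sphere (0 : ℂ) 1, v t < ⊤) {c : EReal}
    (h : ∀ p : ℂ → ℂ, Differentiable ℂ p → (∀ t ∈ sphere (0 : ℂ) 1, v t ≤ ((p t).re : EReal)) →
      c ≤ ((p 0).re : EReal)) :
    c ≤ erealIntegral (volume.restrict (Ioc (0 : ℝ) 1)) (fun θ => v (circ θ)) := by
  obtain ⟨g, M, hM0, hgc, hganti, hgM, hgv, hlim⟩ :=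
    exists_antitone_continuous_approx (isCompact_sphere (0 : ℂ) 1)
      (NormedSpace.sphere_nonempty.2 zero_le_one) hv hlt
  have hcirc : ∀ θ, circ θ ∈ sphere (0 : ℂ) 1 := fun θ => by simp [norm_circ]
  set μ := volume.restrict (Ioc (0 : ℝ) 1) with hμ
  have hint : ∀ k, Integrable (fun θ => g k (circ θ)) μ := fun k =>
    integrableOn_circ (hgc k).continuousOn
  have hck : ∀ k, c ≤ ((∫ θ, g k (circ θ) ∂μ : ℝ) : EReal) := by
    intro k
    by_contra! hcon
    obtain ⟨r, hr1, hr2⟩ := EReal.lt_iff_exists_real_btwn.1 hcon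
    rw [EReal.coe_lt_coe_iff] at hr1
    -- Half the gap: approximating by Re p costs ε, and adding ε to p to get a majorant of v costs
    -- another ε, so c ≤ ∫ g k + 2ε = r < c.
    set ε := (r - ∫ θ, g k (circ θ) ∂μ) / 2 with hε
    have hεpos : 0 < ε := by simp only [hε]; linarith
    obtain ⟨p, hp, hpg⟩ := exists_entire_approx (hgc k) hεpos
    have h1 := h (fun t => p t + ε) (by fun_prop) (by
      intro t ht
      refine (hgv k t ht).trans (EReal.coe_le_coe_iff.2 ?_)
      have := hpg t (by simpa using ht)
      rw [abs_lt] at this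
      simp only [Complex.add_re, Complex.ofReal_re]
      linarith)
    have h2 : (p 0).re ≤ ∫ θ, g k (circ θ) ∂μ + ε := by
      rw [← integral_circ_eq hp.diffContOnCl]
      have : ∫ θ, g k (circ θ) ∂μ + ε = ∫ θ, (g k (circ θ) + ε) ∂μ := by
        rw [integral_add (hint k) (integrable_const _)]
        simp [hμ]
      rw [this]
      apply integral_mono
      · exact integrableOn_circ (g := fun t => (p t).re)
          (Complex.continuous_re.comp hp.continuous).continuousOn
      · exact (hint k).add (integrable_const _)
      · intro θ
        have := hpg (circ θ) (norm_circ θ)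
        rw [abs_lt] at this
        simp only
        linarith
    have h3 := hr2.trans_le h1
    rw [EReal.coe_lt_coe_iff] at h3
    simp only [Complex.add_re, Complex.ofReal_re] at h3
    linarith
  have hmeas : ∀ k, Measurable fun θ => ((g k (circ θ) : ℝ) : EReal) := fun k =>
    measurable_coe_real_ereal.comp ((hgc k).comp continuous_circ).measurable
  have hP : Tendsto (fun k => ∫⁻ θ, ((g k (circ θ) : ℝ) : EReal).toENNReal ∂μ) atTop
      (𝓝 (∫⁻ θ, (v (circ θ)).toENNReal ∂μ)) := by
    apply tendsto_lintegral_of_dominated_convergence (fun _ => ENNReal.ofReal M)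
    · exact fun k => (hmeas k).ereal_toENNReal
    · intro k
      refine ae_of_all _ fun θ => ?_
      simp only [EReal.toENNReal_of_ne_top (EReal.coe_ne_top _), EReal.toReal_coe]
      exact ENNReal.ofReal_le_ofReal (hgM k _)
    · simp [hμ]
    · exact ae_of_all _ fun θ =>
        (EReal.continuous_toENNReal.tendsto _).comp (hlim _ (hcirc θ))
  have hQ : Tendsto (fun k => ∫⁻ θ, (-((g k (circ θ) : ℝ) : EReal)).toENNReal ∂μ) atTop
      (𝓝 (∫⁻ θ, (-(v (circ θ))).toENNReal ∂μ)) := by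
    apply lintegral_tendsto_of_tendsto_of_monotone
    · exact fun k => (hmeas k).neg.ereal_toENNReal.aemeasurable
    · refine ae_of_all _ fun θ k l hkl => ?_
      apply EReal.toENNReal_le_toENNReal
      apply EReal.neg_le_neg_iff.2
      exact EReal.coe_le_coe_iff.2 (hganti (circ θ) hkl)
    · exact ae_of_all _ fun θ =>
        (EReal.continuous_toENNReal.tendsto _).comp
          ((continuous_neg.tendsto _).comp (hlim _ (hcirc θ)))
  have hPfin : ∫⁻ θ, (v (circ θ)).toENNReal ∂μ ≠ ⊤ := by
    apply ne_top_of_le_ne_top (b := ∫⁻ _, ENNReal.ofReal M ∂μ)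
    · simp [hμ]
    · apply lintegral_mono
      intro θ
      have := EReal.toENNReal_le_toENNReal ((hgv 0 _ (hcirc θ)).trans
        (EReal.coe_le_coe_iff.2 (hgM 0 _)))
      simpa [EReal.toENNReal_of_ne_top] using this
  -- Positive parts converge by domination and negative parts by monotonicity. The limit of the
  -- positive parts is finite, so the difference is continuous there even if the other limit is ∞.
  have hT : Tendsto (fun k => erealIntegral μ (fun θ => ((g k (circ θ) : ℝ) : EReal))) atTop
      (𝓝 (erealIntegral μ (fun θ => v (circ θ)))) := by
    unfold erealIntegral
    simp only [sub_eq_add_neg]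
    refine (EReal.continuousAt_add (p := (_, _)) ?_ ?_).tendsto.comp
      (Tendsto.prodMk_nhds ((continuous_coe_ennreal_ereal.tendsto _).comp hP)
      ((continuous_neg.tendsto _).comp ((continuous_coe_ennreal_ereal.tendsto _).comp hQ)))
    · left; simpa using hPfin
    · left; simp
  refine ge_of_tendsto' hT fun k => ?_
  rw [erealIntegral_coe (hint k)]
  exact hck k

theorem EReal_add_coe_le_iff {x : EReal} {a b : ℝ} :
    x + (a : EReal) ≤ (b : EReal) ↔ x ≤ ((b - a : ℝ) : EReal) := by
  induction x with
  | bot => simp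
  | top => simp [-EReal.coe_sub]
  | coe x => norm_cast; constructor <;> intro h <;> linarith

theorem le_coe_of_forall_pos_le_add {x : EReal} {b : ℝ}
    (h : ∀ ε : ℝ, 0 < ε → x ≤ ((b + ε : ℝ) : EReal)) : x ≤ b := by
  by_contra! hcon
  obtain ⟨r, hr1, hr2⟩ := EReal.lt_iff_exists_real_btwn.1 hcon
  have hr1' := EReal.coe_lt_coe_iff.1 hr1
  have := hr2.trans_le (h (r - b) (by linarith))
  rw [EReal.coe_lt_coe_iff] at this
  linarith

/-- The disc of centre c and radius r is the unit disc of the affine line through `a + c • b` with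
direction `r • b`. -/
theorem IsPshOn.subAt {n : ℕ} {Ω : Set (Fin n → ℂ)} {u : (Fin n → ℂ) → EReal} (hu : IsPshOn Ω u)
    {a b : Fin n → ℂ} {c : ℂ} {r : ℝ} (hr : 0 < r)
    (h : ∀ t ∈ closedBall c r, a + t • b ∈ Ω) : SubAt (fun t => u (a + t • b)) c r := by
  apply subAt_of_le_erealIntegral hr
  have := hu.submean (a + c • b) ((r : ℂ) • b) (by
    intro t ht
    have := h (c + t * r) (by
      simp only [mem_closedBall, dist_self_add_left, norm_mul, Complex.norm_real, Real.norm_eq_abs,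
        abs_of_pos hr]
      nlinarith)
    rwa [add_smul, ← add_assoc, ← smul_smul] at this)
  refine this.trans (le_of_eq ?_)
  congr 1
  ext θ
  rw [add_smul, ← add_assoc, ← smul_smul]
  rfl

theorem IsPshOn.of_subAt {n : ℕ} {Ω : Set (Fin n → ℂ)} {u : (Fin n → ℂ) → EReal}
    (hlt : ∀ z ∈ Ω, u z < ⊤) (husc : UpperSemicontinuousOn u Ω)
    (h : ∀ a b : Fin n → ℂ, (∀ t : ℂ, ‖t‖ ≤ 1 → a + t • b ∈ Ω) →
      SubAt (fun t => u (a + t • b)) 0 1) : IsPshOn Ω u := by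
  refine ⟨hlt, husc, fun a b hab => ?_⟩
  have hmaps : MapsTo (fun t : ℂ => a + t • b) (sphere 0 1) Ω := fun t ht =>
    hab t (by simpa using (mem_sphere_zero_iff_norm.1 ht).le)
  have husc' : UpperSemicontinuousOn (fun t : ℂ => u (a + t • b)) (sphere 0 1) :=
    husc.comp (by fun_prop) hmaps
  refine le_erealIntegral_of_entire husc' (fun t ht => hlt _ (hmaps ht)) fun p hp hle => ?_
  simpa using h a b hab p hp.diffContOnCl hle

/-- Subharmonicity is a local property. -/
theorem subAt_of_local {v : ℂ → EReal} (hv : UpperSemicontinuousOn v (closedBall 0 1))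
    (hlt : ∀ t ∈ closedBall (0 : ℂ) 1, v t < ⊤)
    (hloc : ∀ t₀ ∈ ball (0 : ℂ) 1, ∃ ρ > 0, closedBall t₀ ρ ⊆ ball 0 1 ∧ SubAt v t₀ ρ) :
    SubAt v 0 1 := by
  intro g hg hle
  by_contra! hcon
  obtain ⟨r, hr1, hr2⟩ := EReal.lt_iff_exists_real_btwn.1 hcon
  have hr1' := EReal.coe_lt_coe_iff.1 hr1
  -- Maximise v - Re g + δ|t|². This is at most δ on the circle and larger than δ at 0, so the
  -- maximum is interior; the strictly subharmonic term then contradicts the local hypothesis there.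
  set δ := r - (g 0).re with hδ
  have hgc : ContinuousOn g (closedBall 0 1) := by
    have := hg.continuousOn
    rwa [closure_ball _ one_ne_zero] at this
  have hgre : ContinuousOn (fun t => (g t).re) (closedBall 0 1) :=
    Complex.continuous_re.comp_continuousOn hgc
  have hq : ContinuousOn (fun t : ℂ => ((δ * ‖t‖ ^ 2 - (g t).re : ℝ) : EReal)) (closedBall 0 1) := by
    apply continuous_coe_real_ereal.comp_continuousOn
    apply ContinuousOn.sub _ hgre
    fun_prop
  have hw : UpperSemicontinuousOn
      (fun t => v t + ((δ * ‖t‖ ^ 2 - (g t).re : ℝ) : EReal)) (closedBall 0 1) := by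
    apply UpperSemicontinuousOn.add' hv hq.upperSemicontinuousOn
    intro t _
    exact EReal.continuousAt_add (.inr (EReal.coe_ne_bot _)) (.inr (EReal.coe_ne_top _))
  obtain ⟨t₀, ht₀, hmax⟩ := hw.exists_isMaxOn ⟨0, by simp⟩ (isCompact_closedBall 0 1)
  have h0 : (δ : EReal) < v t₀ + ((δ * ‖t₀‖ ^ 2 - (g t₀).re : ℝ) : EReal) := by
    refine lt_of_lt_of_le ?_ (hmax (mem_closedBall_self zero_le_one))
    rw [← not_le, EReal_add_coe_le_iff, not_le]
    refine lt_of_eq_of_lt ?_ hr2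
    simp [hδ]
  have hball : t₀ ∈ ball (0 : ℂ) 1 := by
    by_contra hnot
    have hs : t₀ ∈ sphere (0 : ℂ) 1 := by
      rw [mem_sphere]; rw [mem_closedBall] at ht₀; rw [mem_ball] at hnot; linarith
    rw [← not_le, EReal_add_coe_le_iff] at h0
    apply h0
    have h1 := hle t₀ hs
    rw [mem_sphere_zero_iff_norm] at hs
    simpa [hs] using h1
  obtain ⟨ρ, hρ, hsub, hS⟩ := hloc t₀ hball
  have hbot : v t₀ ≠ ⊥ := by
    intro hb; rw [hb] at h0; simp at h0
  obtain ⟨x, hx⟩ : ∃ x : ℝ, v t₀ = x := ⟨(v t₀).toReal, (EReal.coe_toReal (hlt _ ht₀).ne hbot).symm⟩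
  set m := x + (δ * ‖t₀‖ ^ 2 - (g t₀).re) with hm
  have hle' : ∀ t ∈ closedBall (0 : ℂ) 1,
      v t ≤ ((m - (δ * ‖t‖ ^ 2 - (g t).re) : ℝ) : EReal) := by
    intro t ht
    rw [← EReal_add_coe_le_iff]
    refine (hmax ht).trans (le_of_eq ?_)
    simp only [hx]
    norm_cast
  -- On |t - t₀| = ρ one has |t|² = |t₀|² + ρ² + 2 Re(conj t₀ (t - t₀)), so the majorant is there
  -- the real part of a holomorphic function, whose value at t₀ lies δρ² below v t₀.
  have := hS (fun t => g t + ((m - δ * (‖t₀‖ ^ 2 + ρ ^ 2) : ℝ) : ℂ) - 2 * δ * (conj t₀ * (t - t₀))) (by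
      refine DiffContOnCl.sub (DiffContOnCl.add (hg.mono (ball_subset_closedBall.trans hsub)) ?_) ?_
      · exact diffContOnCl_const
      · exact Differentiable.diffContOnCl (by fun_prop)) (by
      intro t ht
      refine (hle' t (ball_subset_closedBall (hsub (sphere_subset_closedBall ht)))).trans ?_
      rw [EReal.coe_le_coe_iff]
      have h1 : ‖t - t₀‖ ^ 2 = ρ ^ 2 := by rw [mem_sphere_iff_norm.1 ht]
      have e : ∀ w : ℂ, ‖w‖ ^ 2 = w.re ^ 2 + w.im ^ 2 := fun w => by
        rw [Complex.sq_norm, Complex.normSq_apply]; ring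
      rw [e] at h1
      rw [← h1, e t, e t₀]
      simp only [Complex.sub_re, Complex.add_re, Complex.ofReal_re, Complex.mul_re, Complex.re_ofNat,
        Complex.im_ofNat, Complex.ofReal_im, Complex.conj_re, Complex.conj_im, Complex.sub_im,
        Complex.mul_im]
      apply le_of_eq
      ring)
  rw [hx, EReal.coe_le_coe_iff] at this
  simp only [sub_self, mul_zero, sub_zero, Complex.add_re, Complex.ofReal_re, hm] at this
  have : 0 < δ * ρ ^ 2 := by positivity
  linarith

/-- A local holomorphic logarithm. -/
theorem exists_log_branch {F : ℂ → ℂ} {O : Set ℂ} (hO : IsOpen O) (hF : DifferentiableOn ℂ F O)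
    {s₀ : ℂ} (hs : s₀ ∈ O) (h0 : F s₀ ≠ 0) :
    ∃ ρ > 0, ball s₀ ρ ⊆ O ∧ ∃ l : ℂ → ℂ, DifferentiableOn ℂ l (ball s₀ ρ) ∧
      ∀ s ∈ ball s₀ ρ, F s ≠ 0 ∧ Real.log ‖F s‖ = (l s).re := by
  have hc : ContinuousAt (fun s => F s / F s₀) s₀ :=
    ((hF.continuousOn.continuousAt (hO.mem_nhds hs)).div_const _)
  have hslit : ∀ᶠ s in 𝓝 s₀, F s / F s₀ ∈ ball (1 : ℂ) 1 := by
    apply hc.eventually (isOpen_ball.mem_nhds _)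
    simp [div_self h0]
  obtain ⟨ρ, hρ, hball⟩ := Metric.eventually_nhds_iff_ball.1 (hslit.and (hO.eventually_mem hs))
  refine ⟨ρ, hρ, fun s hs => (hball s hs).2,
    fun s => Complex.log (F s / F s₀) + (Real.log ‖F s₀‖ : ℂ), ?_, fun s hs => ?_⟩
  · apply DifferentiableOn.add_const
    apply DifferentiableOn.clog
    · exact (hF.mono fun s hs => (hball s hs).2).div_const _
    · exact fun s hs => Complex.ball_one_subset_slitPlane (hball s hs).1
  · have hne : F s ≠ 0 := by
      intro h
      have := (hball s hs).1
      simp [h] at this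
    refine ⟨hne, ?_⟩
    rw [Complex.add_re, Complex.log_re, Complex.ofReal_re, norm_div,
      Real.log_div (norm_ne_zero_iff.2 hne) (norm_ne_zero_iff.2 h0)]
    ring

theorem ennreal_log_enorm_rpow {w : ℂ} (hw : w ≠ 0) (ε : ℝ) :
    ENNReal.log (‖w‖ₑ ^ ε) = ((ε * Real.log ‖w‖ : ℝ) : EReal) := by
  rw [ENNReal.log_rpow, ← ofReal_norm, ENNReal.log_ofReal_of_pos (norm_pos_iff.2 hw)]
  norm_cast

/-! ### Extension of plurisubharmonic functions across a hypersurface -/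

section Extension

variable {n : ℕ}

/-- The extension of `u` across `E` by upper limits. -/
def limsupExt {α : Type*} [TopologicalSpace α] (E : Set α) (u : α → EReal) (z : α) : EReal :=
  limsup u (𝓝[Eᶜ] z)

/-- A bound on `u` at the points off `E` near z is also a bound at the points off `E` near any z'
close to z. -/
theorem eventually_limsupExt_lt {α : Type*} [TopologicalSpace α] {E : Set α} {u : α → EReal}
    {z : α} {y : EReal} (h : limsupExt E u z < y) : ∀ᶠ z' in 𝓝 z, limsupExt E u z' < y := by
  obtain ⟨y', h1, h2⟩ := exists_between h
  have h3 : ∀ᶠ x in 𝓝[Eᶜ] z, u x < y' := eventually_lt_of_limsup_lt h1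
  rw [eventually_nhdsWithin_iff] at h3
  filter_upwards [eventually_eventually_nhds.2 h3] with z' hz'
  rw [← eventually_nhdsWithin_iff] at hz'
  exact (limsup_le_of_le (h := hz'.mono fun _ => le_of_lt)).trans_lt h2

theorem upperSemicontinuous_limsupExt {α : Type*} [TopologicalSpace α] (E : Set α)
    (u : α → EReal) : UpperSemicontinuous (limsupExt E u) :=
  fun _ _ h => eventually_limsupExt_lt h

/-- Semicontinuity bounds the upper limit by the value. Conversely, as z is not in `E`, the filter
`𝓝[Eᶜ] z` sees the point z itself. -/
theorem limsupExt_eq {α : Type*} [TopologicalSpace α] {E W : Set α} {u : α → EReal} {z : α}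
    (hu : UpperSemicontinuousOn u (W \ E)) (hW : W ∈ 𝓝 z) (hzE : z ∉ E) :
    limsupExt E u z = u z := by
  apply le_antisymm
  · refine le_of_forall_gt_imp_ge_of_dense fun y hy => ?_
    have h1 := hu z ⟨mem_of_mem_nhds hW, hzE⟩ y hy
    have h2 : 𝓝[W \ E] z = 𝓝[Eᶜ] z := by
      rw [sdiff_eq, inter_comm, nhdsWithin_inter_of_mem' (mem_nhdsWithin_of_mem_nhds hW)]
    rw [h2] at h1
    exact limsup_le_of_le (h := h1.mono fun _ => le_of_lt)
  · by_contra! hcon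
    exact lt_irrefl _ ((eventually_lt_of_limsup_lt hcon).self_of_nhdsWithin hzE)

/-- `E` is, near `z`, the zero set of a holomorphic function. -/
def IsHypersurfaceAt (E : Set (Fin n → ℂ)) (z : Fin n → ℂ) : Prop :=
  ∃ B : Set (Fin n → ℂ), IsOpen B ∧ z ∈ B ∧ ∃ f : (Fin n → ℂ) → ℂ, DifferentiableOn ℂ f B ∧
    ∀ y ∈ B, y ∈ E ↔ f y = 0

variable {E : Set (Fin n → ℂ)} {u : (Fin n → ℂ) → EReal}

/-- Add ε log|f|. The sum is -∞ on `E` and, off `E`, locally `u` plus a harmonic function on the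
disc, so it passes the local test everywhere. As |f| ≤ 1, boundary bounds are preserved. At the
centre f ≠ 0, so the correction disappears as ε → 0. -/
theorem le_re_of_disc_off_hypersurface {B : Set (Fin n → ℂ)} (hB : IsOpen B)
    {f : (Fin n → ℂ) → ℂ} (hf : DifferentiableOn ℂ f B) (hf1 : ∀ y ∈ B, ‖f y‖ ≤ 1)
    (hfE : ∀ y ∈ B, y ∈ E ↔ f y = 0) (hu : IsPshOn (B \ E) u)
    (hlt : ∀ z ∈ B, limsupExt E u z < ⊤) {a b : Fin n → ℂ}
    (hab : ∀ t : ℂ, ‖t‖ ≤ 1 → a + t • b ∈ B) (ha : a ∉ E) {G : ℂ → ℂ}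
    (hG : DiffContOnCl ℂ G (ball 0 1))
    (hle : ∀ t ∈ sphere (0 : ℂ) 1, limsupExt E u (a + t • b) ≤ ((G t).re : EReal)) :
    u a ≤ ((G 0).re : EReal) := by
  have haB : a ∈ B := by simpa using hab 0 (by simp)
  have hline : Continuous fun t : ℂ => a + t • b := by fun_prop
  set O : Set ℂ := (fun t : ℂ => a + t • b) ⁻¹' B
  have hOo : IsOpen O := hB.preimage hline
  have hOsub : closedBall (0 : ℂ) 1 ⊆ O := fun t ht => hab t (by simpa using ht)
  set F : ℂ → ℂ := fun t => f (a + t • b) with hF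
  have hFd : DifferentiableOn ℂ F O := hf.comp (t := B) (by fun_prop) (fun t ht => ht)
  have hEq : ∀ y ∈ B, y ∉ E → limsupExt E u y = u y := fun y hy hyE =>
    limsupExt_eq hu.usc (hB.mem_nhds hy) hyE
  have hε : ∀ ε : ℝ, 0 < ε →
      u a + ENNReal.log (‖f a‖ₑ ^ ε) ≤ ((G 0).re : EReal) := by
    intro ε hε
    let v : ℂ → EReal := fun t => limsupExt E u (a + t • b) + ENNReal.log (‖F t‖ₑ ^ ε)
    have hvt : ∀ t ∈ O, v t < ⊤ := by
      intro t ht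
      apply EReal.add_lt_top (hlt _ ht).ne
      rw [Ne, ENNReal.log_eq_top_iff]
      exact (ENNReal.rpow_lt_top_of_nonneg hε.le enorm_ne_top).ne
    have hlogc : ContinuousOn (fun t => ENNReal.log (‖F t‖ₑ ^ ε)) O :=
      ENNReal.continuous_log.comp_continuousOn
        (ENNReal.continuous_rpow_const.comp_continuousOn hFd.continuousOn.enorm)
    have hvusc : UpperSemicontinuousOn v (closedBall 0 1) := by
      apply UpperSemicontinuousOn.add'
      · exact ((upperSemicontinuous_limsupExt E u).upperSemicontinuousOn univ).comp
          hline.continuousOn (fun _ _ => mem_univ _)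
      · exact (hlogc.mono hOsub).upperSemicontinuousOn
      · intro t ht
        apply EReal.continuousAt_add
        · exact .inl (hlt _ (hOsub ht)).ne
        · right
          rw [Ne, ENNReal.log_eq_top_iff]
          exact (ENNReal.rpow_lt_top_of_nonneg hε.le enorm_ne_top).ne
    have hS : SubAt v 0 1 := by
      apply subAt_of_local hvusc (fun t ht => hvt t (hOsub ht))
      intro t₀ ht₀
      obtain ⟨ρ₁, hρ₁, hball₁⟩ := Metric.isOpen_iff.1 isOpen_ball t₀ ht₀
      have ht₀O := hOsub (ball_subset_closedBall ht₀)
      by_cases hF0 : F t₀ = 0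
      · refine ⟨ρ₁ / 2, by positivity,
          (closedBall_subset_ball (by linarith)).trans hball₁, fun g hg _ => ?_⟩
        have : v t₀ = ⊥ := by
          simp only [v, hF0, enorm_zero, ENNReal.zero_rpow_of_pos hε, ENNReal.log_zero,
            EReal.add_bot]
        rw [this]; exact bot_le
      · obtain ⟨ρ₂, hρ₂, hball₂, l, hl, hlF⟩ := exists_log_branch hOo hFd ht₀O hF0
        set ρ := min ρ₁ ρ₂ / 2 with hρ
        have hmin : 0 < min ρ₁ ρ₂ := lt_min hρ₁ hρ₂
        have hρ1 : ρ < ρ₁ := by have := min_le_left ρ₁ ρ₂; simp only [hρ]; linarith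
        have hρ2 : ρ < ρ₂ := by have := min_le_right ρ₁ ρ₂; simp only [hρ]; linarith
        have hρ0 : 0 < ρ := by simp only [hρ]; linarith
        refine ⟨ρ, hρ0, (closedBall_subset_ball hρ1).trans hball₁, fun g hg hgle => ?_⟩
        have hin : ∀ t ∈ closedBall t₀ ρ, a + t • b ∈ B \ E := by
          intro t ht
          have ht2 := closedBall_subset_ball hρ2 ht
          refine ⟨hball₂ ht2, ?_⟩
          rw [hfE _ (hball₂ ht2)]
          exact (hlF t ht2).1
        have hv : ∀ t ∈ closedBall t₀ ρ, v t = u (a + t • b) + ((ε * (l t).re : ℝ) : EReal) := by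
          intro t ht
          have ht2 := closedBall_subset_ball hρ2 ht
          simp only [v]
          rw [ennreal_log_enorm_rpow (hlF t ht2).1, (hlF t ht2).2, hEq _ (hin t ht).1 (hin t ht).2]
        have hlc : DiffContOnCl ℂ l (ball t₀ ρ) := by
          apply DifferentiableOn.diffContOnCl
          rw [closure_ball _ hρ0.ne']
          exact hl.mono (closedBall_subset_ball hρ2)
        have := hu.subAt hρ0 hin (fun t => g t - ε * l t) (hg.sub (hlc.const_smul (ε : ℂ))) (by
          intro t ht
          have h1 := hgle t ht
          rw [hv t (sphere_subset_closedBall ht), EReal_add_coe_le_iff] at h1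
          simpa using h1)
        rw [hv t₀ (mem_closedBall_self hρ0.le), EReal_add_coe_le_iff]
        simpa using this
    have h1 := hS G hG (by
      intro t ht
      refine le_trans ?_ (hle t ht)
      have : ENNReal.log (‖F t‖ₑ ^ ε) ≤ 0 := by
        rw [ENNReal.log_le_zero_iff]
        apply ENNReal.rpow_le_one _ hε.le
        rw [← ofReal_norm]
        exact ENNReal.ofReal_le_one.2 (hf1 _ (hOsub (sphere_subset_closedBall ht)))
      calc v t ≤ limsupExt E u (a + t • b) + 0 := add_le_add le_rfl this
        _ = _ := add_zero _)
    simp only [v, hF, zero_smul, add_zero] at h1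
    rwa [hEq a haB ha] at h1
  have hfa : f a ≠ 0 := fun h => ha ((hfE a haB).2 h)
  apply le_coe_of_forall_pos_le_add
  intro η hη
  have hln : Real.log ‖f a‖ ≤ 0 := Real.log_nonpos (norm_nonneg _) (hf1 a haB)
  -- This ε makes -ε log|f a| at most η; the 1 keeps the denominator positive when |f a| = 1.
  have h1 := hε (η / (1 - Real.log ‖f a‖)) (by apply div_pos hη; linarith)
  rw [ennreal_log_enorm_rpow hfa, EReal_add_coe_le_iff] at h1
  refine h1.trans (EReal.coe_le_coe_iff.2 ?_)
  have h2 : η / (1 - Real.log ‖f a‖) * (1 - Real.log ‖f a‖) = η :=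
    div_mul_cancel₀ _ (by linarith)
  nlinarith

/-- A plurisubharmonic function that is bounded above near a hypersurface extends across it. -/
theorem isPshOn_limsupExt {Ω : Set (Fin n → ℂ)} (hΩ : IsOpen Ω) (hu : IsPshOn (Ω \ E) u)
    (hE : ∀ z ∈ Ω, IsHypersurfaceAt E z)
    (hbdd : ∀ z ∈ Ω, limsupExt E u z < ⊤) : IsPshOn Ω (limsupExt E u) := by
  apply IsPshOn.of_subAt hbdd ((upperSemicontinuous_limsupExt E u).upperSemicontinuousOn Ω)
  intro a b hab
  have hline : Continuous fun t : ℂ => a + t • b := by fun_prop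
  refine subAt_of_local ?_ (fun t ht => hbdd _ (hab t (by simpa using ht))) ?_
  · exact ((upperSemicontinuous_limsupExt E u).upperSemicontinuousOn univ).comp
      hline.continuousOn (fun _ _ => mem_univ _)
  -- The value at z₀ is an upper limit of values `u z` with z off `E`. Each of these is bounded
  -- through the disc translated to the centre z, where the previous lemma applies; the boundary
  -- bound survives the translation up to κ.
  intro t₀ ht₀
  set z₀ := a + t₀ • b with hz₀
  have hz₀Ω : z₀ ∈ Ω := hab t₀ (by simpa using (mem_ball.1 ht₀).le)
  obtain ⟨B, hB, hzB, f, hf, hfE⟩ := hE z₀ hz₀Ω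
  have hfc : ContinuousAt f z₀ := hf.continuousOn.continuousAt (hB.mem_nhds hzB)
  have hev : ∀ᶠ z in 𝓝 z₀, (z ∈ B ∧ z ∈ Ω) ∧ ‖f z‖ < ‖f z₀‖ + 1 :=
    ((hB.eventually_mem hzB).and (hΩ.eventually_mem hz₀Ω)).and
      (hfc.norm.eventually (gt_mem_nhds (by linarith)))
  obtain ⟨η, hη, hball⟩ := Metric.eventually_nhds_iff_ball.1 hev
  set C := ‖f z₀‖ + 1
  have hCpos : 0 < C := by positivity
  obtain ⟨ρ₁, hρ₁, hball₁⟩ := Metric.isOpen_iff.1 isOpen_ball t₀ ht₀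
  -- With `ρ * ‖b‖ < η / 2`, translated discs with centres in the ball of radius η/2 stay in the
  -- ball of radius η.
  obtain ⟨ρ, hρ0, hρ1, hρb⟩ : ∃ ρ > 0, ρ < ρ₁ ∧ ρ * ‖b‖ < η / 2 := by
    refine ⟨min (ρ₁ / 2) (η / (4 * (‖b‖ + 1))), by positivity, ?_, ?_⟩
    · exact (min_le_left _ _).trans_lt (by linarith)
    · calc _ ≤ η / (4 * (‖b‖ + 1)) * ‖b‖ := by gcongr; exact min_le_right _ _
        _ ≤ η / (4 * (‖b‖ + 1)) * (‖b‖ + 1) := by gcongr; linarith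
        _ = η / 4 := by field_simp
        _ < η / 2 := by linarith
  refine ⟨ρ, hρ0, (closedBall_subset_ball hρ1).trans hball₁, fun g hg hgle => ?_⟩
  apply le_coe_of_forall_pos_le_add
  intro κ hκ
  have hgc : ContinuousOn g (closedBall t₀ ρ) := by
    have := hg.continuousOn
    rwa [closure_ball _ hρ0.ne'] at this
  -- upper semicontinuity in the centre, uniformly over the circle
  have htube : ∀ᶠ z in 𝓝 z₀, ∀ t ∈ (univ : Set (sphere t₀ ρ)),
      limsupExt E u (z + ((t : ℂ) - t₀) • b) < (((g t).re + κ : ℝ) : EReal) := by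
    apply isCompact_univ.eventually_forall_of_forall_eventually
    rintro ⟨t, ht⟩ -
    have hlt : limsupExt E u (a + t • b) < (((g t).re + κ / 2 : ℝ) : EReal) :=
      (hgle t ht).trans_lt (EReal.coe_lt_coe_iff.2 (by linarith))
    have h1 : Tendsto (fun p : (Fin n → ℂ) × sphere t₀ ρ => p.1 + ((p.2 : ℂ) - t₀) • b)
        (𝓝 (z₀, ⟨t, ht⟩)) (𝓝 (a + t • b)) := by
      have hcont : Continuous fun p : (Fin n → ℂ) × sphere t₀ ρ => p.1 + ((p.2 : ℂ) - t₀) • b := by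
        fun_prop
      have := hcont.tendsto (z₀, ⟨t, ht⟩)
      have e : z₀ + (t - t₀) • b = a + t • b := by rw [hz₀, sub_smul]; abel
      simpa only [e] using this
    have h2 : Tendsto (fun p : (Fin n → ℂ) × sphere t₀ ρ => (g p.2).re)
        (𝓝 (z₀, ⟨t, ht⟩)) (𝓝 (g t).re) := by
      have hcont : Continuous fun p : (Fin n → ℂ) × sphere t₀ ρ => (g p.2).re := by
        apply Complex.continuous_re.comp
        exact hgc.comp_continuous (continuous_subtype_val.comp continuous_snd)
          fun p => sphere_subset_closedBall p.2.2
      exact hcont.tendsto (z₀, ⟨t, ht⟩)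
    filter_upwards [h1.eventually (eventually_limsupExt_lt hlt),
      h2.eventually (lt_mem_nhds (a := (g t).re - κ / 2) (by linarith))] with p hp1 hp2
    exact hp1.trans (EReal.coe_lt_coe_iff.2 (by linarith))
  have hmain : ∀ᶠ z in 𝓝[Eᶜ] z₀, u z ≤ (((g t₀).re + κ : ℝ) : EReal) := by
    filter_upwards [self_mem_nhdsWithin, mem_nhdsWithin_of_mem_nhds htube,
      mem_nhdsWithin_of_mem_nhds (ball_mem_nhds z₀ (half_pos hη))] with z hzE hztube hzball
    have hsubΩ : ball z₀ η \ E ⊆ Ω \ E := fun y hy => ⟨(hball y hy.1).1.2, hy.2⟩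
    have hu' : IsPshOn (ball z₀ η \ E) u :=
      ⟨fun y hy => hu.lt_top y (hsubΩ hy), hu.usc.mono hsubΩ,
        fun a b h => hu.submean a b fun t ht => hsubΩ (h t ht)⟩
    have hmaps : MapsTo (fun s : ℂ => t₀ + s * ρ) (ball 0 1) (ball t₀ ρ) := by
      intro t ht
      simp only [mem_ball, dist_zero_right] at ht
      simp only [mem_ball, dist_self_add_left, norm_mul, Complex.norm_real, Real.norm_eq_abs,
        abs_of_pos hρ0]
      nlinarith
    have hGd : DiffContOnCl ℂ (fun s : ℂ => g (t₀ + s * ρ) + (κ : ℂ)) (ball 0 1) :=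
      (hg.comp (g := fun s : ℂ => t₀ + s * ρ)
        (Differentiable.diffContOnCl (by fun_prop)) hmaps).add diffContOnCl_const
    have := le_re_of_disc_off_hypersurface (E := E) (u := u) (B := ball z₀ η) isOpen_ball
      (f := fun z => f z / C) (by
        simpa only [div_eq_mul_inv] using (hf.mono fun y hy => (hball y hy).1.1).mul_const _)
      (fun y hy => by
        rw [norm_div, Complex.norm_real, Real.norm_eq_abs, abs_of_pos hCpos]
        exact (div_le_one hCpos).2 (hball y hy).2.le)
      (fun y hy => by
        rw [hfE y (hball y hy).1.1, div_eq_zero_iff]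
        simp [hCpos.ne'])
      hu' (fun y hy => hbdd y (hball y hy).1.2) (a := z) (b := (ρ : ℂ) • b)
      (fun t ht => by
        rw [mem_ball, dist_eq_norm]
        rw [mem_ball, dist_eq_norm] at hzball
        calc ‖z + t • (ρ : ℂ) • b - z₀‖ = ‖(z - z₀) + t • (ρ : ℂ) • b‖ := by congr 1; abel
          _ ≤ ‖z - z₀‖ + ‖t • (ρ : ℂ) • b‖ := norm_add_le _ _
          _ ≤ ‖z - z₀‖ + 1 * (ρ * ‖b‖) := by
              rw [norm_smul, norm_smul, Complex.norm_real, Real.norm_eq_abs, abs_of_pos hρ0]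
              gcongr
          _ < η := by linarith)
      hzE hGd (by
        intro t ht
        have h1 := hztube ⟨t₀ + t * ρ, by
          simp [mem_sphere_zero_iff_norm.1 ht, abs_of_pos hρ0]⟩ (mem_univ _)
        simp only [add_sub_cancel_left, mul_smul] at h1
        simpa using h1.le)
    simpa using this
  exact limsup_le_of_le (h := hmain)

end Extension

/-! ### Jensen's inequality and consequences on small circles -/

theorem enorm_toReal_le (x : EReal) : ‖x.toReal‖ₑ ≤ x.toENNReal + (-x).toENNReal := by
  induction x with
  | bot => simp
  | top => simp
  | coe x =>
    rw [← EReal.coe_neg, EReal.toENNReal_of_ne_top (EReal.coe_ne_top _),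
      EReal.toENNReal_of_ne_top (EReal.coe_ne_top _)]
    simp only [EReal.toReal_coe]
    rcases le_total 0 x with h | h
    · rw [Real.enorm_of_nonneg h]; exact le_self_add
    · rw [← enorm_neg, Real.enorm_of_nonneg (neg_nonneg.2 h)]; exact le_add_self

/-- Jensen's inequality for the square of the exponential. -/
theorem sq_le_lintegral_sq {α : Type*} [MeasurableSpace α] {μ : Measure α} [IsProbabilityMeasure μ]
    {φ : α → ℝ≥0∞} (hφ : Measurable φ) {M : ℝ} (hM : ∀ a, ENNReal.log (φ a) ≤ M) {x : ℝ≥0∞}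
    (hx : x ≠ ⊤) (h : ENNReal.log x ≤ erealIntegral μ (fun a => ENNReal.log (φ a))) :
    x ^ 2 ≤ ∫⁻ a, φ a ^ 2 ∂μ := by
  rcases eq_or_ne x 0 with rfl | hx0
  · simp
  have hlogx := ENNReal.log_pos_real hx0 hx
  set c := Real.log x.toReal with hc
  have hψ : Measurable fun a => ENNReal.log (φ a) := hφ.ennreal_log
  have hP : ∫⁻ a, (ENNReal.log (φ a)).toENNReal ∂μ < ⊤ := by
    apply lt_of_le_of_lt (b := ∫⁻ _, (M : EReal).toENNReal ∂μ)
    · exact lintegral_mono fun a => EReal.toENNReal_le_toENNReal (hM a)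
    · simp [EReal.toENNReal_of_ne_top]
  -- Were it infinite, the integral would be -∞, below the real number log x.
  have hQ : ∫⁻ a, (-ENNReal.log (φ a)).toENNReal ∂μ < ⊤ := by
    rw [lt_top_iff_ne_top]
    intro hQ
    rw [hlogx, erealIntegral, hQ] at h
    simp at h
  have hne : ∀ᵐ a ∂μ, ENNReal.log (φ a) ≠ ⊥ := by
    filter_upwards [ae_lt_top hψ.neg.ereal_toENNReal hQ.ne] with a ha hb
    simp [Pi.neg_apply, hb] at ha
  have hreal : ∀ᵐ a ∂μ, (((ENNReal.log (φ a)).toReal : ℝ) : EReal) = ENNReal.log (φ a) := by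
    filter_upwards [hne] with a ha
    exact EReal.coe_toReal ((hM a).trans_lt (EReal.coe_lt_top _)).ne ha
  have hint : Integrable (fun a => (ENNReal.log (φ a)).toReal) μ := by
    refine ⟨hψ.ereal_toReal.aestronglyMeasurable, ?_⟩
    refine lt_of_le_of_lt (lintegral_mono fun a => enorm_toReal_le _) ?_
    rw [lintegral_add_left hψ.ereal_toENNReal]
    exact ENNReal.add_lt_top.2 ⟨hP, hQ⟩
  have hcle : c ≤ ∫ a, (ENNReal.log (φ a)).toReal ∂μ := by
    rw [← EReal.coe_le_coe_iff, ← erealIntegral_coe hint, ← hlogx]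
    exact h.trans (erealIntegral_mono (hreal.mono fun a ha => ha.ge))
  have hxe : x = ENNReal.ofReal (Real.exp c) := by
    rw [hc, Real.exp_log (ENNReal.toReal_pos hx0 hx), ENNReal.ofReal_toReal hx]
  -- The tangent line of y ↦ exp(2y) at y = c, evaluated at log φ; convexity puts it below φ².
  set g : α → ℝ := fun a => Real.exp (2 * c) * (1 + 2 * ((ENNReal.log (φ a)).toReal - c)) with hg
  have hgint : Integrable g μ :=
    ((integrable_const _).add ((hint.sub (integrable_const _)).const_mul _)).const_mul _
  have hgi : Real.exp (2 * c) ≤ ∫ a, g a ∂μ := by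
    have : ∫ a, g a ∂μ =
        Real.exp (2 * c) * (1 + 2 * (∫ a, (ENNReal.log (φ a)).toReal ∂μ - c)) := by
      simp only [hg]
      have h1 : Integrable (fun a => 2 * ((ENNReal.log (φ a)).toReal - c)) μ :=
        (hint.sub (integrable_const c)).const_mul 2
      rw [integral_const_mul, integral_add (integrable_const _) h1, integral_const_mul,
        integral_sub hint (integrable_const _)]
      simp
    rw [this]
    have := Real.exp_pos (2 * c)
    nlinarith
  calc x ^ 2 = ENNReal.ofReal (Real.exp (2 * c)) := by
        rw [hxe, ← ENNReal.ofReal_pow (Real.exp_pos _).le, ← Real.exp_nat_mul]; norm_num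
    _ ≤ ENNReal.ofReal (∫ a, g a ∂μ) := ENNReal.ofReal_le_ofReal hgi
    _ ≤ ∫⁻ a, ENNReal.ofReal (g a) ∂μ := by
        rw [integral_eq_lintegral_pos_part_sub_lintegral_neg_part hgint]
        refine ENNReal.ofReal_le_of_le_toReal ?_
        linarith [ENNReal.toReal_nonneg (a := ∫⁻ a, ENNReal.ofReal (-g a) ∂μ)]
    _ ≤ ∫⁻ a, φ a ^ 2 ∂μ := by
        apply lintegral_mono_ae
        filter_upwards [hreal] with a ha
        have h1 : φ a = ENNReal.ofReal (Real.exp (ENNReal.log (φ a)).toReal) := by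
          apply ENNReal.log_injective
          rw [ENNReal.log_ofReal_of_pos (Real.exp_pos _), Real.log_exp, ha]
        set y := (ENNReal.log (φ a)).toReal
        rw [h1, ← ENNReal.ofReal_pow (Real.exp_pos _).le, ← Real.exp_nat_mul]
        apply ENNReal.ofReal_le_ofReal
        have h2 : Real.exp (((2 : ℕ) : ℝ) * y) = Real.exp (2 * c) * Real.exp (2 * (y - c)) := by
          rw [← Real.exp_add]; congr 1; push_cast; ring
        rw [h2]
        simp only [hg]
        gcongr
        linarith [Real.add_one_le_exp (2 * (y - c))]

section

variable {n : ℕ} {Ω : Set (Fin n → ℂ)}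

theorem exists_small_punctured_disc (hΩ : IsOpen Ω) {z c : Fin n → ℂ} (hz : z ∈ Ω)
    {P : (Fin n → ℂ) → Prop} (hP : ∀ᶠ t in 𝓝[≠] (0 : ℂ), P (z + t • c)) :
    ∃ ρ > 0, (∀ t ∈ closedBall (0 : ℂ) ρ, z + t • c ∈ Ω) ∧ ∀ t ∈ sphere (0 : ℂ) ρ, P (z + t • c) := by
  have h1 : ∀ᶠ t in 𝓝 (0 : ℂ), z + t • c ∈ Ω := by
    have : Continuous fun t : ℂ => z + t • c := by fun_prop
    exact this.continuousAt.eventually (hΩ.mem_nhds (by simpa using hz))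
  rw [eventually_nhdsWithin_iff] at hP
  obtain ⟨ε, hε, hb⟩ := Metric.eventually_nhds_iff_ball.1 (h1.and hP)
  refine ⟨ε / 2, by positivity, fun t ht => (hb t (closedBall_subset_ball (by linarith) ht)).1,
    fun t ht => (hb t (closedBall_subset_ball (by linarith) (sphere_subset_closedBall ht))).2 ?_⟩
  rintro rfl
  simp at ht
  linarith

/-- A plurisubharmonic function is determined by its values outside a hypersurface. -/
theorem IsPshOn.eq_limsupExt (hΩ : IsOpen Ω) {u : (Fin n → ℂ) → EReal} (hu : IsPshOn Ω u)
    {E : Set (Fin n → ℂ)} {z c : Fin n → ℂ} (hz : z ∈ Ω)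
    (hc : ∀ᶠ t in 𝓝[≠] (0 : ℂ), z + t • c ∉ E) : u z = limsupExt E u z := by
  apply le_antisymm
  · refine le_of_forall_gt_imp_ge_of_dense fun y hy => ?_
    obtain ⟨r, hr1, hr2⟩ := EReal.lt_iff_exists_real_btwn.1 hy
    have h1 : ∀ᶠ x in 𝓝[Eᶜ] z, u x < r := eventually_lt_of_limsup_lt hr1
    have h2 : Tendsto (fun t : ℂ => z + t • c) (𝓝[≠] 0) (𝓝[Eᶜ] z) := by
      apply tendsto_nhdsWithin_iff.2 ⟨?_, hc⟩
      have : Continuous fun t : ℂ => z + t • c := by fun_prop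
      simpa using (this.tendsto 0).mono_left nhdsWithin_le_nhds
    -- A small circle on the line in direction c avoids `E`, and there `u < r`; the constant r is a
    -- harmonic majorant.
    obtain ⟨ρ, hρ, hin, hlt⟩ := exists_small_punctured_disc (P := fun x => u x < r) hΩ hz
      (h2.eventually h1)
    have := hu.subAt hρ hin (fun _ => (r : ℂ)) diffContOnCl_const
      (fun t ht => by simpa using (hlt t ht).le)
    simp only [zero_smul, add_zero, Complex.ofReal_re] at this
    exact this.trans hr2.le
  · refine le_of_forall_gt_imp_ge_of_dense fun y hy => ?_
    have h1 := hu.usc z hz y hy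
    rw [nhdsWithin_eq_nhds.2 (hΩ.mem_nhds hz)] at h1
    exact limsup_le_of_le (h := (h1.filter_mono nhdsWithin_le_nhds).mono fun _ => le_of_lt)

/-- By Jensen, squares of log-plurisubharmonic norms satisfy the sub-mean value inequality. Squared
norms can thus be added and averaged over one circle missing the centre, which is how the
parallelogram inequality will reach `D`. -/
theorem add_sq_le_of_punctured_disc (hΩ : IsOpen Ω) {N₁ N₂ : (Fin n → ℂ) → ℝ≥0∞}
    (h₁ : IsPshOn Ω fun z => ENNReal.log (N₁ z)) (h₂ : IsPshOn Ω fun z => ENNReal.log (N₂ z))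
    {z c : Fin n → ℂ} (hz : z ∈ Ω) {K : ℝ≥0∞}
    (hK : ∀ᶠ t in 𝓝[≠] (0 : ℂ), N₁ (z + t • c) ^ 2 + N₂ (z + t • c) ^ 2 ≤ K) :
    N₁ z ^ 2 + N₂ z ^ 2 ≤ K := by
  obtain ⟨ρ, hρ, hin, hle⟩ := exists_small_punctured_disc
    (P := fun x => N₁ x ^ 2 + N₂ x ^ 2 ≤ K) hΩ hz hK
  set μ := volume.restrict (Ioc (0 : ℝ) 1) with hμ
  have : IsProbabilityMeasure μ := ⟨by simp [hμ]⟩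
  set γ : ℝ → (Fin n → ℂ) := fun θ => z + circ θ • (ρ : ℂ) • c with hγ
  have hγc : Continuous γ := by
    have := continuous_circ
    simp only [hγ]; fun_prop
  have hγΩ : ∀ θ, γ θ ∈ Ω := by
    intro θ
    have := hin (circ θ * ρ) (by simp [norm_circ, abs_of_pos hρ])
    rwa [mul_smul] at this
  have key : ∀ N : (Fin n → ℂ) → ℝ≥0∞, IsPshOn Ω (fun z => ENNReal.log (N z)) →
      Measurable (fun θ => N (γ θ)) ∧ N z ^ 2 ≤ ∫⁻ θ, N (γ θ) ^ 2 ∂μ := by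
    intro N hN
    have husc : UpperSemicontinuous fun θ => ENNReal.log (N (γ θ)) := by
      rw [← upperSemicontinuousOn_univ_iff]
      exact hN.usc.comp hγc.continuousOn fun θ _ => hγΩ θ
    have hmeas : Measurable fun θ => N (γ θ) := by
      have := husc.measurable.ereal_exp
      simpa using this
    refine ⟨hmeas, ?_⟩
    have hcomp : IsCompact (sphere (0 : ℂ) 1) := isCompact_sphere 0 1
    have hmaps : MapsTo (fun t : ℂ => z + t • (ρ : ℂ) • c) (sphere 0 1) Ω := by
      intro t ht
      have := hin (t * ρ) (by simp [mem_sphere_zero_iff_norm.1 ht, abs_of_pos hρ])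
      rwa [mul_smul] at this
    obtain ⟨M, -, hM⟩ := exists_real_bound_of_usc hcomp
      (v := fun t => ENNReal.log (N (z + t • (ρ : ℂ) • c)))
      (hN.usc.comp (g := fun t : ℂ => z + t • (ρ : ℂ) • c) (by fun_prop) hmaps)
      (fun t ht => hN.lt_top _ (hmaps ht))
    have hz' := hN.lt_top z hz
    rw [ENNReal.log_lt_top_iff] at hz'
    refine sq_le_lintegral_sq hmeas (M := M) (fun θ => hM (circ θ) (by simp [norm_circ])) hz'.ne ?_
    refine hN.submean z ((ρ : ℂ) • c) fun t ht => ?_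
    have := hin (t * ρ) (by
      simp only [mem_closedBall, dist_zero_right, norm_mul, Complex.norm_real, Real.norm_eq_abs,
        abs_of_pos hρ]
      nlinarith)
    rwa [mul_smul] at this
  obtain ⟨hm, k₁⟩ := key N₁ h₁
  obtain ⟨-, k₂⟩ := key N₂ h₂
  calc N₁ z ^ 2 + N₂ z ^ 2 ≤ ∫⁻ θ, N₁ (γ θ) ^ 2 ∂μ + ∫⁻ θ, N₂ (γ θ) ^ 2 ∂μ := add_le_add k₁ k₂
    _ = ∫⁻ θ, N₁ (γ θ) ^ 2 + N₂ (γ θ) ^ 2 ∂μ := (lintegral_add_left (hm.pow_const 2) _).symm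
    _ ≤ ∫⁻ _, K ∂μ := by
        apply lintegral_mono
        intro θ
        have := hle (circ θ * ρ) (by simp [norm_circ, abs_of_pos hρ])
        simpa only [hγ, mul_smul] using this
    _ = K := by simp

end

/-! ### The hermitian form of a finite hermitian norm -/

/-- The properties of the hermitian inner product `B` with norm `q`. -/
structure IsHermitianForm {V : Type*} [AddCommGroup V] [Module ℂ V] (B : V → V → ℂ)
    (q : V → ℝ) : Prop where
  add_left : ∀ u v w, B (u + v) w = B u w + B v w
  smul_left : ∀ (c : ℂ) u w, B (c • u) w = c * B u w
  conj_symm : ∀ u v, conj (B u v) = B v u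
  self : ∀ v, B v v = ((q v ^ 2 : ℝ) : ℂ)
  cauchySchwarz : ∀ u v, ‖B u v‖ ^ 2 ≤ q u ^ 2 * q v ^ 2

/-- The Jordan–von Neumann theorem. -/
theorem isHermitianForm_polarForm {V : Type*} [AddCommGroup V] [Module ℂ V] {N : V → ℝ≥0∞}
    (hN : IsSingularHermitianInner N) (hF : IsFinitePosDef N) :
    IsHermitianForm (polarForm N) (fun v => (N v).toReal) := by
  let : Norm V := ⟨fun v => (N v).toReal⟩
  have hnorm : ∀ v : V, ‖v‖ = (N v).toReal := fun _ => rfl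
  have core : NormedSpace.Core ℂ V :=
    { norm_nonneg := fun x => ENNReal.toReal_nonneg
      norm_smul := fun c x => by
        rcases eq_or_ne c 0 with rfl | hc
        · simp [hnorm, hN.map_zero]
        · rw [hnorm, hN.map_smul c x hc, ENNReal.toReal_mul, toReal_enorm, hnorm]
      norm_triangle := fun x y => by
        simp only [hnorm]
        rw [← ENNReal.toReal_add (hF.1 x) (hF.1 y)]
        exact ENNReal.toReal_mono (ENNReal.add_ne_top.2 ⟨hF.1 x, hF.1 y⟩) (hN.triangle x y)
      norm_eq_zero_iff := fun x => by
        simp only [hnorm, ENNReal.toReal_eq_zero_iff, hF.1 x, or_false]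
        exact ⟨hF.2 x, fun h => by rw [h, hN.map_zero]⟩ }
  let : NormedAddCommGroup V := NormedAddCommGroup.ofCore core
  let : NormedSpace ℂ V := NormedSpace.ofCore core
  have hpar : ∀ x y : V, ‖x + y‖ * ‖x + y‖ + ‖x - y‖ * ‖x - y‖ = 2 * (‖x‖ * ‖x‖ + ‖y‖ * ‖y‖) := by
    intro x y
    have := congrArg ENNReal.toReal (hN.parallelogram x y)
    rw [ENNReal.toReal_add (ENNReal.pow_ne_top (hF.1 _)) (ENNReal.pow_ne_top (hF.1 _)),
      ENNReal.toReal_add (ENNReal.mul_ne_top (by simp) (ENNReal.pow_ne_top (hF.1 _)))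
        (ENNReal.mul_ne_top (by simp) (ENNReal.pow_ne_top (hF.1 _)))] at this
    simp only [ENNReal.toReal_mul, ENNReal.toReal_pow, ENNReal.toReal_ofNat] at this
    simp only [hnorm]
    linarith
  let : InnerProductSpace ℂ V := InnerProductSpace.ofNorm ℂ hpar
  -- The arguments are swapped because `polarForm` is linear in the first variable and `inner` in
  -- the second.
  have hB : ∀ u v : V, polarForm N u v = inner ℂ v u := by
    intro u v
    rw [← inner_conj_symm, inner_eq_sum_norm_sq_div_four]
    unfold polarForm
    simp only [hnorm, map_div₀, map_add, map_sub, map_mul, map_pow, RCLike.I_to_complex,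
      Complex.conj_I, Complex.coe_algebraMap, Complex.conj_ofReal, map_ofNat]
    push_cast
    ring
  refine ⟨fun u v w => ?_, fun c u w => ?_, fun u v => ?_, fun v => ?_, fun u v => ?_⟩
  · simp only [hB, inner_add_right]
  · simp only [hB, inner_smul_right]
  · simp only [hB, inner_conj_symm]
  · rw [hB, inner_self_eq_norm_sq_to_K]
    simp [hnorm]
  · rw [hB]
    have := norm_inner_le_norm (𝕜 := ℂ) v u
    calc ‖inner ℂ v u‖ ^ 2 ≤ (‖v‖ * ‖u‖) ^ 2 := by gcongr
      _ = _ := by rw [hnorm, hnorm]; ring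

namespace IsHermitianForm

variable {V : Type*} [AddCommGroup V] [Module ℂ V] {B : V → V → ℂ} {q : V → ℝ}

theorem add_right (h : IsHermitianForm B q) (u v w : V) : B u (v + w) = B u v + B u w := by
  rw [← h.conj_symm, h.add_left, map_add, h.conj_symm, h.conj_symm]

theorem smul_right (h : IsHermitianForm B q) (c : ℂ) (u v : V) :
    B u (c • v) = conj c * B u v := by
  rw [← h.conj_symm, h.smul_left, map_mul, h.conj_symm]

theorem zero_left (h : IsHermitianForm B q) (w : V) : B 0 w = 0 := by
  simpa using h.smul_left 0 0 w

theorem sum_left (h : IsHermitianForm B q) {ι : Type*} (s : Finset ι) (f : ι → V) (w : V) :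
    B (∑ i ∈ s, f i) w = ∑ i ∈ s, B (f i) w := by
  classical
  induction s using Finset.induction_on with
  | empty => simp [h.zero_left]
  | insert a s ha ih => rw [Finset.sum_insert ha, Finset.sum_insert ha, h.add_left, ih]

theorem sum_right (h : IsHermitianForm B q) {ι : Type*} (s : Finset ι) (f : ι → V) (w : V) :
    B w (∑ i ∈ s, f i) = ∑ i ∈ s, B w (f i) := by
  rw [← h.conj_symm, h.sum_left, map_sum]
  simp only [h.conj_symm]

end IsHermitianForm

section Matrix

variable {n : ℕ} {B : (Fin n → ℂ) → (Fin n → ℂ) → ℂ} {q : (Fin n → ℂ) → ℝ}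

theorem IsHermitianForm.eq_sum (h : IsHermitianForm B q) (u v : Fin n → ℂ) :
    B u v = ∑ i, ∑ j, B (Pi.single i 1) (Pi.single j 1) * u i * conj (v j) := by
  conv_lhs => rw [pi_eq_sum_univ' u, pi_eq_sum_univ' v]
  rw [h.sum_left]
  refine Finset.sum_congr rfl fun i _ => ?_
  rw [h.sum_right]
  refine Finset.sum_congr rfl fun j _ => ?_
  rw [h.smul_left, h.smul_right]
  ring

/-- The Cauchy–Schwarz inequality between a hermitian form and its dual form. -/
theorem IsHermitianForm.dual_cauchySchwarz (h : IsHermitianForm B q)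
    (hq : ∀ v, q v = 0 → v = 0) {H : Matrix (Fin n) (Fin n) ℂ}
    (hH : ∀ i j, H i j = B (Pi.single i 1) (Pi.single j 1)) (w v : Fin n → ℂ) :
    ‖∑ k, w k * conj (v k)‖ ^ 2 ≤
      (∑ k, ∑ l, w k * H⁻¹ k l * conj (w l)).re * q v ^ 2 := by
  have hBsum : ∀ u v : Fin n → ℂ, B u v = ∑ k, Matrix.vecMul u H k * conj (v k) := by
    intro u v
    rw [h.eq_sum, Finset.sum_comm]
    refine Finset.sum_congr rfl fun k _ => ?_
    rw [Matrix.vecMul, dotProduct, Finset.sum_mul]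
    refine Finset.sum_congr rfl fun i _ => ?_
    rw [hH]; ring
  have hdet : IsUnit H.det := by
    rw [isUnit_iff_ne_zero]
    intro hdet
    obtain ⟨u, hu0, hu⟩ := Matrix.exists_vecMul_eq_zero_iff.2 hdet
    have h1 : B u u = 0 := by rw [hBsum, hu]; simp
    rw [h.self] at h1
    apply hu0 (hq u _)
    have h2 : q u ^ 2 = 0 := by exact_mod_cast h1
    exact pow_eq_zero_iff (two_ne_zero) |>.1 h2
  -- The vector y represents the functional w, that is B(y, v) = ∑ w_k conj v_k, and the dual norm
  -- of w is B(y, y); ordinary Cauchy–Schwarz then applies.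
  set y := Matrix.vecMul w H⁻¹ with hy
  have hyw : Matrix.vecMul y H = w := by
    rw [hy, Matrix.vecMul_vecMul, Matrix.nonsing_inv_mul H hdet, Matrix.vecMul_one]
  have h1 : B y v = ∑ k, w k * conj (v k) := by rw [hBsum, hyw]
  have h2 : ∑ k, ∑ l, w k * H⁻¹ k l * conj (w l) = B y y := by
    rw [← h.conj_symm, hBsum, hyw, map_sum, Finset.sum_comm]
    refine Finset.sum_congr rfl fun l _ => ?_
    rw [map_mul, Complex.conj_conj, hy, Matrix.vecMul, dotProduct, ← Finset.sum_mul, mul_comm]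
  rw [h2, ← h1, h.self, Complex.ofReal_re]
  exact h.cauchySchwarz y v

end Matrix

/-! ### Curvature along complex lines -/

section Curvature

variable {n : ℕ}

theorem dHol_congr {f g : (Fin n → ℂ) → ℂ} {z : Fin n → ℂ} (h : f =ᶠ[𝓝 z] g) (v : Fin n → ℂ) :
    dHol v f z = dHol v g z := by
  unfold dHol; rw [h.fderiv_eq]

theorem dBar_congr {f g : (Fin n → ℂ) → ℂ} {z : Fin n → ℂ} (h : f =ᶠ[𝓝 z] g) (v : Fin n → ℂ) :
    dBar v f z = dBar v g z := by
  unfold dBar; rw [h.fderiv_eq]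

theorem fderiv_sum_sum_mul {f : Fin n → Fin n → (Fin n → ℂ) → ℂ} {c : Fin n → Fin n → ℂ}
    {z : Fin n → ℂ} (hf : ∀ i j, DifferentiableAt ℝ (f i j) z) (v : Fin n → ℂ) :
    fderiv ℝ (fun w => ∑ i, ∑ j, f i j w * c i j) z v =
      ∑ i, ∑ j, fderiv ℝ (f i j) z v * c i j := by
  have h : HasFDerivAt (fun w => ∑ i, ∑ j, f i j w * c i j)
      (∑ i, ∑ j, (MulOpposite.op (c i j)) • fderiv ℝ (f i j) z) z :=
    HasFDerivAt.fun_sum fun i _ => HasFDerivAt.fun_sum fun j _ =>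
      (hf i j).hasFDerivAt.mul_const' (c i j)
  rw [h.fderiv]
  simp [mul_comm]

theorem dHol_sum_sum_mul {f : Fin n → Fin n → (Fin n → ℂ) → ℂ} {c : Fin n → Fin n → ℂ}
    {z : Fin n → ℂ} (hf : ∀ i j, DifferentiableAt ℝ (f i j) z) (v : Fin n → ℂ) :
    dHol v (fun w => ∑ i, ∑ j, f i j w * c i j) z = ∑ i, ∑ j, dHol v (f i j) z * c i j := by
  simp only [dHol, fderiv_sum_sum_mul hf, Finset.mul_sum, ← Finset.sum_sub_distrib]
  exact Finset.sum_congr rfl fun i _ => Finset.sum_congr rfl fun j _ => by ring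

theorem dBar_sum_sum_mul {f : Fin n → Fin n → (Fin n → ℂ) → ℂ} {c : Fin n → Fin n → ℂ}
    {z : Fin n → ℂ} (hf : ∀ i j, DifferentiableAt ℝ (f i j) z) (v : Fin n → ℂ) :
    dBar v (fun w => ∑ i, ∑ j, f i j w * c i j) z = ∑ i, ∑ j, dBar v (f i j) z * c i j := by
  simp only [dBar, fderiv_sum_sum_mul hf, Finset.mul_sum, ← Finset.sum_add_distrib]
  exact Finset.sum_congr rfl fun i _ => Finset.sum_congr rfl fun j _ => by ring

theorem dBar_conj {f : (Fin n → ℂ) → ℂ} {z : Fin n → ℂ} (hf : DifferentiableAt ℝ f z)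
    (v : Fin n → ℂ) : dBar v (fun w => conj (f w)) z = conj (dHol v f z) := by
  have h : ∀ u, fderiv ℝ (fun w => conj (f w)) z u = conj (fderiv ℝ f z u) := by
    intro u
    have : HasFDerivAt (fun w => conj (f w))
        ((Complex.conjCLE : ℂ →L[ℝ] ℂ).comp (fderiv ℝ f z)) z :=
      (Complex.conjCLE : ℂ →L[ℝ] ℂ).hasFDerivAt.comp z hf.hasFDerivAt
    rw [this.fderiv]; simp
  simp only [dBar, dHol, h, map_mul, map_sub, map_div₀, map_one, map_ofNat, Complex.conj_I]
  ring

theorem fderiv_ofReal {g : (Fin n → ℂ) → ℝ} {z : Fin n → ℂ} (hg : DifferentiableAt ℝ g z)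
    (v : Fin n → ℂ) : fderiv ℝ (fun w => (g w : ℂ)) z v = (fderiv ℝ g z v : ℂ) := by
  have : HasFDerivAt (fun w => (g w : ℂ)) (Complex.ofRealCLM.comp (fderiv ℝ g z)) z :=
    Complex.ofRealCLM.hasFDerivAt.comp z hg.hasFDerivAt
  rw [this.fderiv]; simp

theorem norm_sq_dHol_ofReal {g : (Fin n → ℂ) → ℝ} {z : Fin n → ℂ} (hg : DifferentiableAt ℝ g z)
    (v : Fin n → ℂ) : ‖dHol v (fun w => (g w : ℂ)) z‖ ^ 2 =
      (1 / 4) * (fderiv ℝ g z v ^ 2 + fderiv ℝ g z (Complex.I • v) ^ 2) := by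
  rw [dHol, fderiv_ofReal hg, fderiv_ofReal hg, Complex.sq_norm, Complex.normSq_apply]
  simp
  ring

/-- The operator ∂_v ∂̄_v is a quarter of the Laplacian of the complex line in direction v; the
mixed derivatives only enter the imaginary part. -/
theorem re_dHol_dBar_ofReal {U : Set (Fin n → ℂ)} (hU : IsOpen U) {g : (Fin n → ℂ) → ℝ}
    (hg : ContDiffOn ℝ ∞ g U) {z : Fin n → ℂ} (hz : z ∈ U) (v : Fin n → ℂ) :
    (dHol v (dBar v fun w => (g w : ℂ)) z).re =
      (1 / 4) * (fderiv ℝ (fun w => fderiv ℝ g w v) z v +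
        fderiv ℝ (fun w => fderiv ℝ g w (Complex.I • v)) z (Complex.I • v)) := by
  have hd : ∀ u : Fin n → ℂ, DifferentiableAt ℝ (fun w => fderiv ℝ g w u) z := by
    intro u
    have h1 : ContDiffAt ℝ 1 (fderiv ℝ g) z :=
      (hg.contDiffAt (hU.mem_nhds hz)).fderiv_right (m := 1) (by norm_cast)
    exact (h1.differentiableAt one_ne_zero).clm_apply (differentiableAt_const u)
  have he : (dBar v fun w => (g w : ℂ)) =ᶠ[𝓝 z] fun w => (1 / 2 : ℂ) * ((fderiv ℝ g w v : ℂ) +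
      Complex.I * (fderiv ℝ g w (Complex.I • v) : ℂ)) := by
    filter_upwards [hU.mem_nhds hz] with w hw
    have := (hg.contDiffAt (hU.mem_nhds hw)).differentiableAt (by simp)
    simp only [dBar, fderiv_ofReal this]
  have hF : ∀ u, fderiv ℝ (fun w => (1 / 2 : ℂ) * ((fderiv ℝ g w v : ℂ) +
      Complex.I * (fderiv ℝ g w (Complex.I • v) : ℂ))) z u =
      (1 / 2 : ℂ) * ((fderiv ℝ (fun w => fderiv ℝ g w v) z u : ℂ) +
        Complex.I * (fderiv ℝ (fun w => fderiv ℝ g w (Complex.I • v)) z u : ℂ)) := by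
    intro u
    have hc : ∀ u, HasFDerivAt (fun w => (fderiv ℝ g w u : ℂ))
        (Complex.ofRealCLM.comp (fderiv ℝ (fun w => fderiv ℝ g w u) z)) z := fun u =>
      Complex.ofRealCLM.hasFDerivAt.comp z (hd u).hasFDerivAt
    have := ((hc v).add ((hc (Complex.I • v)).const_mul Complex.I)).const_mul (1 / 2 : ℂ)
    erw [this.fderiv]
    simp [mul_add]
  rw [dHol_congr he, dHol, hF, hF]
  simp
  ring

/-- If the holomorphic sectional curvature is at most `-A`, the squared norm `G` of a constant
vector field `b` satisfies `4 A G ≤ Δ log G` along the complex lines in the direction `b`. -/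
theorem laplacian_log_ge_of_curvature_le {U : Set (Fin n → ℂ)} (hU : IsOpen U)
    {M : (Fin n → ℂ) → (Fin n → ℂ) → ℝ≥0∞} {H : (Fin n → ℂ) → Matrix (Fin n) (Fin n) ℂ}
    (hM : ∀ z ∈ U, IsHermitianForm (polarForm (M z)) (fun v => (M z v).toReal))
    (hpos : ∀ z ∈ U, ∀ v, (M z v).toReal = 0 → v = 0)
    (hH : ∀ z i j, H z i j = polarForm (M z) (Pi.single i 1) (Pi.single j 1))
    (hsm : ∀ i j, ContDiffOn ℝ ∞ (fun z => H z i j) U) (b : Fin n → ℂ) :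
    ContDiffOn ℝ ∞ (fun w => (M w b).toReal ^ 2) U ∧
    ∀ z ∈ U, ∀ A : ℝ, (∑ i, ∑ j, (- dHol b (dBar b fun w => H w i j) z +
      ∑ p, ∑ q, dHol b (fun w => H w i q) z * (H z)⁻¹ q p *
        dBar b (fun w => H w p j) z) * b i * conj (b j)).re ≤ -A * (M z b).toReal ^ 4 →
      b ≠ 0 →
      4 * A * (M z b).toReal ^ 2 ≤
        (fderiv ℝ (fun w => fderiv ℝ (fun w => (M w b).toReal ^ 2) w b) z b +
          fderiv ℝ (fun w => fderiv ℝ (fun w => (M w b).toReal ^ 2) w (Complex.I • b)) z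
            (Complex.I • b)) / (M z b).toReal ^ 2 -
        (fderiv ℝ (fun w => (M w b).toReal ^ 2) z b ^ 2 +
          fderiv ℝ (fun w => (M w b).toReal ^ 2) z (Complex.I • b) ^ 2) /
          ((M z b).toReal ^ 2) ^ 2 := by
  set G : (Fin n → ℂ) → ℝ := fun w => (M w b).toReal ^ 2 with hG
  set Gc : (Fin n → ℂ) → ℂ := fun w => ∑ i, ∑ j, H w i j * (b i * conj (b j)) with hGc
  have hGeq : ∀ w ∈ U, (G w : ℂ) = Gc w := by
    intro w hw
    have h1 := (hM w hw).self b
    have h2 := (hM w hw).eq_sum b b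
    simp only [hG, hGc, hH]
    rw [← h1, h2]
    exact Finset.sum_congr rfl fun i _ => Finset.sum_congr rfl fun j _ => by ring
  have hGcsm : ContDiffOn ℝ ∞ Gc U :=
    ContDiffOn.sum fun i _ => ContDiffOn.sum fun j _ => (hsm i j).mul contDiffOn_const
  have hGsm : ContDiffOn ℝ ∞ G U := by
    have h1 : ContDiffOn ℝ ∞ (fun w => (Gc w).re) U := Complex.reCLM.contDiff.comp_contDiffOn hGcsm
    exact h1.congr fun w hw => by rw [← hGeq w hw, Complex.ofReal_re]
  refine ⟨hGsm, fun z hz A hcurv hb => ?_⟩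
  have hdiff : ∀ w ∈ U, ∀ i j, DifferentiableAt ℝ (fun z => H z i j) w := fun w hw i j =>
    ((hsm i j).contDiffAt (hU.mem_nhds hw)).differentiableAt (by simp)
  have hevG : (fun w => (G w : ℂ)) =ᶠ[𝓝 z] Gc := by
    filter_upwards [hU.mem_nhds hz] with w hw using hGeq w hw
  have hGdiff : DifferentiableAt ℝ G z :=
    (hGsm.contDiffAt (hU.mem_nhds hz)).differentiableAt (by simp)
  -- the second order term
  have hdBarH : ∀ i j, DifferentiableAt ℝ (dBar b fun w => H w i j) z := by
    intro i j
    have h1 : ContDiffAt ℝ 1 (fderiv ℝ (fun w => H w i j)) z :=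
      ((hsm i j).contDiffAt (hU.mem_nhds hz)).fderiv_right (m := 1) (by norm_cast)
    have h2 : ∀ u : Fin n → ℂ, DifferentiableAt ℝ (fun w => fderiv ℝ (fun w => H w i j) w u) z :=
      fun u => (h1.differentiableAt one_ne_zero).clm_apply (differentiableAt_const u)
    exact ((h2 b).add ((h2 (Complex.I • b)).const_mul Complex.I)).const_mul (1 / 2 : ℂ)
  have hsecond : dHol b (dBar b fun w => (G w : ℂ)) z =
      ∑ i, ∑ j, dHol b (dBar b fun w => H w i j) z * (b i * conj (b j)) := by
    have he : (dBar b fun w => (G w : ℂ)) =ᶠ[𝓝 z]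
        fun w => ∑ i, ∑ j, (dBar b fun w => H w i j) w * (b i * conj (b j)) := by
      filter_upwards [hU.mem_nhds hz] with w hw
      have : (fun w => (G w : ℂ)) =ᶠ[𝓝 w] Gc := by
        filter_upwards [hU.mem_nhds hw] with x hx using hGeq x hx
      rw [dBar_congr this, hGc, dBar_sum_sum_mul (hdiff w hw)]
    rw [dHol_congr he, dHol_sum_sum_mul hdBarH]
  -- the first order term
  set τ : Fin n → ℂ := fun k => ∑ i, dHol b (fun w => H w i k) z * b i with hτ
  have hfirst : dHol b (fun w => (G w : ℂ)) z = ∑ k, τ k * conj (b k) := by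
    rw [dHol_congr hevG, hGc, dHol_sum_sum_mul (hdiff z hz), Finset.sum_comm]
    refine Finset.sum_congr rfl fun k _ => ?_
    rw [hτ, Finset.sum_mul]
    exact Finset.sum_congr rfl fun i _ => by ring
  have hconj : ∀ p j, dBar b (fun w => H w p j) z = conj (dHol b (fun w => H w j p) z) := by
    intro p j
    rw [← dBar_conj (hdiff z hz j p)]
    apply dBar_congr
    filter_upwards [hU.mem_nhds hz] with w hw
    rw [hH, hH, (hM w hw).conj_symm]
  have hthird : ∑ i, ∑ j, (∑ p, ∑ q, dHol b (fun w => H w i q) z * (H z)⁻¹ q p *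
        dBar b (fun w => H w p j) z) * b i * conj (b j) =
      ∑ k, ∑ l, τ k * (H z)⁻¹ k l * conj (τ l) := by
    simp only [hτ, map_sum, map_mul, Finset.sum_mul, Finset.mul_sum, hconj]
    have e1 : ∀ i j : Fin n, ∑ p, ∑ q, dHol b (fun w => H w i q) z * (H z)⁻¹ q p *
        conj (dHol b (fun w => H w j p) z) * b i * conj (b j) =
        ∑ q, ∑ p, dHol b (fun w => H w i q) z * (H z)⁻¹ q p *
        conj (dHol b (fun w => H w j p) z) * b i * conj (b j) := fun i j => Finset.sum_comm
    simp only [e1]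
    have e2 : ∀ i : Fin n, ∑ j, ∑ q, ∑ p, dHol b (fun w => H w i q) z * (H z)⁻¹ q p *
        conj (dHol b (fun w => H w j p) z) * b i * conj (b j) =
        ∑ q, ∑ p, ∑ j, dHol b (fun w => H w i q) z * (H z)⁻¹ q p *
        conj (dHol b (fun w => H w j p) z) * b i * conj (b j) := fun i => by
      rw [Finset.sum_comm]
      exact Finset.sum_congr rfl fun q _ => Finset.sum_comm
    simp only [e2]
    rw [Finset.sum_comm]
    refine Finset.sum_congr rfl fun q _ => ?_
    rw [Finset.sum_comm]
    refine Finset.sum_congr rfl fun p _ => ?_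
    rw [Finset.sum_comm]
    refine Finset.sum_congr rfl fun j _ => Finset.sum_congr rfl fun i _ => ?_
    ring
  have hsplit : ∑ i, ∑ j, (- dHol b (dBar b fun w => H w i j) z +
      ∑ p, ∑ q, dHol b (fun w => H w i q) z * (H z)⁻¹ q p *
        dBar b (fun w => H w p j) z) * b i * conj (b j) =
      - dHol b (dBar b fun w => (G w : ℂ)) z + ∑ k, ∑ l, τ k * (H z)⁻¹ k l * conj (τ l) := by
    rw [← hthird, hsecond, ← Finset.sum_neg_distrib, ← Finset.sum_add_distrib]
    refine Finset.sum_congr rfl fun i _ => ?_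
    rw [← Finset.sum_neg_distrib, ← Finset.sum_add_distrib]
    exact Finset.sum_congr rfl fun j _ => by ring
  rw [hsplit, Complex.add_re, Complex.neg_re, re_dHol_dBar_ofReal hU hGsm hz] at hcurv
  -- Dual Cauchy–Schwarz bounds the term with H⁻¹ below by |∂_b G|²/G. So ∂∂̄ log G = (∂∂̄G -
  -- |∂G|²/G)/G is at least minus the curvature term divided by G, hence at least A G, and Δ = 4∂∂̄.
  have hcs := (hM z hz).dual_cauchySchwarz (hpos z hz) (hH z) τ b
  rw [← hfirst, norm_sq_dHol_ofReal hGdiff] at hcs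
  have hGpos : 0 < G z := by
    have : (M z b).toReal ≠ 0 := fun h => hb (hpos z hz b h)
    positivity
  have hG4 : (M z b).toReal ^ 4 = G z ^ 2 := by simp only [hG]; ring
  rw [hG4] at hcurv
  change _ ≤ _ * G z at hcs
  change 4 * A * G z ≤ _ / G z - _ / G z ^ 2
  rw [le_sub_iff_add_le, ← sub_nonneg]
  set a₁ := fderiv ℝ (fun w => fderiv ℝ G w b) z b
  set a₂ := fderiv ℝ (fun w => fderiv ℝ G w (Complex.I • b)) z (Complex.I • b)
  set c₁ := fderiv ℝ G z b
  set c₂ := fderiv ℝ G z (Complex.I • b)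
  set T := (∑ k, ∑ l, τ k * (H z)⁻¹ k l * conj (τ l)).re
  have e : (a₁ + a₂) / G z - (4 * A * G z + (c₁ ^ 2 + c₂ ^ 2) / G z ^ 2) =
      ((a₁ + a₂) * G z - 4 * A * G z ^ 2 * G z - (c₁ ^ 2 + c₂ ^ 2)) / G z ^ 2 := by
    field_simp
    ring
  rw [e]
  apply div_nonneg _ (by positivity)
  nlinarith

end Curvature

/-! ### The Ahlfors–Schwarz lemma -/

/-- A positive second derivative would make 0 a local minimum as well, so p would be locally
constant and its second derivative zero. -/
theorem second_deriv_nonpos_of_isLocalMax {p p₁ : ℝ → ℝ} {p₂ : ℝ}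
    (h1 : ∀ᶠ s in 𝓝 0, HasDerivAt p (p₁ s) s) (h2 : HasDerivAt p₁ p₂ 0) (hmax : IsLocalMax p 0) :
    p₂ ≤ 0 := by
  by_contra! hpos
  have he : deriv p =ᶠ[𝓝 0] p₁ := h1.mono fun s hs => hs.deriv
  have hdd : deriv (deriv p) 0 = p₂ := by rw [he.deriv_eq, h2.deriv]
  have hmin : IsLocalMin p 0 := isLocalMin_of_deriv_deriv_pos (by rwa [hdd])
    hmax.deriv_eq_zero h1.self_of_nhds.continuousAt
  have hconst : p =ᶠ[𝓝 0] fun _ => p 0 := by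
    filter_upwards [hmax, hmin] with s hs1 hs2 using le_antisymm hs1 hs2
  have h3 : deriv p =ᶠ[𝓝 0] fun _ => 0 := by
    have := hconst.deriv
    simpa using this
  have : deriv (deriv p) 0 = 0 := by rw [h3.deriv_eq]; simp
  linarith

theorem hasDerivAt_log_twice {g g₁ : ℝ → ℝ} {g₂ : ℝ} (h1 : ∀ᶠ s in 𝓝 0, HasDerivAt g (g₁ s) s)
    (h2 : HasDerivAt g₁ g₂ 0) (h0 : 0 < g 0) :
    (∀ᶠ s in 𝓝 0, HasDerivAt (fun s => Real.log (g s)) (g₁ s / g s) s) ∧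
      HasDerivAt (fun s => g₁ s / g s) (g₂ / g 0 - g₁ 0 ^ 2 / g 0 ^ 2) 0 := by
  have hc : ContinuousAt g 0 := h1.self_of_nhds.continuousAt
  constructor
  · filter_upwards [h1, hc.eventually (lt_mem_nhds h0)] with s hs hs0
    exact hs.log hs0.ne'
  · refine (h2.div h1.self_of_nhds h0.ne').congr_deriv ?_
    field_simp

section Ahlfors

variable {n : ℕ}

/-- The complement of `U` in `Ω` is, locally in `Ω`, an analytic subset. -/
def HasAnalyticComplement (Ω U : Set (Fin n → ℂ)) : Prop :=
  ∀ z ∈ Ω, ∃ W : Set (Fin n → ℂ), IsOpen W ∧ z ∈ W ∧ ∃ (k : ℕ) (f : Fin k → (Fin n → ℂ) → ℂ),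
    (∀ j, DifferentiableOn ℂ (f j) W) ∧ ∀ y ∈ W, y ∉ U ↔ ∀ j, f j y = 0

variable {Ω U : Set (Fin n → ℂ)}

/-- Restricted to the line, each defining function either vanishes near t₁ or has no zero in a
punctured neighbourhood. -/
theorem HasAnalyticComplement.line_alternative (hU : HasAnalyticComplement Ω U)
    {a b : Fin n → ℂ} {t₁ : ℂ} (h : a + t₁ • b ∈ Ω) :
    (∀ᶠ t in 𝓝 t₁, a + t • b ∉ U) ∨ ∀ᶠ t in 𝓝[≠] t₁, a + t • b ∈ U := by
  obtain ⟨W, hW, hzW, k, f, hf, hiff⟩ := hU _ h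
  have hline : Continuous fun t : ℂ => a + t • b := by fun_prop
  have hO : IsOpen ((fun t : ℂ => a + t • b) ⁻¹' W) := hW.preimage hline
  have hev : ∀ᶠ t in 𝓝 t₁, a + t • b ∈ W := hO.mem_nhds hzW
  have han : ∀ j, AnalyticAt ℂ (fun t : ℂ => f j (a + t • b)) t₁ := by
    intro j
    have : DifferentiableOn ℂ (fun t : ℂ => f j (a + t • b)) ((fun t : ℂ => a + t • b) ⁻¹' W) :=
      (hf j).comp (t := W) (by fun_prop) fun t ht => ht
    exact this.analyticAt (hO.mem_nhds hzW)
  by_cases hall : ∀ j, ∀ᶠ t in 𝓝 t₁, f j (a + t • b) = 0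
  · left
    filter_upwards [hev, eventually_all.2 hall] with t ht h0
    exact (hiff _ ht).2 h0
  · right
    obtain ⟨j, hj⟩ := not_forall.1 hall
    have hne := (han j).eventually_eq_zero_or_eventually_ne_zero.resolve_left hj
    filter_upwards [hne, nhdsWithin_le_nhds hev] with t ht hW'
    by_contra hcon
    exact ht ((hiff _ hW').1 hcon j)

/-- The two alternatives cut the connected disc into disjoint open sets. The centre belongs to the
second, so the points outside `U` are isolated, and compactness makes them finitely many. -/
theorem HasAnalyticComplement.finite_disc (hU : HasAnalyticComplement Ω U) (hUo : IsOpen U)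
    {a b : Fin n → ℂ} (hab : ∀ t : ℂ, ‖t‖ ≤ 1 → a + t • b ∈ Ω) (ha : a ∈ U) :
    {t ∈ closedBall (0 : ℂ) 1 | a + t • b ∉ U}.Finite := by
  set U₁ : Set ℂ := {t | ∀ᶠ t' in 𝓝 t, a + t' • b ∉ U}
  set U₂ : Set ℂ := {t | ∀ᶠ t' in 𝓝[≠] t, a + t' • b ∈ U}
  have hU₁ : IsOpen U₁ := isOpen_setOfPred_eventually_nhds
  have hU₂ : IsOpen U₂ := isOpen_setOfPred_eventually_nhdsWithin
  have hcov : closedBall (0 : ℂ) 1 ⊆ U₁ ∪ U₂ := fun t ht =>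
    hU.line_alternative (hab t (by simpa using ht))
  have hconn : IsPreconnected (closedBall (0 : ℂ) 1) := (convex_closedBall 0 1).isPreconnected
  have hdisj : U₁ ∩ U₂ = ∅ := by
    ext t
    simp only [mem_inter_iff, mem_empty_iff_false, iff_false, not_and]
    intro h1 h2
    have h3 : ∀ᶠ t' in 𝓝[≠] t, a + t' • b ∉ U := Eventually.filter_mono nhdsWithin_le_nhds h1
    have h4 : ∀ᶠ t' in 𝓝[≠] t, a + t' • b ∈ U := h2
    obtain ⟨t', ht1, ht2⟩ := (h3.and h4).exists
    exact ht1 ht2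
  have h0 : (0 : ℂ) ∈ U₂ := by
    have hline : Continuous fun t : ℂ => a + t • b := by fun_prop
    exact nhdsWithin_le_nhds ((hUo.preimage hline).mem_nhds (by simpa using ha))
  have hsub : closedBall (0 : ℂ) 1 ⊆ U₂ := by
    intro t ht
    rcases hcov ht with h | h
    · obtain ⟨x, -, hx⟩ := hconn U₁ U₂ hU₁ hU₂ hcov ⟨t, ht, h⟩ ⟨0, by simp, h0⟩
      rw [hdisj] at hx
      exact absurd hx (notMem_empty x)
    · exact h
  by_contra hinf
  obtain ⟨x, hx, hacc⟩ := Set.Infinite.exists_accPt_of_subset_isCompact hinf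
    (isCompact_closedBall (0 : ℂ) 1) (sep_subset _ _)
  rw [accPt_iff_frequently_nhdsNE] at hacc
  have hx₂ : ∀ᶠ t in 𝓝[≠] x, a + t • b ∈ U := hsub hx
  exact hacc (hx₂.mono fun t ht h => h.2 ht)

/-- The test for a maximum of `G (1 - |t|²)² |F|^{2ε}` on a disc. -/
theorem mul_sq_le_of_isLocalMax {G : (Fin n → ℂ) → ℝ} (hU : IsOpen U) (hG : ContDiffOn ℝ ∞ G U)
    {a b : Fin n → ℂ} {t₀ : ℂ} (ht₀ : ‖t₀‖ < 1) (hz : a + t₀ • b ∈ U) (hpos : 0 < G (a + t₀ • b))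
    {A ε : ℝ} (hA : 0 < A)
    (hlap : 4 * A * G (a + t₀ • b) ≤ (fderiv ℝ (fun w => fderiv ℝ G w b) (a + t₀ • b) b +
          fderiv ℝ (fun w => fderiv ℝ G w (Complex.I • b)) (a + t₀ • b) (Complex.I • b)) /
            G (a + t₀ • b) -
        (fderiv ℝ G (a + t₀ • b) b ^ 2 + fderiv ℝ G (a + t₀ • b) (Complex.I • b) ^ 2) /
          G (a + t₀ • b) ^ 2)
    {l : ℂ → ℂ} {O : Set ℂ} (hO : IsOpen O) (hl : DifferentiableOn ℂ l O) (ht₀O : t₀ ∈ O)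
    (hmax : IsLocalMax (fun t : ℂ => (1 / 2) * Real.log (G (a + t • b)) +
      Real.log (1 - ‖t‖ ^ 2) + ε * (l t).re) t₀) :
    G (a + t₀ • b) * (1 - ‖t₀‖ ^ 2) ^ 2 ≤ 2 / A := by
  set z₀ := a + t₀ • b with hz₀
  have hq0 : 0 < 1 - ‖t₀‖ ^ 2 := by have := norm_nonneg t₀; nlinarith
  -- The second derivative test along the real line through t₀ in the unit direction d.
  have key : ∀ d : ℂ, ‖d‖ = 1 →
      (1 / 2) * (fderiv ℝ (fun w => fderiv ℝ G w (d • b)) z₀ (d • b) / G z₀ -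
        fderiv ℝ G z₀ (d • b) ^ 2 / G z₀ ^ 2) +
      (-2 / (1 - ‖t₀‖ ^ 2) - (-2 * (conj t₀ * d).re) ^ 2 / (1 - ‖t₀‖ ^ 2) ^ 2) +
      ε * (deriv (deriv l) t₀ * d * d).re ≤ 0 := by
    intro d hd
    have hlinec : Continuous fun s : ℝ => t₀ + (s : ℂ) * d := by fun_prop
    have hlined : ∀ s : ℝ, HasDerivAt (fun s : ℝ => t₀ + (s : ℂ) * d) d s := fun s => by
      simpa using ((Complex.ofRealCLM.hasDerivAt (x := s)).mul_const d).const_add t₀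
    have hγd : ∀ s : ℝ, HasDerivAt (fun s : ℝ => z₀ + s • (d • b)) (d • b) s := fun s => by
      simpa using ((hasDerivAt_id s).smul_const (d • b)).const_add z₀
    have hγeq : ∀ s : ℝ, a + (t₀ + (s : ℂ) * d) • b = z₀ + s • (d • b) := fun s => by
      rw [hz₀, add_smul, ← add_assoc, mul_smul, Complex.coe_smul]
    have hγc : Continuous fun s : ℝ => z₀ + s • (d • b) := by fun_prop
    have hγU : ∀ᶠ s in 𝓝 (0 : ℝ), z₀ + s • (d • b) ∈ U :=
      hγc.continuousAt.eventually (hU.mem_nhds (by simpa using hz))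
    -- the norm term
    have hG1 : ∀ᶠ s in 𝓝 (0 : ℝ), HasDerivAt (fun s : ℝ => G (z₀ + s • (d • b)))
        (fderiv ℝ G (z₀ + s • (d • b)) (d • b)) s := by
      filter_upwards [hγU] with s hs
      have : DifferentiableAt ℝ G (z₀ + s • (d • b)) :=
        (hG.contDiffAt (hU.mem_nhds hs)).differentiableAt (by simp)
      exact this.hasFDerivAt.comp_hasDerivAt s (hγd s)
    have hG2 : HasDerivAt (fun s : ℝ => fderiv ℝ G (z₀ + s • (d • b)) (d • b))
        (fderiv ℝ (fun w => fderiv ℝ G w (d • b)) z₀ (d • b)) 0 := by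
      have h1 : ContDiffAt ℝ 1 (fderiv ℝ G) z₀ :=
        (hG.contDiffAt (hU.mem_nhds hz)).fderiv_right (m := 1) (by norm_cast)
      have h2 : DifferentiableAt ℝ (fun w => fderiv ℝ G w (d • b)) (z₀ + (0 : ℝ) • (d • b)) := by
        simpa using (h1.differentiableAt one_ne_zero).clm_apply (differentiableAt_const (d • b))
      have := h2.hasFDerivAt.comp_hasDerivAt (0 : ℝ) (hγd 0)
      rw [zero_smul, add_zero] at this
      exact this
    obtain ⟨hG3, hG4⟩ := hasDerivAt_log_twice hG1 hG2 (by simpa using hpos)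
    -- the term of the Poincaré metric
    have hq : ∀ s : ℝ, 1 - ‖t₀ + (s : ℂ) * d‖ ^ 2 =
        1 - ‖t₀‖ ^ 2 - 2 * (conj t₀ * d).re * s - s ^ 2 := by
      intro s
      have e : ∀ w : ℂ, ‖w‖ ^ 2 = w.re ^ 2 + w.im ^ 2 := fun w => by
        rw [Complex.sq_norm, Complex.normSq_apply]; ring
      have hd2 : d.re ^ 2 + d.im ^ 2 = 1 := by rw [← e, hd]; norm_num
      rw [e, e]
      simp only [Complex.add_re, Complex.mul_re, Complex.ofReal_re, Complex.ofReal_im,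
        Complex.add_im, Complex.mul_im, Complex.conj_re, Complex.conj_im]
      linear_combination (-s ^ 2) * hd2
    have hq1 : ∀ s : ℝ, HasDerivAt (fun s : ℝ => 1 - ‖t₀ + (s : ℂ) * d‖ ^ 2)
        (-2 * (conj t₀ * d).re - 2 * s) s := by
      intro s
      simp only [hq]
      have := ((((hasDerivAt_id s).const_mul (2 * (conj t₀ * d).re)).const_sub
        (1 - ‖t₀‖ ^ 2)).sub ((hasDerivAt_id s).pow 2))
      refine HasDerivAt.congr_deriv this ?_
      simp
    have hq2 : HasDerivAt (fun s : ℝ => -2 * (conj t₀ * d).re - 2 * s) (-2) 0 := by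
      simpa using ((hasDerivAt_id (0 : ℝ)).const_mul 2).const_sub (-2 * (conj t₀ * d).re)
    obtain ⟨hq3, hq4⟩ := hasDerivAt_log_twice (Eventually.of_forall hq1) hq2
      (by simpa using hq0)
    -- the harmonic term
    have hlO : ∀ᶠ s : ℝ in 𝓝 (0 : ℝ), t₀ + (s : ℂ) * d ∈ O :=
      hlinec.continuousAt.eventually (hO.mem_nhds (by simpa using ht₀O))
    have hl1 : ∀ᶠ s : ℝ in 𝓝 (0 : ℝ), HasDerivAt (fun s : ℝ => (l (t₀ + (s : ℂ) * d)).re)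
        (deriv l (t₀ + (s : ℂ) * d) * d).re s := by
      filter_upwards [hlO] with s hs
      have h1 := ((hl.differentiableAt (hO.mem_nhds hs)).hasDerivAt).comp s (hlined s)
      exact Complex.reCLM.hasFDerivAt.comp_hasDerivAt s h1
    have hl2 : HasDerivAt (fun s : ℝ => (deriv l (t₀ + (s : ℂ) * d) * d).re)
        (deriv (deriv l) t₀ * d * d).re 0 := by
      have h0 : DifferentiableAt ℂ (deriv l) (t₀ + ((0 : ℝ) : ℂ) * d) := by
        simpa using (hl.deriv hO).differentiableAt (hO.mem_nhds ht₀O)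
      have h1 := (h0.hasDerivAt.comp (0 : ℝ) (hlined 0)).mul_const d
      have := Complex.reCLM.hasFDerivAt.comp_hasDerivAt (0 : ℝ) h1
      rw [Complex.ofReal_zero, zero_mul, add_zero] at this
      exact this
    have hfin := second_deriv_nonpos_of_isLocalMax
      (p := fun s : ℝ => (1 / 2) * Real.log (G (z₀ + s • (d • b))) +
        Real.log (1 - ‖t₀ + (s : ℂ) * d‖ ^ 2) + ε * (l (t₀ + (s : ℂ) * d)).re)
      (by
        filter_upwards [hG3, hq3, hl1] with s h1 h2 h3
        exact ((h1.const_mul (1 / 2)).add h2).add (h3.const_mul ε))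
      (((hG4.const_mul (1 / 2)).add hq4).add (hl2.const_mul ε)) (by
        have hm : IsLocalMax (fun t : ℂ => (1 / 2) * Real.log (G (a + t • b)) +
          Real.log (1 - ‖t‖ ^ 2) + ε * (l t).re) (t₀ + ((0 : ℝ) : ℂ) * d) := by simpa using hmax
        have := hm.comp_continuous hlinec.continuousAt (g := fun s : ℝ => t₀ + (s : ℂ) * d)
        simpa only [Function.comp_def, hγeq] using this)
    simpa using hfin
  -- Adding the directions 1 and i gives the Laplacian: Re l contributes 0 and log(1 - |t|²)
  -- contributes -4/(1 - |t|²)².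
  have k1 := key 1 (by simp)
  have k2 := key Complex.I (by simp)
  simp only [one_smul] at k1
  have e1 : (conj t₀ * 1).re = t₀.re := by simp
  have e2 : (conj t₀ * Complex.I).re = t₀.im := by simp
  have e3 : (deriv (deriv l) t₀ * Complex.I * Complex.I).re = - (deriv (deriv l) t₀ * 1 * 1).re := by
    rw [mul_assoc, Complex.I_mul_I]; simp
  rw [e1] at k1
  rw [e2, e3] at k2
  have hn : ‖t₀‖ ^ 2 = t₀.re ^ 2 + t₀.im ^ 2 := by
    rw [Complex.sq_norm, Complex.normSq_apply]; ring
  set Q := 1 - ‖t₀‖ ^ 2 with hQ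
  set X := G z₀
  have hsum : (1 / 2) * (4 * A * X) ≤ 4 / Q ^ 2 := by
    have e4 : (-2 / Q - (-2 * t₀.re) ^ 2 / Q ^ 2) + (-2 / Q - (-2 * t₀.im) ^ 2 / Q ^ 2) =
        - (4 / Q ^ 2) := by
      have : t₀.re ^ 2 + t₀.im ^ 2 = 1 - Q := by rw [← hn, hQ]; ring
      field_simp
      linear_combination (-4) * this
    have e5 := (mul_le_mul_of_nonneg_left hlap (show (0 : ℝ) ≤ 1 / 2 by norm_num))
    rw [add_div, add_div] at e5
    linarith
  rw [le_div_iff₀ hA]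
  rw [le_div_iff₀ (by positivity)] at hsum
  linarith

end Ahlfors

section Ahlfors

variable {n : ℕ} {Ω U : Set (Fin n → ℂ)}

/-- Since the weight may vanish, logarithms are avoided: a real ν slightly above N at the point,
with ν c still below y, bounds N nearby. -/
theorem upperSemicontinuousOn_toReal_mul {X : Type*} [TopologicalSpace X] {K : Set X}
    {N : X → ℝ≥0∞} (hN : UpperSemicontinuousOn (fun t => ENNReal.log (N t)) K)
    (hlt : ∀ t ∈ K, N t ≠ ⊤) {c : X → ℝ} (hc : ContinuousOn c K) (hc0 : ∀ t ∈ K, 0 ≤ c t) :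
    UpperSemicontinuousOn (fun t => (N t).toReal * c t) K := by
  intro t₁ ht₁ y hy
  obtain ⟨ν, hν1, hν2⟩ : ∃ ν, (N t₁).toReal < ν ∧ ν * c t₁ < y := by
    have h1 : ∀ᶠ ν in 𝓝 (N t₁).toReal, ν * c t₁ < y :=
      (continuous_id.mul continuous_const).continuousAt.eventually (gt_mem_nhds hy)
    obtain ⟨ν, hν⟩ := ((h1.filter_mono nhdsWithin_le_nhds).and
      (self_mem_nhdsWithin (s := Ioi (N t₁).toReal))).exists
    exact ⟨ν, hν.2, hν.1⟩
  have hν0 : 0 ≤ ν := ENNReal.toReal_nonneg.trans hν1.le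
  have h1 : ENNReal.log (N t₁) < ENNReal.log (ENNReal.ofReal ν) := by
    rw [ENNReal.log_lt_log_iff]
    exact (ENNReal.lt_ofReal_iff_toReal_lt (hlt t₁ ht₁)).2 hν1
  have h2 : ∀ᶠ t in 𝓝[K] t₁, ν * c t < y :=
    ((hc t₁ ht₁).const_mul ν).eventually (gt_mem_nhds hν2)
  filter_upwards [hN t₁ ht₁ _ h1, h2, self_mem_nhdsWithin] with t h3 h4 h5
  rw [ENNReal.log_lt_log_iff] at h3
  have h6 : (N t).toReal ≤ ν := ENNReal.toReal_le_of_le_ofReal hν0 h3.le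
  exact (mul_le_mul_of_nonneg_right h6 (hc0 t h5)).trans_lt h4

/-- The Ahlfors–Schwarz lemma on a disc whose centre lies in the smooth locus. -/
theorem toReal_sq_le_of_center_mem {N : (Fin n → ℂ) → ℝ≥0∞} {b : Fin n → ℂ} {A : ℝ} (hA : 0 < A)
    (hN : IsPshOn Ω fun z => ENNReal.log (N z)) (hUo : IsOpen U)
    (hK : HasAnalyticComplement Ω U)
    (hG : ContDiffOn ℝ ∞ (fun w => (N w).toReal ^ 2) U) (hpos : ∀ z ∈ U, 0 < (N z).toReal)
    (hlap : ∀ z ∈ U, 4 * A * (N z).toReal ^ 2 ≤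
        (fderiv ℝ (fun w => fderiv ℝ (fun w => (N w).toReal ^ 2) w b) z b +
          fderiv ℝ (fun w => fderiv ℝ (fun w => (N w).toReal ^ 2) w (Complex.I • b)) z
            (Complex.I • b)) / (N z).toReal ^ 2 -
        (fderiv ℝ (fun w => (N w).toReal ^ 2) z b ^ 2 +
          fderiv ℝ (fun w => (N w).toReal ^ 2) z (Complex.I • b) ^ 2) /
          ((N z).toReal ^ 2) ^ 2)
    {a : Fin n → ℂ} (hab : ∀ t : ℂ, ‖t‖ ≤ 1 → a + t • b ∈ Ω) (ha : a ∈ U) :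
    (N a).toReal ^ 2 ≤ 2 / A := by
  have hline : Continuous fun t : ℂ => a + t • b := by fun_prop
  have hfin := hK.finite_disc hUo hab ha
  set S : Finset ℂ := hfin.toFinset with hS
  have hSmem : ∀ t : ℂ, t ∈ S ↔ ‖t‖ ≤ 1 ∧ a + t • b ∉ U := by
    intro t; simp [hS]
  -- F vanishes exactly at the points of the disc outside `U`; the halves keep |F| ≤ 1 on the disc.
  set F : ℂ → ℂ := fun t => ∏ c ∈ S, (t - c) / 2 with hF
  have hFd : Differentiable ℂ F := by
    simp only [hF]
    exact Differentiable.fun_finsetProd fun c _ => by fun_prop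
  have hF1 : ∀ t : ℂ, ‖t‖ ≤ 1 → ‖F t‖ ≤ 1 := by
    intro t ht
    simp only [hF, norm_prod]
    apply Finset.prod_le_one
    · intro c _; positivity
    · intro c hc
      have h1 := ((hSmem c).1 hc).1
      have h2 := norm_sub_le t c
      rw [norm_div]
      simp only [Complex.norm_ofNat]
      linarith
  have hF0 : ∀ t : ℂ, ‖t‖ ≤ 1 → F t ≠ 0 → a + t • b ∈ U := by
    intro t ht hne
    by_contra hcon
    apply hne
    exact Finset.prod_eq_zero ((hSmem t).2 ⟨ht, hcon⟩) (by simp)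
  have hFa : F 0 ≠ 0 := by
    simp only [hF]
    rw [Finset.prod_ne_zero_iff]
    intro c hc h0
    have : c = 0 := by simpa using h0
    rw [this] at hc
    exact ((hSmem 0).1 hc).2 (by simpa using ha)
  have hball : ∀ t ∈ closedBall (0 : ℂ) 1, ‖t‖ ≤ 1 := fun t ht => by simpa using ht
  have hε : ∀ ε : ℝ, 0 < ε → ((N a).toReal * ‖F 0‖ ^ ε) ^ 2 ≤ 2 / A := by
    intro ε hε
    -- The factor 1 - |t|² pushes the maximum off the boundary circle, and |F|^ε pushes it off the
    -- points outside `U`.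
    set c : ℂ → ℝ := fun t => (1 - ‖t‖ ^ 2) * ‖F t‖ ^ ε with hc
    have hcc : Continuous c :=
      (by fun_prop : Continuous fun t : ℂ => 1 - ‖t‖ ^ 2).mul
        (hFd.continuous.norm.rpow_const fun _ => .inr hε.le)
    have hm : UpperSemicontinuousOn (fun t : ℂ => (N (a + t • b)).toReal * c t)
        (closedBall 0 1) := by
      apply upperSemicontinuousOn_toReal_mul
      · exact hN.usc.comp hline.continuousOn fun t ht => hab t (hball t ht)
      · intro t ht
        have := hN.lt_top _ (hab t (hball t ht))
        rw [ENNReal.log_lt_top_iff] at this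
        exact this.ne
      · exact hcc.continuousOn
      · intro t ht
        have := hball t ht
        have h2 : 0 ≤ 1 - ‖t‖ ^ 2 := by nlinarith [norm_nonneg t]
        positivity
    obtain ⟨t₀, ht₀, hmax⟩ := hm.exists_isMaxOn ⟨0, by simp⟩ (isCompact_closedBall 0 1)
    have hmax0 : (N a).toReal * ‖F 0‖ ^ ε ≤ (N (a + t₀ • b)).toReal * c t₀ := by
      have := hmax (mem_closedBall_self zero_le_one)
      simpa [hc] using this
    have hpos0 : 0 < (N (a + t₀ • b)).toReal * c t₀ :=
      (mul_pos (hpos a ha) (Real.rpow_pos_of_pos (norm_pos_iff.2 hFa) ε)).trans_le hmax0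
    have hc0 : c t₀ ≠ 0 := right_ne_zero_of_mul hpos0.ne'
    have hlt : ‖t₀‖ < 1 := by
      refine lt_of_le_of_ne (hball t₀ ht₀) fun h => hc0 ?_
      simp [hc, h]
    have hFt₀ : F t₀ ≠ 0 := by
      intro h
      exact hc0 (by simp [hc, h, Real.zero_rpow hε.ne'])
    have hz : a + t₀ • b ∈ U := hF0 t₀ hlt.le hFt₀
    obtain ⟨ρ, hρ, -, l, hl, hlF⟩ := exists_log_branch isOpen_univ hFd.differentiableOn
      (mem_univ t₀) hFt₀
    have hlogm : ∀ t : ℂ, ‖t‖ < 1 → t ∈ ball t₀ ρ →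
        0 < (N (a + t • b)).toReal * c t ∧
        Real.log ((N (a + t • b)).toReal * c t) =
          (1 / 2) * Real.log ((N (a + t • b)).toReal ^ 2) + Real.log (1 - ‖t‖ ^ 2) +
            ε * (l t).re := by
      intro t ht1 htρ
      obtain ⟨hFt, hlog⟩ := hlF t htρ
      have h1 : 0 < (N (a + t • b)).toReal := hpos _ (hF0 t ht1.le hFt)
      have h2 : 0 < 1 - ‖t‖ ^ 2 := by nlinarith [norm_nonneg t]
      have h3 : 0 < ‖F t‖ := norm_pos_iff.2 hFt
      have h4 : 0 < ‖F t‖ ^ ε := Real.rpow_pos_of_pos h3 ε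
      refine ⟨by simp only [hc]; positivity, ?_⟩
      simp only [hc]
      rw [Real.log_mul h1.ne' (by positivity), Real.log_mul h2.ne' h4.ne', Real.log_rpow h3,
        Real.log_pow, hlog]
      push_cast; ring
    have hloc : IsLocalMax (fun t : ℂ => (1 / 2) * Real.log ((N (a + t • b)).toReal ^ 2) +
        Real.log (1 - ‖t‖ ^ 2) + ε * (l t).re) t₀ := by
      filter_upwards [isOpen_ball.mem_nhds (mem_ball_self hρ),
        isOpen_ball.mem_nhds (show t₀ ∈ ball (0 : ℂ) 1 by simpa using hlt)] with t ht1 ht2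
      have ht2' : ‖t‖ < 1 := by simpa using ht2
      obtain ⟨hp, he⟩ := hlogm t ht2' ht1
      rw [← he, ← (hlogm t₀ hlt (mem_ball_self hρ)).2]
      exact Real.log_le_log hp (hmax (ball_subset_closedBall ht2))
    have hkey := mul_sq_le_of_isLocalMax (G := fun w => (N w).toReal ^ 2) hUo hG hlt hz
      (pow_pos (hpos _ hz) 2) hA (hlap _ hz) isOpen_ball hl (mem_ball_self hρ) hloc
    have h1 : 0 ≤ (N a).toReal * ‖F 0‖ ^ ε := by positivity
    calc ((N a).toReal * ‖F 0‖ ^ ε) ^ 2 ≤ ((N (a + t₀ • b)).toReal * c t₀) ^ 2 := by gcongr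
      _ = ((N (a + t₀ • b)).toReal ^ 2 * (1 - ‖t₀‖ ^ 2) ^ 2) * (‖F t₀‖ ^ ε) ^ 2 := by
          simp only [hc]; ring
      _ ≤ ((N (a + t₀ • b)).toReal ^ 2 * (1 - ‖t₀‖ ^ 2) ^ 2) * 1 := by
          gcongr
          exact pow_le_one₀ (by positivity) (Real.rpow_le_one (norm_nonneg _) (hF1 t₀ hlt.le) hε.le)
      _ ≤ 2 / A := by rw [mul_one]; exact hkey
  -- As F 0 ≠ 0, the factor ‖F 0‖^ε tends to 1.
  have hlim : Tendsto (fun ε : ℝ => ((N a).toReal * ‖F 0‖ ^ ε) ^ 2) (𝓝[>] 0)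
      (𝓝 (((N a).toReal * ‖F 0‖ ^ (0 : ℝ)) ^ 2)) := by
    have hcont : Continuous fun ε : ℝ => ‖F 0‖ ^ ε :=
      Real.continuous_const_rpow (norm_ne_zero_iff.2 hFa)
    exact ((continuous_const.mul hcont).pow 2).continuousAt.tendsto.mono_left nhdsWithin_le_nhds
  have := le_of_tendsto hlim (eventually_mem_nhdsWithin.mono fun ε h => hε ε h)
  simpa using this

/-- Join z to a nearby point w of `U`, where some defining function is nonzero. It is not
identically zero on the line, and the identity theorem on a convex piece of this line isolates its
zeros near z. -/
theorem HasAnalyticComplement.exists_direction (hK : HasAnalyticComplement Ω U)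
    (hdense : Ω ⊆ closure U) {z : Fin n → ℂ} (hz : z ∈ Ω) :
    ∃ c : Fin n → ℂ, ∀ᶠ t in 𝓝[≠] (0 : ℂ), z + t • c ∈ U := by
  obtain ⟨W, hW, hzW, k, f, hf, hiff⟩ := hK z hz
  obtain ⟨r, hr, hball⟩ := Metric.isOpen_iff.1 hW z hzW
  obtain ⟨w, hwU, hw⟩ := Metric.mem_closure_iff.1 (hdense hz) r hr
  have hwb : w ∈ ball z r := by rw [mem_ball, dist_comm]; exact hw
  obtain ⟨j, hj⟩ : ∃ j, f j w ≠ 0 := by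
    by_contra! hcon
    exact (hiff w (hball hwb)).2 hcon hwU
  refine ⟨w - z, ?_⟩
  have hline : Continuous fun t : ℂ => z + t • (w - z) := by fun_prop
  set O : Set ℂ := (fun t : ℂ => z + t • (w - z)) ⁻¹' ball z r with hO
  have hOo : IsOpen O := isOpen_ball.preimage hline
  have hOeq : O = {t : ℂ | ‖t‖ * ‖w - z‖ < r} := by
    ext t; simp [hO, norm_smul]
  have hOconv : Convex ℝ O := by
    rw [hOeq]
    intro x hx y hy α β hα hβ hαβ
    simp only [mem_ofPred_eq] at hx hy ⊢
    calc ‖α • x + β • y‖ * ‖w - z‖ ≤ (α * ‖x‖ + β * ‖y‖) * ‖w - z‖ := by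
          gcongr
          refine (norm_add_le _ _).trans (le_of_eq ?_)
          rw [norm_smul, norm_smul, Real.norm_of_nonneg hα, Real.norm_of_nonneg hβ]
      _ = α * (‖x‖ * ‖w - z‖) + β * (‖y‖ * ‖w - z‖) := by ring
      _ < r := by
          rcases hα.eq_or_lt with rfl | hα'
          · have : β = 1 := by linarith
            subst this; linarith
          · have h1 : α * (‖x‖ * ‖w - z‖) < α * r := by gcongr
            have h2 : β * (‖y‖ * ‖w - z‖) ≤ β * r := by gcongr
            have : α * r + β * r = r := by rw [← add_mul, hαβ, one_mul]
            linarith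
  have hd : DifferentiableOn ℂ (fun t : ℂ => f j (z + t • (w - z))) O :=
    ((hf j).mono hball).comp (t := ball z r) (by fun_prop) fun t ht => ht
  have han : AnalyticOnNhd ℂ (fun t : ℂ => f j (z + t • (w - z))) O := hd.analyticOnNhd hOo
  have h0 : (0 : ℂ) ∈ O := by simpa [hO] using hr
  have h1 : (1 : ℂ) ∈ O := by
    rw [hOeq]; simpa [dist_eq_norm] using hwb
  have hne : ∀ᶠ t in 𝓝[≠] (0 : ℂ), f j (z + t • (w - z)) ≠ 0 := by
    apply (han 0 h0).eventually_eq_zero_or_eventually_ne_zero.resolve_left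
    intro hzero
    have := han.eqOn_zero_of_preconnected_of_eventuallyEq_zero hOconv.isPreconnected h0 hzero h1
    simp at this
    exact hj this
  filter_upwards [hne, nhdsWithin_le_nhds (hOo.mem_nhds h0)] with t ht htO
  by_contra hcon
  exact ht ((hiff _ (hball htO)).1 hcon j)

/-- The Ahlfors–Schwarz lemma. -/
theorem le_of_disc_subset {N : (Fin n → ℂ) → ℝ≥0∞} {b : Fin n → ℂ} {A : ℝ} (hA : 0 < A)
    (hN : IsPshOn Ω fun z => ENNReal.log (N z)) (hΩ : IsOpen Ω) (hUo : IsOpen U)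
    (hK : HasAnalyticComplement Ω U) (hdense : Ω ⊆ closure U)
    (hG : ContDiffOn ℝ ∞ (fun w => (N w).toReal ^ 2) U) (hpos : ∀ z ∈ U, 0 < (N z).toReal)
    (hlap : ∀ z ∈ U, 4 * A * (N z).toReal ^ 2 ≤
        (fderiv ℝ (fun w => fderiv ℝ (fun w => (N w).toReal ^ 2) w b) z b +
          fderiv ℝ (fun w => fderiv ℝ (fun w => (N w).toReal ^ 2) w (Complex.I • b)) z
            (Complex.I • b)) / (N z).toReal ^ 2 -
        (fderiv ℝ (fun w => (N w).toReal ^ 2) z b ^ 2 +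
          fderiv ℝ (fun w => (N w).toReal ^ 2) z (Complex.I • b) ^ 2) /
          ((N z).toReal ^ 2) ^ 2)
    {a : Fin n → ℂ} (hab : ∀ t : ℂ, ‖t‖ ≤ 1 → a + t • b ∈ Ω) :
    N a ≤ ENNReal.ofReal (√(2 / A)) := by
  have haΩ : a ∈ Ω := by simpa using hab 0 (by simp)
  obtain ⟨c, hc⟩ := hK.exists_direction hdense haΩ
  have hev : ∀ᶠ x in 𝓝 a, ∀ t ∈ closedBall (0 : ℂ) 1, x + t • b ∈ Ω := by
    apply (isCompact_closedBall (0 : ℂ) 1).eventually_forall_of_forall_eventually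
    intro t ht
    have hcont : Continuous fun p : (Fin n → ℂ) × ℂ => p.1 + p.2 • b := by fun_prop
    exact hcont.continuousAt.eventually (hΩ.mem_nhds (hab t (by simpa using ht)))
  have htend : Tendsto (fun t : ℂ => a + t • c) (𝓝[≠] 0) (𝓝 a) := by
    have : Continuous fun t : ℂ => a + t • c := by fun_prop
    simpa using (this.tendsto 0).mono_left nhdsWithin_le_nhds
  -- On a small circle around a, in a direction that leaves the complement of `U`, the centres lie
  -- in `U` and their discs still lie in `Ω`. The bound holds there and passes to a by the sub-mean
  -- value inequality.
  obtain ⟨ρ, hρ, hin, hP⟩ := exists_small_punctured_disc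
    (P := fun x => x ∈ U ∧ ∀ t ∈ closedBall (0 : ℂ) 1, x + t • b ∈ Ω) hΩ haΩ
    (hc.and (htend.eventually hev))
  have hsq : 0 < √(2 / A) := Real.sqrt_pos.2 (by positivity)
  have := hN.subAt hρ hin (fun _ => (Real.log (√(2 / A)) : ℂ)) diffContOnCl_const (by
    intro t ht
    obtain ⟨h1, h2⟩ := hP t ht
    have h3 := toReal_sq_le_of_center_mem hA hN hUo hK hG hpos hlap
      (fun s hs => h2 s (by simpa using hs)) h1
    have h4 := hN.lt_top _ (hin t (sphere_subset_closedBall ht))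
    rw [ENNReal.log_lt_top_iff] at h4
    rw [Complex.ofReal_re, ← ENNReal.log_ofReal_of_pos hsq, ENNReal.log_le_log_iff]
    rw [ENNReal.le_ofReal_iff_toReal_le h4.ne hsq.le]
    exact Real.le_sqrt_of_sq_le h3)
  simp only [zero_smul, add_zero] at this
  rwa [Complex.ofReal_re, ← ENNReal.log_ofReal_of_pos hsq, ENNReal.log_le_log_iff] at this

end Ahlfors

/-! ### Metrics and vector fields in holomorphic charts -/

section Charts

variable {n : ℕ} {X : Type*} [TopologicalSpace X] [ChartedSpace (Fin n → ℂ) X]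
  {φ : OpenPartialHomeomorph X (Fin n → ℂ)}

theorem IsPshOn.congr {Ω : Set (Fin n → ℂ)} {u v : (Fin n → ℂ) → EReal} (hu : IsPshOn Ω u)
    (h : ∀ z ∈ Ω, u z = v z) : IsPshOn Ω v := by
  refine ⟨fun z hz => h z hz ▸ hu.lt_top z hz, fun z hz y hy => ?_, fun a b hab => ?_⟩
  · have hy : v z < y := hy
    rw [← h z hz] at hy
    filter_upwards [hu.usc z hz y hy, self_mem_nhdsWithin] with w hw hwΩ
    rwa [← h w hwΩ]
  · rw [← h a (by simpa using hab 0 (by simp))]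
    refine (hu.submean a b hab).trans (le_of_eq ?_)
    congr 1
    ext θ
    exact h _ (hab _ (norm_circ θ).le)

theorem mdifferentiable_of_mem_holCharts (hφ : φ ∈ holCharts n X) :
    φ.MDifferentiable 𝓘(ℂ, Fin n → ℂ) 𝓘(ℂ, Fin n → ℂ) :=
  ⟨(contMDiffOn_of_mem_maximalAtlas hφ).mdifferentiableOn (by simp),
    (contMDiffOn_symm_of_mem_maximalAtlas hφ).mdifferentiableOn (by simp)⟩

theorem IsHolFun.differentiableOn_chart (hφ : φ ∈ holCharts n X) {W : Set X} {f : X → ℂ}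
    (hf : IsHolFun n W f) : DifferentiableOn ℂ (fun z => f (φ.symm z)) (φ.target ∩ φ.symm ⁻¹' W) := by
  rw [← mdifferentiableOn_iff_differentiableOn]
  exact MDifferentiableOn.comp hf
    ((mdifferentiable_of_mem_holCharts hφ).2.mono inter_subset_left) fun z hz => hz.2

theorem coordVec_add (z u v : Fin n → ℂ) :
    coordVec φ z (u + v) = coordVec φ z u + coordVec φ z v :=
  map_add (mfderiv 𝓘(ℂ, Fin n → ℂ) 𝓘(ℂ, Fin n → ℂ) φ.symm z) u v

theorem coordVec_sub (z u v : Fin n → ℂ) :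
    coordVec φ z (u - v) = coordVec φ z u - coordVec φ z v :=
  map_sub (mfderiv 𝓘(ℂ, Fin n → ℂ) 𝓘(ℂ, Fin n → ℂ) φ.symm z) u v

theorem coordVec_smul (z : Fin n → ℂ) (c : ℂ) (v : Fin n → ℂ) :
    coordVec φ z (c • v) = c • coordVec φ z v :=
  map_smul (mfderiv 𝓘(ℂ, Fin n → ℂ) 𝓘(ℂ, Fin n → ℂ) φ.symm z) c v

theorem coordVec_zero (z : Fin n → ℂ) : coordVec φ z 0 = 0 :=
  map_zero (mfderiv 𝓘(ℂ, Fin n → ℂ) 𝓘(ℂ, Fin n → ℂ) φ.symm z)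

theorem coordVec_sum (z : Fin n → ℂ) {ι : Type*} (s : Finset ι) (f : ι → Fin n → ℂ) :
    coordVec φ z (∑ i ∈ s, f i) = ∑ i ∈ s, coordVec φ z (f i) :=
  map_sum (mfderiv 𝓘(ℂ, Fin n → ℂ) 𝓘(ℂ, Fin n → ℂ) φ.symm z) f s

theorem coordVec_eq_zero (hφ : φ ∈ holCharts n X) {z v : Fin n → ℂ} (hz : z ∈ φ.target)
    (h : coordVec φ z v = 0) : v = 0 :=
  (mdifferentiable_of_mem_holCharts hφ).symm.mfderiv_injective hz
    (h.trans (coordVec_zero z).symm)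

/-- The norm of the coordinate vector fields of the chart `φ`. -/
def chartNorm (h : ∀ x : X, TangentSpace 𝓘(ℂ, Fin n → ℂ) x → ℝ≥0∞)
    (φ : OpenPartialHomeomorph X (Fin n → ℂ)) (z v : Fin n → ℂ) : ℝ≥0∞ :=
  h (φ.symm z) (coordVec φ z v)

variable {h : ∀ x : X, TangentSpace 𝓘(ℂ, Fin n → ℂ) x → ℝ≥0∞}

theorem gram_apply (z : Fin n → ℂ) (i j : Fin n) :
    gram h φ z i j = polarForm (chartNorm h φ z) (Pi.single i 1) (Pi.single j 1) := by
  simp only [gram, Matrix.of_apply, polarForm, chartNorm, coordVec_add, coordVec_sub, coordVec_smul]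

theorem IsSingularHermitianInner.chartNorm {z : Fin n → ℂ}
    (hin : IsSingularHermitianInner (h (φ.symm z))) :
    IsSingularHermitianInner (chartNorm h φ z) where
  map_zero := by simp only [LogMetric.chartNorm, coordVec_zero, hin.map_zero]
  map_smul c v hc := by simp only [LogMetric.chartNorm, coordVec_smul, hin.map_smul _ _ hc]
  triangle v w := by simp only [LogMetric.chartNorm, coordVec_add, hin.triangle]
  parallelogram v w := by
    simp only [LogMetric.chartNorm, coordVec_add, coordVec_sub, hin.parallelogram]

theorem IsFinitePosDef.chartNorm (hφ : φ ∈ holCharts n X) {z : Fin n → ℂ} (hz : z ∈ φ.target)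
    (hfin : IsFinitePosDef (h (φ.symm z))) : IsFinitePosDef (chartNorm h φ z) :=
  ⟨fun _ => hfin.1 _, fun _ hv => coordVec_eq_zero hφ hz (hfin.2 _ hv)⟩

theorem IsSingularHermitianInner.smul_le {V : Type*} [AddCommGroup V] [Module ℂ V] {N : V → ℝ≥0∞}
    (hN : IsSingularHermitianInner N) (c : ℂ) (v : V) : N (c • v) ≤ ‖c‖ₑ * N v := by
  rcases eq_or_ne c 0 with rfl | hc
  · simp [hN.map_zero]
  · exact (hN.map_smul c v hc).le

theorem IsSingularHermitianInner.sum_le {V : Type*} [AddCommGroup V] [Module ℂ V] {N : V → ℝ≥0∞}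
    (hN : IsSingularHermitianInner N) {ι : Type*} (s : Finset ι) (f : ι → V) :
    N (∑ i ∈ s, f i) ≤ ∑ i ∈ s, N (f i) := by
  classical
  induction s using Finset.induction_on with
  | empty => simp [hN.map_zero]
  | insert a s ha ih =>
    rw [Finset.sum_insert ha, Finset.sum_insert ha]
    exact (hN.triangle _ _).trans (add_le_add le_rfl ih)

/-- The holomorphic vector field on the domain of the chart `φ` with constant coordinates `v`. -/
def coordField (φ : OpenPartialHomeomorph X (Fin n → ℂ)) (v : Fin n → ℂ) (x : X) :
    TangentSpace 𝓘(ℂ, Fin n → ℂ) x :=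
  coordVec φ (φ x) v

theorem coordField_symm {z : Fin n → ℂ} (hz : z ∈ φ.target) (v : Fin n → ℂ) :
    coordField φ v (φ.symm z) = coordVec φ z v :=
  congrArg (fun w => (mfderiv 𝓘(ℂ, Fin n → ℂ) 𝓘(ℂ, Fin n → ℂ) φ.symm w :
    (Fin n → ℂ) →L[ℂ] (Fin n → ℂ)) v) (φ.right_inv hz)

theorem tangentBundle_mk_congr {x y : X} (hxy : x = y) (w : Fin n → ℂ) :
    (⟨x, w⟩ : TangentBundle 𝓘(ℂ, Fin n → ℂ) X) = ⟨y, w⟩ := by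
  subst hxy; rfl

variable [IsManifold 𝓘(ℂ, Fin n → ℂ) ω X]

/-- It is the image of a constant field under the holomorphic tangent map of `φ.symm`. -/
theorem coordField_mem (hφ : φ ∈ holCharts n X) (v : Fin n → ℂ) :
    coordField φ v ∈ holVectorFields φ.source := by
  have : IsManifold 𝓘(ℂ, Fin n → ℂ) 1 X := IsManifold.of_le (n := ω) (by simp)
  have h1 : ContMDiffOn (𝓘(ℂ, Fin n → ℂ).tangent) (𝓘(ℂ, Fin n → ℂ).tangent) 1
      (tangentMapWithin 𝓘(ℂ, Fin n → ℂ) 𝓘(ℂ, Fin n → ℂ) φ.symm φ.target)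
      (Bundle.TotalSpace.proj ⁻¹' φ.target) :=
    (contMDiffOn_symm_of_mem_maximalAtlas hφ).contMDiffOn_tangentMapWithin (by simp)
      φ.open_target.uniqueMDiffOn
  have h2 : ContMDiff 𝓘(ℂ, Fin n → ℂ) (𝓘(ℂ, Fin n → ℂ).tangent) 1
      (fun z : Fin n → ℂ => (⟨z, v⟩ : TangentBundle 𝓘(ℂ, Fin n → ℂ) (Fin n → ℂ))) :=
    contMDiff_vectorSpace_iff_contDiff.2 contDiff_const
  have h3 := (h1.mdifferentiableOn one_ne_zero).comp
    ((h2.mdifferentiable one_ne_zero).comp_mdifferentiableOn (mdifferentiable_of_mem_holCharts hφ).1)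
    (fun x hx => φ.map_source hx)
  refine MDifferentiableOn.congr h3 fun x hx => ?_
  have hx' := φ.map_source hx
  simp only [Function.comp_def, tangentMapWithin]
  rw [mfderivWithin_of_isOpen φ.open_target hx']
  exact tangentBundle_mk_congr (φ.left_inv hx).symm _

end Charts

/-! ### Divisors, analytic subsets and vector fields read in a chart -/

section

variable {n : ℕ} {X : Type*} [TopologicalSpace X] [ChartedSpace (Fin n → ℂ) X]
  {φ : OpenPartialHomeomorph X (Fin n → ℂ)} {D Z : Set X}
  {h : ∀ x : X, TangentSpace 𝓘(ℂ, Fin n → ℂ) x → ℝ≥0∞}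

theorem IsNormalCrossingDivisor.isOpen_compl (hD : IsNormalCrossingDivisor n D) : IsOpen Dᶜ := by
  rw [isOpen_iff_mem_nhds]
  intro x hx
  obtain ⟨φ, -, hxs, -, S, hS⟩ := hD x
  have h1 : ∀ᶠ y in 𝓝 x, ∏ i ∈ S, φ y i ≠ 0 :=
    (ContinuousOn.continuousAt (continuousOn_finsetProd S fun i _ =>
      (continuous_apply i).comp_continuousOn φ.continuousOn)
      (φ.open_source.mem_nhds hxs)).eventually_ne
      fun h0 => hx ((hS x hxs).2 h0)
  filter_upwards [h1, φ.open_source.mem_nhds hxs] with y hy hys hyD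
  exact hy ((hS y hys).1 hyD)

theorem IsAnalyticSubset.isOpen_diff {V : Set X} (hZ : IsAnalyticSubset n V Z) :
    IsOpen (V \ Z) := by
  rw [isOpen_iff_mem_nhds]
  rintro x ⟨hxV, hxZ⟩
  obtain ⟨W, hW, hxW, hWV, k, f, hf, hiff⟩ := hZ.2 x hxV
  obtain ⟨j, hj⟩ := not_forall.1 fun hall => hxZ ((hiff x hxW).2 hall)
  have hc : ContinuousAt (f j) x := (MDifferentiableOn.continuousOn (hf j)).continuousAt
    (hW.mem_nhds hxW)
  filter_upwards [hc.eventually_ne hj, hW.mem_nhds hxW] with y hy hyW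
  exact ⟨hWV hyW, fun hyZ => hy ((hiff y hyW).1 hyZ j)⟩

theorem IsAnalyticSubset.hasAnalyticComplement {V : Set X} (hZ : IsAnalyticSubset n V Z)
    (hφ : φ ∈ holCharts n X) :
    HasAnalyticComplement (φ.target ∩ φ.symm ⁻¹' V) (φ.target ∩ φ.symm ⁻¹' (V \ Z)) := by
  rintro z ⟨hzt, hzV⟩
  obtain ⟨W, hW, hxW, hWV, k, f, hf, hiff⟩ := hZ.2 _ hzV
  refine ⟨φ.target ∩ φ.symm ⁻¹' W, φ.symm.isOpen_inter_preimage hW, ⟨hzt, hxW⟩, k,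
    fun j z => f j (φ.symm z), fun j => (hf j).differentiableOn_chart hφ, ?_⟩
  rintro y ⟨hyt, hyW⟩
  rw [← hiff _ hyW]
  constructor
  · intro hn
    by_contra hnZ
    exact hn ⟨hyt, hWV hyW, hnZ⟩
  · intro hyZ hn
    exact hn.2.2 hyZ

theorem chart_preimage_subset_closure {Y : Type*} [TopologicalSpace Y]
    (φ : OpenPartialHomeomorph Y (Fin n → ℂ)) {V U : Set Y}
    (hd : V ⊆ closure U) :
    φ.target ∩ φ.symm ⁻¹' V ⊆ closure (φ.target ∩ φ.symm ⁻¹' U) := by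
  rintro z ⟨hzt, hzV⟩
  rw [_root_.mem_closure_iff]
  intro O hO hzO
  obtain ⟨y, ⟨hys, hyO⟩, hyU⟩ := _root_.mem_closure_iff.1 (hd hzV) _ (φ.isOpen_inter_preimage hO)
    ⟨φ.map_target hzt, by simpa [φ.right_inv hzt] using hzO⟩
  exact ⟨φ y, hyO, φ.map_source hys, by simpa [φ.left_inv hys] using hyU⟩

/-- The components of a vector field in a chart. -/
def chartComp (φ : OpenPartialHomeomorph X (Fin n → ℂ))
    (θ : ∀ x : X, TangentSpace 𝓘(ℂ, Fin n → ℂ) x) (z : Fin n → ℂ) : Fin n → ℂ :=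
  mfderiv 𝓘(ℂ, Fin n → ℂ) 𝓘(ℂ, Fin n → ℂ) φ (φ.symm z) (θ (φ.symm z))

theorem coordVec_chartComp (hφ : φ ∈ holCharts n X)
    (θ : ∀ x : X, TangentSpace 𝓘(ℂ, Fin n → ℂ) x) {z : Fin n → ℂ} (hz : z ∈ φ.target) :
    coordVec φ z (chartComp φ θ z) = θ (φ.symm z) := by
  have h1 := (mdifferentiable_of_mem_holCharts hφ).symm_comp_deriv (φ.map_target hz)
  have h2 := congrArg (fun w => (mfderiv 𝓘(ℂ, Fin n → ℂ) 𝓘(ℂ, Fin n → ℂ) φ.symm w :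
    (Fin n → ℂ) →L[ℂ] (Fin n → ℂ)) (chartComp φ θ z)) (φ.right_inv hz)
  exact h2.symm.trans (DFunLike.congr_fun h1 (θ (φ.symm z)))

variable [IsManifold 𝓘(ℂ, Fin n → ℂ) ω X]

/-- Semi-negativity applied to the field with constant coordinates v. -/
theorem IsSemiNegativeMetric.isPshOn_chartNorm {V : Set X} (hV : IsOpen V)
    (hh : IsSemiNegativeMetric n holVectorFields V h) (hφ : φ ∈ holCharts n X) (v : Fin n → ℂ) :
    IsPshOn (φ.target ∩ φ.symm ⁻¹' V) fun z => ENNReal.log (chartNorm h φ z v) := by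
  have h1 := hh.psh (φ.source ∩ V) (φ.open_source.inter hV) inter_subset_right (coordField φ v)
    (MDifferentiableOn.mono (coordField_mem hφ v) inter_subset_left) φ hφ
  have hset : φ.target ∩ φ.symm ⁻¹' (φ.source ∩ V) = φ.target ∩ φ.symm ⁻¹' V := by
    ext z
    constructor
    · rintro ⟨h1, h2⟩; exact ⟨h1, h2.2⟩
    · rintro ⟨h1, h2⟩; exact ⟨h1, φ.map_target h1, h2⟩
  rw [hset] at h1
  refine h1.congr fun z hz => ?_
  simp only [Function.comp_apply, chartNorm, coordField_symm hz.1]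

/-- The Ahlfors–Schwarz lemma for holomorphic discs that are affine in a chart. -/
theorem chartNorm_le_of_disc_subset {V : Set X} (hV : IsOpen V)
    (hh : IsSemiNegativeMetric n holVectorFields V h) (hZ : IsAnalyticSubset n V Z)
    (hdense : V ⊆ closure (V \ Z)) (hsmooth : IsSmoothMetricOn (V \ Z) h) {A : ℝ} (hA : 0 < A)
    (hcurv : HolSecCurvLE (V \ Z) h (-A)) (hφ : φ ∈ holCharts n X) {a b : Fin n → ℂ} (hb : b ≠ 0)
    (hab : ∀ t : ℂ, ‖t‖ ≤ 1 → a + t • b ∈ φ.target ∩ φ.symm ⁻¹' V) :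
    chartNorm h φ a b ≤ ENNReal.ofReal (√(2 / A)) := by
  set U := φ.target ∩ φ.symm ⁻¹' (V \ Z)
  have hUo : IsOpen U := φ.symm.isOpen_inter_preimage hZ.isOpen_diff
  have hin : ∀ z ∈ U, IsSingularHermitianInner (chartNorm h φ z) := fun z hz =>
    (hsmooth.1 _ hz.2).1.chartNorm
  have hfin : ∀ z ∈ U, IsFinitePosDef (chartNorm h φ z) := fun z hz =>
    (hsmooth.1 _ hz.2).2.chartNorm hφ hz.1
  have hpos : ∀ z ∈ U, ∀ v, (chartNorm h φ z v).toReal = 0 → v = 0 := by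
    intro z hz v hv
    rw [ENNReal.toReal_eq_zero_iff] at hv
    exact (hfin z hz).2 v (hv.resolve_right ((hfin z hz).1 v))
  obtain ⟨hG, hlap⟩ := laplacian_log_ge_of_curvature_le (M := chartNorm h φ) (H := gram h φ) hUo
    (fun z hz => isHermitianForm_polarForm (hin z hz) (hfin z hz)) hpos gram_apply
    (hsmooth.2 φ hφ) b
  have hposb : ∀ z ∈ U, 0 < (chartNorm h φ z b).toReal := fun z hz =>
    lt_of_le_of_ne ENNReal.toReal_nonneg fun h0 => hb (hpos z hz b h0.symm)
  refine le_of_disc_subset (N := fun z => chartNorm h φ z b) hA (hh.isPshOn_chartNorm hV hφ b)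
    (φ.symm.isOpen_inter_preimage hV) hUo (hZ.hasAnalyticComplement hφ)
    (chart_preimage_subset_closure φ hdense) hG hposb (fun z hz => hlap z hz A ?_ hb) hab
  have h1 := hcurv φ hφ z hz.1 hz.2 b hb
  change (chernR h φ z b).re / (chartNorm h φ z b).toReal ^ 4 ≤ -A at h1
  rw [div_le_iff₀ (pow_pos (hposb z hz) 4)] at h1
  exact h1

theorem differentiableOn_chartComp (hφ : φ ∈ holCharts n X) {W : Set X}
    {θ : ∀ x : X, TangentSpace 𝓘(ℂ, Fin n → ℂ) x} (hθ : θ ∈ holVectorFields W) :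
    DifferentiableOn ℂ (chartComp φ θ) (φ.target ∩ φ.symm ⁻¹' W) := by
  have : IsManifold 𝓘(ℂ, Fin n → ℂ) 1 X := IsManifold.of_le (n := ω) (by simp)
  have h1 : ContMDiffOn (𝓘(ℂ, Fin n → ℂ).tangent) (𝓘(ℂ, Fin n → ℂ).tangent) 1
      (tangentMapWithin 𝓘(ℂ, Fin n → ℂ) 𝓘(ℂ, Fin n → ℂ) φ φ.source)
      (Bundle.TotalSpace.proj ⁻¹' φ.source) :=
    (contMDiffOn_of_mem_maximalAtlas hφ).contMDiffOn_tangentMapWithin (by simp)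
      φ.open_source.uniqueMDiffOn
  have h2 : MDifferentiableOn 𝓘(ℂ, Fin n → ℂ) (𝓘(ℂ, Fin n → ℂ).prod 𝓘(ℂ, Fin n → ℂ))
      (fun z => (⟨φ.symm z, θ (φ.symm z)⟩ : TangentBundle 𝓘(ℂ, Fin n → ℂ) X))
      (φ.target ∩ φ.symm ⁻¹' W) :=
    MDifferentiableOn.comp (u := W) hθ
      ((mdifferentiable_of_mem_holCharts hφ).2.mono inter_subset_left) fun z hz => hz.2
  have h3 := (h1.mdifferentiableOn one_ne_zero).comp h2 fun z hz => φ.map_target hz.1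
  have h4 := ((contMDiff_snd_tangentBundle_modelSpace (n := 1) (Fin n → ℂ)
    𝓘(ℂ, Fin n → ℂ)).mdifferentiable one_ne_zero).comp_mdifferentiableOn h3
  rw [← mdifferentiableOn_iff_differentiableOn]
  refine h4.congr fun z hz => ?_
  have e := mfderivWithin_of_isOpen (I := 𝓘(ℂ, Fin n → ℂ)) (I' := 𝓘(ℂ, Fin n → ℂ)) (f := φ)
    φ.open_source (φ.map_target hz.1)
  exact (congrArg (fun L : (Fin n → ℂ) →L[ℂ] (Fin n → ℂ) => L (θ (φ.symm z))) e).symm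

end

/-! ### Boundedness of logarithmic vector fields near the divisor -/

section

variable {n : ℕ} {X : Type*} [TopologicalSpace X] [ChartedSpace (Fin n → ℂ) X]
  [IsManifold 𝓘(ℂ, Fin n → ℂ) ω X]
  {φ : OpenPartialHomeomorph X (Fin n → ℂ)} {D Z : Set X}
  {h : ∀ x : X, TangentSpace 𝓘(ℂ, Fin n → ℂ) x → ℝ≥0∞}

theorem differentiable_coord_prod (S : Finset (Fin n)) :
    Differentiable ℂ fun w : Fin n → ℂ => ∏ j ∈ S, w j :=
  (contDiff_prod (n := 1) fun j _ => contDiff_apply ℂ ℂ j).differentiable one_ne_zero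

/-- The components of a logarithmic vector field normal to a branch of `D` vanish on it. -/
theorem IsLogVectorField.chartComp_eq_zero (hφ : φ ∈ holCharts n X) {S : Finset (Fin n)}
    (hS : ∀ y ∈ φ.source, y ∈ D ↔ ∏ i ∈ S, φ y i = 0) {W : Set X} (hW : IsOpen W)
    {θ : ∀ x : X, TangentSpace 𝓘(ℂ, Fin n → ℂ) x} (hθ : IsLogVectorField D W θ)
    {z : Fin n → ℂ} (hz : z ∈ φ.target ∩ φ.symm ⁻¹' W) {i : Fin n} (hi : i ∈ S) (hzi : z i = 0)
    (hne : ∀ j ∈ S, j ≠ i → z j ≠ 0) : chartComp φ θ z i = 0 := by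
  -- The field is tested on the local equation P = ∏ z_j of `D`.
  set P : (Fin n → ℂ) → ℂ := fun w => ∏ j ∈ S, w j
  have hPd : Differentiable ℂ P := differentiable_coord_prod S
  have hmd := mdifferentiable_of_mem_holCharts hφ
  have hzs := φ.map_target hz.1
  have hzr := φ.right_inv hz.1
  have hhol : IsHolFun n (W ∩ φ.source) (P ∘ φ) :=
    (hPd.mdifferentiable.comp_mdifferentiableOn hmd.1).mono inter_subset_right
  have h0 := hθ.2 (W ∩ φ.source) (P ∘ φ) (hW.inter φ.open_source) inter_subset_left hhol
    (fun y hy => (hS y hy.1.2).1 hy.2) (φ.symm z) ⟨⟨hz.2, hzs⟩, (hS _ hzs).2 (by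
      rw [hzr]; exact Finset.prod_eq_zero hi hzi)⟩
  -- As z_i = 0, the product rule leaves only the term in dz_i, with a nonzero coefficient.
  have hder : HasFDerivAt P ((∏ j ∈ S.erase i, z j) •
      (ContinuousLinearMap.proj (R := ℂ) (φ := fun _ : Fin n => ℂ) i)) z := by
    have hQ : DifferentiableAt ℂ (fun w : Fin n → ℂ => ∏ j ∈ S.erase i, w j) z :=
      (differentiable_coord_prod _).differentiableAt
    have := (hasFDerivAt_apply (𝕜 := ℂ) i z).mul hQ.hasFDerivAt
    have e : P = fun w => w i * ∏ j ∈ S.erase i, w j :=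
      funext fun w => (Finset.mul_prod_erase S (fun j => w j) hi).symm
    rw [e]
    refine this.congr_fderiv ?_
    ext w
    simp [hzi]
  have hcomp : mfderiv 𝓘(ℂ, Fin n → ℂ) 𝓘(ℂ, ℂ) (P ∘ φ) (φ.symm z) (θ (φ.symm z)) =
      (∏ j ∈ S.erase i, z j) * chartComp φ θ z i := by
    have hder' : HasMFDerivAt 𝓘(ℂ, Fin n → ℂ) 𝓘(ℂ, ℂ) P (φ (φ.symm z))
        ((∏ j ∈ S.erase i, z j) •
          (ContinuousLinearMap.proj (R := ℂ) (φ := fun _ : Fin n => ℂ) i)) := by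
      rw [hzr]; exact hder.hasMFDerivAt
    have h1 := (hder'.comp (φ.symm z) (hmd.mdifferentiableAt hzs).hasMFDerivAt).mfderiv
    rw [h1]
    rfl
  rw [hcomp] at h0
  refine (mul_eq_zero.1 h0).resolve_left (Finset.prod_ne_zero_iff.2 fun j hj => ?_)
  exact hne j (Finset.mem_of_mem_erase hj) (Finset.ne_of_mem_erase hj)

/-- Logarithmic vector fields are bounded near `D` for a metric of negative holomorphic sectional
curvature. -/
theorem logField_bounded (hD : IsNormalCrossingDivisor n D)
    (hh : IsSemiNegativeMetric n holVectorFields Dᶜ h) (hZ : IsAnalyticSubset n Dᶜ Z)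
    (hdense : Dᶜ ⊆ closure (Dᶜ \ Z)) (hsmooth : IsSmoothMetricOn (Dᶜ \ Z) h) {A : ℝ} (hA : 0 < A)
    (hcurv : HolSecCurvLE (Dᶜ \ Z) h (-A)) {x : X}
    {θ : ∀ x : X, TangentSpace 𝓘(ℂ, Fin n → ℂ) x} (hθ : θ ∈ logGerms (n := n) D x) :
    ∃ M : ℝ≥0∞, M ≠ ⊤ ∧ ∀ᶠ y in 𝓝[Dᶜ] x, h y (θ y) ≤ M := by
  obtain ⟨W, hW, hxW, hlog⟩ := hθ
  obtain ⟨φ, hφ, hxs, hx0, S, hS⟩ := hD x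
  have hDo := hD.isOpen_compl
  set O := φ.target ∩ φ.symm ⁻¹' W
  have hOo : IsOpen O := φ.symm.isOpen_inter_preimage hW
  have hxs' : φ.symm 0 = x := by rw [← hx0, φ.left_inv hxs]
  have h0O : (0 : Fin n → ℂ) ∈ O := ⟨hx0 ▸ φ.map_source hxs, by rw [mem_preimage, hxs']; exact hxW⟩
  have hcd := differentiableOn_chartComp hφ hlog.1
  have hev : ∀ᶠ z in 𝓝 (0 : Fin n → ℂ),
      z ∈ O ∧ ‖chartComp φ θ z‖ < ‖chartComp φ θ 0‖ + 1 :=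
    (hOo.eventually_mem h0O).and
      ((hcd.continuousOn.continuousAt (hOo.mem_nhds h0O)).norm.eventually
        (gt_mem_nhds (lt_add_one _)))
  obtain ⟨R, hR, hball⟩ := Metric.eventually_nhds_iff_ball.1 hev
  set C := ‖chartComp φ θ 0‖ + 1
  -- The norm is the maximum of the coordinates, so balls are polydiscs and a displacement in one
  -- coordinate can be checked separately.
  have hcoord : ∀ z : Fin n → ℂ, z ∈ ball 0 R ↔ ∀ i, ‖z i‖ < R := fun z => by
    rw [mem_ball_zero_iff, pi_norm_lt_iff hR]
  set K := ENNReal.ofReal (√(2 / A))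
  have hmain : ∀ z ∈ ball (0 : Fin n → ℂ) (R / 2), φ.symm z ∉ D →
      h (φ.symm z) (θ (φ.symm z)) ≤ ∑ _i : Fin n, ENNReal.ofReal (2 * C / R) * K := by
    intro z hz hzD
    have hzi : ∀ i, ‖z i‖ < R / 2 := by
      rwa [mem_ball_zero_iff, pi_norm_lt_iff (by positivity)] at hz
    have hzR : z ∈ ball (0 : Fin n → ℂ) R := ball_subset_ball (by linarith) hz
    have hzO := (hball z hzR).1
    have hSD : ∀ w ∈ φ.target, φ.symm w ∈ D ↔ ∏ i ∈ S, w i = 0 := fun w hw => by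
      rw [hS _ (φ.map_target hw), φ.right_inv hw]
    have hzS : ∀ j ∈ S, z j ≠ 0 := by
      rw [hSD z hzO.1] at hzD
      exact Finset.prod_ne_zero_iff.1 hzD
    have hN : IsSingularHermitianInner (chartNorm h φ z) := (hh.inner _ hzD).chartNorm
    -- the Ahlfors–Schwarz bound along the coordinate directions
    have hdisc : ∀ (i : Fin n) (c : ℂ), c ≠ 0 → ‖c‖ ≤ R / 2 →
        (i ∈ S → ∀ t : ℂ, ‖t‖ ≤ 1 → z i + t * c ≠ 0) →
        chartNorm h φ z (c • Pi.single i 1) ≤ K := by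
      intro i c hc0 hcR hcS
      refine chartNorm_le_of_disc_subset hDo hh hZ hdense hsmooth hA hcurv hφ
        (smul_ne_zero hc0 (by simp)) fun t ht => ?_
      have hw : ∀ j, (z + t • c • (Pi.single i 1 : Fin n → ℂ)) j =
          if j = i then z i + t * c else z j := by
        intro j
        by_cases hj : j = i
        · subst hj; simp
        · simp [hj]
      have hwR : z + t • c • (Pi.single i 1 : Fin n → ℂ) ∈ ball (0 : Fin n → ℂ) R := by
        rw [hcoord]
        intro j
        rw [hw]
        split_ifs with hj
        · have h1 := norm_add_le (z i) (t * c)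
          rw [norm_mul] at h1
          have h2 := hzi i
          have h3 : ‖t‖ * ‖c‖ ≤ 1 * (R / 2) := by gcongr
          linarith
        · linarith [hzi j]
      have hwt := (hball _ hwR).1.1
      refine ⟨hwt, ?_⟩
      rw [mem_preimage, mem_compl_iff, hSD _ hwt]
      refine Finset.prod_ne_zero_iff.2 fun j hj => ?_
      rw [hw]
      split_ifs with hji
      · exact hcS (hji ▸ hj) t ht
      · exact hzS j hj
    have hterm : ∀ i, chartNorm h φ z (chartComp φ θ z i • Pi.single i 1) ≤
        ENNReal.ofReal (2 * C / R) * K := by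
      intro i
      have hcompC : ∀ w ∈ ball (0 : Fin n → ℂ) R, ‖chartComp φ θ w i‖ ≤ C := fun w hw =>
        (norm_le_pi_norm _ i).trans (hball w hw).2.le
      -- The disc vector is c = z_i/2 in a normal direction, which cannot reach z_i = 0, and c = R/2
      -- otherwise. The component is at most C|z_i|/R, respectively C, so its quotient by c is at
      -- most 2C/R in both cases.
      obtain ⟨c, hc0, hcR, hcS, hcC⟩ : ∃ c : ℂ, c ≠ 0 ∧ ‖c‖ ≤ R / 2 ∧
          (i ∈ S → ∀ t : ℂ, ‖t‖ ≤ 1 → z i + t * c ≠ 0) ∧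
          ‖chartComp φ θ z i / c‖ ≤ 2 * C / R := by
        by_cases hi : i ∈ S
        · have hzi0 := hzS i hi
          refine ⟨z i / 2, by simpa using hzi0, ?_, fun _ t ht h0 => ?_, ?_⟩
          · rw [norm_div, Complex.norm_ofNat]; linarith [hzi i, norm_nonneg (z i)]
          · have h1 : z i * (1 + t / 2) = 0 := by rw [← h0]; ring
            have h2 := (mul_eq_zero.1 h1).resolve_left hzi0
            have h3 : t = -2 := by linear_combination 2 * h2
            rw [h3] at ht
            norm_num at ht
          · -- Schwarz lemma in the normal direction
            set f : ℂ → ℂ := fun t => chartComp φ θ (Function.update z i t) i with hf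
            have hupd : ∀ t ∈ ball (0 : ℂ) R, Function.update z i t ∈ ball (0 : Fin n → ℂ) R := by
              intro t ht
              rw [hcoord]
              intro j
              by_cases hj : j = i
              · subst hj; simpa using ht
              · rw [Function.update_of_ne hj]; linarith [hzi j]
            have hfd : DifferentiableOn ℂ f (ball 0 R) := by
              have h1 : DifferentiableOn ℂ (fun t : ℂ => chartComp φ θ (Function.update z i t))
                  (ball 0 R) := by
                refine hcd.comp (t := O) (fun t _ => ?_) fun t ht => (hball _ (hupd t ht)).1
                exact (hasFDerivAt_update z t).differentiableAt.differentiableWithinAt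
              exact fun t ht => (differentiableWithinAt_pi.1 (h1 t ht)) i
            have hf0 : f 0 = 0 := by
              refine hlog.chartComp_eq_zero hφ hS hW (hball _ (hupd 0 (by simpa using hR))).1 hi
                (by simp) fun j hj hji => ?_
              rw [Function.update_of_ne hji]
              exact hzS j hj
            have hmaps : MapsTo f (ball 0 R) (closedBall (f 0) C) := by
              intro t ht
              rw [hf0, mem_closedBall_zero_iff]
              exact hcompC _ (hupd t ht)
            have h1 := Complex.dist_le_div_mul_dist_of_mapsTo_ball hfd hmaps
              (z := z i) (by rw [mem_ball_zero_iff]; linarith [hzi i])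
            rw [hf0, dist_zero_right, dist_zero_right] at h1
            have h2 : f (z i) = chartComp φ θ z i := by simp [hf]
            rw [h2] at h1
            have h3 : 0 < ‖z i‖ := norm_pos_iff.2 hzi0
            rw [norm_div, norm_div, Complex.norm_ofNat, div_le_iff₀ (by positivity)]
            calc _ ≤ C / R * ‖z i‖ := h1
              _ = _ := by ring
        · refine ⟨((R / 2 : ℝ) : ℂ), ?_, ?_, fun h => absurd h hi, ?_⟩
          · exact_mod_cast (half_pos hR).ne'
          · rw [Complex.norm_real, Real.norm_of_nonneg (by positivity)]
          · rw [norm_div, Complex.norm_real, Real.norm_of_nonneg (by positivity),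
              div_le_iff₀ (by positivity)]
            calc _ ≤ C := hcompC z hzR
              _ = _ := by field_simp
      have e : chartComp φ θ z i • (Pi.single i 1 : Fin n → ℂ) =
          (chartComp φ θ z i / c) • (c • (Pi.single i 1 : Fin n → ℂ)) := by
        rw [smul_smul, div_mul_cancel₀ _ hc0]
      rw [e]
      refine (hN.smul_le _ _).trans ?_
      gcongr
      · rw [← ofReal_norm]; exact ENNReal.ofReal_le_ofReal hcC
      · exact hdisc i c hc0 hcR hcS
    have hsum : h (φ.symm z) (θ (φ.symm z)) = chartNorm h φ z (chartComp φ θ z) := by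
      rw [chartNorm, coordVec_chartComp hφ θ hzO.1]
    rw [hsum]
    conv_lhs => rw [pi_eq_sum_univ' (chartComp φ θ z)]
    refine (hN.sum_le _ _).trans (Finset.sum_le_sum fun i _ => ?_)
    exact hterm i
  refine ⟨∑ _i : Fin n, ENNReal.ofReal (2 * C / R) * K, ?_, ?_⟩
  · exact ENNReal.sum_ne_top.2 fun i _ => ENNReal.mul_ne_top ENNReal.ofReal_ne_top
      ENNReal.ofReal_ne_top
  · have h1 : ∀ᶠ y in 𝓝 x, φ y ∈ ball (0 : Fin n → ℂ) (R / 2) := by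
      apply (φ.continuousAt hxs).eventually
      rw [hx0]
      exact isOpen_ball.mem_nhds (mem_ball_self (by positivity))
    filter_upwards [nhdsWithin_le_nhds h1, nhdsWithin_le_nhds (φ.open_source.mem_nhds hxs),
      self_mem_nhdsWithin] with y hy hys hyD
    have := hmain (φ y) hy (by rwa [φ.left_inv hys])
    rwa [φ.left_inv hys] at this

end

/-! ### Upper limits -/

theorem ennreal_limsup_add_le {α : Type*} (l : Filter α) (u v : α → ℝ≥0∞) :
    limsup (fun a => u a + v a) l ≤ limsup u l + limsup v l := by
  rcases eq_or_ne (limsup u l) ⊤ with hu | hu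
  · simp [hu]
  rcases eq_or_ne (limsup v l) ⊤ with hv | hv
  · simp [hv]
  refine ENNReal.le_of_forall_pos_le_add fun ε hε _ => ?_
  have hε2 : ((ε : ℝ≥0∞) / 2) ≠ 0 := by simpa using hε.ne'
  have h1 := eventually_lt_of_limsup_lt (ENNReal.lt_add_right hu hε2)
  have h2 := eventually_lt_of_limsup_lt (ENNReal.lt_add_right hv hε2)
  refine limsup_le_of_le (h := ?_)
  filter_upwards [h1, h2] with a ha hb
  calc u a + v a ≤ (limsup u l + ε / 2) + (limsup v l + ε / 2) := add_le_add ha.le hb.le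
    _ = limsup u l + limsup v l + ε := by
      rw [add_add_add_comm, ENNReal.add_halves]

theorem ennreal_log_limsup {α : Type*} (l : Filter α) (u : α → ℝ≥0∞) :
    ENNReal.log (limsup u l) = limsup (fun a => ENNReal.log (u a)) l :=
  OrderIso.limsup_apply ENNReal.logOrderIso

/-- The inequality for v + w and v - w, whose sum and difference are 2v and 2w, is the reverse
inequality for v and w. -/
theorem IsSingularHermitianInner.of_parallelogram_le {V : Type*} [AddCommGroup V] [Module ℂ V]
    {N : V → ℝ≥0∞} (h0 : N 0 = 0) (hs : ∀ (c : ℂ) (v : V), c ≠ 0 → N (c • v) = ‖c‖ₑ * N v)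
    (ht : ∀ v w, N (v + w) ≤ N v + N w)
    (hp : ∀ v w, N (v + w) ^ 2 + N (v - w) ^ 2 ≤ 2 * N v ^ 2 + 2 * N w ^ 2) :
    IsSingularHermitianInner N := by
  refine ⟨h0, hs, ht, fun v w => (hp v w).antisymm ?_⟩
  have h2 : ∀ v, N ((2 : ℂ) • v) = 2 * N v := fun v => by
    rw [hs 2 v two_ne_zero, ← ofReal_norm, Complex.norm_ofNat]; simp
  have h1 := hp (v + w) (v - w)
  have e1 : v + w + (v - w) = (2 : ℂ) • v := by rw [two_smul]; abel
  have e2 : v + w - (v - w) = (2 : ℂ) • w := by rw [two_smul]; abel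
  rw [e1, e2, h2, h2] at h1
  have h3 : 2 * (2 * N v ^ 2 + 2 * N w ^ 2) ≤ 2 * (N (v + w) ^ 2 + N (v - w) ^ 2) := by
    calc _ = (2 * N v) ^ 2 + (2 * N w) ^ 2 := by ring
      _ ≤ _ := h1
      _ = _ := by ring
  exact (ENNReal.mul_le_mul_iff_right two_ne_zero ENNReal.ofNat_ne_top).1 h3

theorem limsupExt_comp_symm {n : ℕ} {X : Type*} [TopologicalSpace X] {D : Set X}
    {φ : OpenPartialHomeomorph X (Fin n → ℂ)} {z : Fin n → ℂ} (hz : z ∈ φ.target) (u : X → EReal) :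
    limsupExt (φ.symm ⁻¹' D) (u ∘ φ.symm) z = limsupExt D u (φ.symm z) := by
  rw [limsupExt, limsupExt, ← φ.symm.map_nhdsWithin_preimage_eq hz]
  rfl

/-! ### Local geometry of a normal crossing divisor -/

section

variable {n : ℕ} {X : Type*} [TopologicalSpace X] [ChartedSpace (Fin n → ℂ) X]
  {φ : OpenPartialHomeomorph X (Fin n → ℂ)} {D : Set X}

/-- Some line through any given point leaves a normal crossing divisor. -/
theorem IsNormalCrossingDivisor.exists_chart_line (hD : IsNormalCrossingDivisor n D) (x : X) :
    ∃ φ ∈ holCharts n X, x ∈ φ.source ∧ ∃ c : Fin n → ℂ,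
      ∀ᶠ t in 𝓝[≠] (0 : ℂ), φ x + t • c ∉ φ.symm ⁻¹' D := by
  obtain ⟨φ, hφ, hxs, hx0, S, hS⟩ := hD x
  -- On the diagonal of centred coordinates every z_i equals t, so no product of coordinates
  -- vanishes for t ≠ 0.
  refine ⟨φ, hφ, hxs, fun _ => 1, ?_⟩
  have h1 : ∀ᶠ t in 𝓝 (0 : ℂ), φ x + t • (fun _ => (1 : ℂ)) ∈ φ.target := by
    have : Continuous fun t : ℂ => φ x + t • (fun _ : Fin n => (1 : ℂ)) := by fun_prop
    exact this.continuousAt.eventually (φ.open_target.mem_nhds (by simpa using φ.map_source hxs))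
  filter_upwards [nhdsWithin_le_nhds h1, self_mem_nhdsWithin] with t ht ht0 hmem
  rw [mem_preimage, hS _ (φ.map_target ht), φ.right_inv ht, hx0, Finset.prod_eq_zero_iff] at hmem
  obtain ⟨i, -, hi⟩ := hmem
  exact ht0 (by simpa using hi)

theorem IsNormalCrossingDivisor.nhdsWithin_compl_neBot (hD : IsNormalCrossingDivisor n D) (x : X) :
    (𝓝[Dᶜ] x).NeBot := by
  obtain ⟨φ, hφ, hxs, c, hc⟩ := hD.exists_chart_line x
  have h2 : Tendsto (fun t : ℂ => φ x + t • c) (𝓝[≠] 0) (𝓝[(φ.symm ⁻¹' D)ᶜ] (φ x)) := by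
    apply tendsto_nhdsWithin_iff.2 ⟨?_, hc⟩
    have : Continuous fun t : ℂ => φ x + t • c := by fun_prop
    simpa using (this.tendsto 0).mono_left nhdsWithin_le_nhds
  have h3 : (𝓝[(φ.symm ⁻¹' D)ᶜ] (φ x)).NeBot := h2.neBot
  have h4 := φ.symm.map_nhdsWithin_preimage_eq (φ.map_source hxs) Dᶜ
  rw [φ.left_inv hxs] at h4
  rw [← h4]
  exact h3.map _

/-- The chart need not be adapted to `D`; the equation is transported from an adapted chart ψ. -/
theorem IsNormalCrossingDivisor.isHypersurfaceAt (hD : IsNormalCrossingDivisor n D)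
    (hφ : φ ∈ holCharts n X) {z : Fin n → ℂ} (hz : z ∈ φ.target) :
    IsHypersurfaceAt (φ.symm ⁻¹' D) z := by
  obtain ⟨ψ, hψ, hxs, -, S, hS⟩ := hD (φ.symm z)
  refine ⟨φ.target ∩ φ.symm ⁻¹' ψ.source, φ.symm.isOpen_inter_preimage ψ.open_source, ⟨hz, hxs⟩,
    fun y => ∏ i ∈ S, ψ (φ.symm y) i, ?_, fun y hy => hS _ hy.2⟩
  have hhol : IsHolFun n ψ.source ((fun w : Fin n → ℂ => ∏ i ∈ S, w i) ∘ ψ) :=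
    (differentiable_coord_prod S).mdifferentiable.comp_mdifferentiableOn
      (mdifferentiable_of_mem_holCharts hψ).1
  exact hhol.differentiableOn_chart hφ

/-- Locally `D` lies in the image of coordinate hyperplanes under a change of charts, and
differentiable maps preserve null sets. -/
theorem IsNormalCrossingDivisor.isNullSet (hD : IsNormalCrossingDivisor n D) : IsNullSet n D := by
  intro φ hφ
  refine measure_null_of_locally_null _ fun z hz => ?_
  obtain ⟨ψ, hψ, hxs, -, S, hS⟩ := hD (φ.symm z)
  refine ⟨φ.target ∩ φ.symm ⁻¹' (ψ.source ∩ D), ?_, ?_⟩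
  · have h1 : φ.target ∩ φ.symm ⁻¹' ψ.source ∈ 𝓝 z :=
      (φ.symm.isOpen_inter_preimage ψ.open_source).mem_nhds ⟨hz.1, hxs⟩
    filter_upwards [nhdsWithin_le_nhds h1, self_mem_nhdsWithin] with w hw hwD
    exact ⟨hw.1, hw.2, hwD.2⟩
  · set T : Set (Fin n → ℂ) := (ψ.target ∩ ψ.symm ⁻¹' φ.source) ∩ ⋃ i : Fin n, {w | w i = 0} with hT
    have hTnull : volume T = 0 := by
      refine measure_mono_null inter_subset_right (measure_iUnion_null fun i => ?_)
      exact Measure.pi_hyperplane (fun _ : Fin n => (volume : Measure ℂ)) i 0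
    have hd : DifferentiableOn ℂ (fun w => φ (ψ.symm w)) T := by
      rw [← mdifferentiableOn_iff_differentiableOn]
      exact MDifferentiableOn.comp (mdifferentiable_of_mem_holCharts hφ).1
        ((mdifferentiable_of_mem_holCharts hψ).2.mono fun w hw => hw.1.1) fun w hw => hw.1.2
    refine measure_mono_null ?_ (addHaar_image_eq_zero_of_differentiableOn_of_addHaar_eq_zero volume
      (hd.restrictScalars ℝ) hTnull)
    rintro w ⟨hwt, hws, hwD⟩
    refine ⟨ψ (φ.symm w), ⟨⟨ψ.map_source hws, ?_⟩, ?_⟩, ?_⟩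
    · rw [mem_preimage, ψ.left_inv hws]; exact φ.map_target hwt
    · obtain ⟨i, -, hi⟩ := Finset.prod_eq_zero_iff.1 ((hS _ hws).1 hwD)
      exact mem_iUnion.2 ⟨i, hi⟩
    · simp only [ψ.left_inv hws, φ.right_inv hwt]

end

/-! ### The fibres of the logarithmic tangent bundle -/

section

variable {n : ℕ} {X : Type*} [TopologicalSpace X] [ChartedSpace (Fin n → ℂ) X]
  [IsManifold 𝓘(ℂ, Fin n → ℂ) ω X] {D : Set X} {x : X}

theorem logToTangent_mk (θ : logGerms (n := n) D x) :
    logToTangent D x (Submodule.Quotient.mk θ) = θ.1 x := rfl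

open Classical in
/-- The section of the logarithmic tangent bundle given by a logarithmic vector field. -/
def germSection (D : Set X) (θ : ∀ y : X, TangentSpace 𝓘(ℂ, Fin n → ℂ) y) (y : X) :
    LogFiber (n := n) D y :=
  if hy : θ ∈ logGerms D y then Submodule.Quotient.mk ⟨θ, hy⟩ else 0

theorem germSection_of_mem {θ : ∀ y : X, TangentSpace 𝓘(ℂ, Fin n → ℂ) y} (hθ : θ ∈ logGerms D x) :
    germSection D θ x = Submodule.Quotient.mk ⟨θ, hθ⟩ :=
  dif_pos hθ

theorem IsLogVectorField.germSection_mem {W : Set X} (hW : IsOpen W)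
    {θ : ∀ y : X, TangentSpace 𝓘(ℂ, Fin n → ℂ) y} (hθ : IsLogVectorField D W θ) :
    germSection D θ ∈ logSections D W := fun _ hx => ⟨θ, by
  filter_upwards [hW.mem_nhds hx] with y hy
  exact ⟨⟨W, hW, hy, hθ⟩, germSection_of_mem _⟩⟩

theorem logToTangent_mem_holVectorFields {W : Set X} {s : ∀ x : X, LogFiber (n := n) D x}
    (hs : s ∈ logSections D W) : (fun y => logToTangent D y (s y)) ∈ holVectorFields W := by
  intro x hx
  obtain ⟨θ, hθ⟩ := hs x hx
  obtain ⟨⟨W', hW', hx', hlog⟩, -⟩ := hθ.self_of_nhds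
  have h1 := (hlog.1 x hx').mdifferentiableAt (hW'.mem_nhds hx')
  refine (h1.congr_of_eventuallyEq ?_).mdifferentiableWithinAt
  filter_upwards [hθ] with y hy
  obtain ⟨hy, e⟩ := hy
  rw [e, logToTangent_mk]

/-- Off `D` the canonical map from the logarithmic to the usual tangent space is injective. -/
theorem logToTangent_injective (hD : IsOpen Dᶜ) (hx : x ∉ D) :
    Function.Injective (logToTangent (n := n) D x) := by
  rw [← LinearMap.ker_eq_bot, LinearMap.ker_eq_bot']
  intro ξ hξ
  obtain ⟨θ, rfl⟩ := Submodule.Quotient.mk_surjective _ ξ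
  rw [logToTangent_mk] at hξ
  rw [Submodule.Quotient.mk_eq_zero]
  set φ := chartAt (Fin n → ℂ) x
  have hφ : φ ∈ holCharts n X := IsManifold.chart_mem_maximalAtlas x
  have hxs : x ∈ φ.source := mem_chart_source _ x
  have hmd := mdifferentiable_of_mem_holCharts hφ
  obtain ⟨W, hW, hxW, hlog⟩ := θ.2
  set W' := W ∩ (φ.source ∩ Dᶜ)
  have hWo : IsOpen W' := hW.inter (φ.open_source.inter hD)
  have hxW' : x ∈ W' := ⟨hxW, hxs, hx⟩
  -- On an open set disjoint from `D` the logarithmic condition is empty, so coordinate fields may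
  -- be used.
  have key : ∀ τ ∈ holVectorFields (X := X) (n := n) W', τ ∈ logGerms D x := fun τ hτ =>
    ⟨W', hWo, hxW', hτ, fun V g _ hV _ _ y hy => absurd hy.2 (hV hy.1).2.2⟩
  set f : Fin n → X → ℂ := fun j y => chartComp φ θ.1 (φ y) j with hf
  have hfhol : ∀ j, IsHolFun n W' (f j) := by
    intro j
    have h1 : DifferentiableOn ℂ (fun z => chartComp φ θ.1 z j) (φ.target ∩ φ.symm ⁻¹' W) :=
      fun z hz => differentiableWithinAt_pi.1 (differentiableOn_chartComp hφ hlog.1 z hz) j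
    exact MDifferentiableOn.comp (mdifferentiableOn_iff_differentiableOn.2 h1)
      (hmd.1.mono fun y hy => hy.2.1) fun y hy => ⟨φ.map_source hy.2.1, by
        rw [mem_preimage, φ.left_inv hy.2.1]; exact hy.1⟩
  have hfx : ∀ j, f j x = 0 := by
    intro j
    have h1 : chartComp φ θ.1 (φ x) = 0 := by
      refine coordVec_eq_zero hφ (φ.map_source hxs) ?_
      rw [coordVec_chartComp hφ _ (φ.map_source hxs), φ.left_inv hxs]
      exact hξ
    simp only [hf, h1, Pi.zero_apply]
  have he : ∀ j : Fin n, coordField φ (Pi.single j 1) ∈ logGerms D x := fun j =>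
    key _ (MDifferentiableOn.mono (coordField_mem hφ _) fun y hy => hy.2.1)
  have hg : ∀ j, (fun y => f j y • coordField φ (Pi.single j 1) y) ∈ logGerms D x := fun j =>
    key _ (MDifferentiableOn.smul_section (hfhol j)
      (MDifferentiableOn.mono (coordField_mem hφ _) fun y hy => hy.2.1))
  set g : Fin n → logGerms (n := n) D x := fun j => ⟨_, hg j⟩
  have hgv : ∀ j, g j ∈ logVanishing D x := fun j =>
    Submodule.subset_span ⟨W', f j, hWo, hxW', hfhol j, hfx j, _, he j, fun y _ => rfl⟩
  -- Near x the field is the sum of its components f_j times the coordinate fields, and f_j x = 0.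
  -- The remainder vanishes near x but perhaps not elsewhere; it is a generator with `σ = 0`.
  have hr : θ - ∑ j, g j ∈ logVanishing D x := by
    refine Submodule.subset_span ⟨W', fun _ => 0, hWo, hxW', mdifferentiableOn_const, rfl, 0,
      Submodule.zero_mem _, fun y hy => ?_⟩
    have h1 : (∑ j, g j).1 y = ∑ j, f j y • coordField φ (Pi.single j 1) y := by
      rw [AddSubmonoidClass.coe_finsetSum, Finset.sum_apply]
    have h2 : ∑ j, f j y • coordField φ (Pi.single j 1) y = θ.1 y := by
      have h3 := coordVec_chartComp hφ θ.1 (φ.map_source hy.2.1)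
      have h4 : chartComp φ θ.1 (φ y) = ∑ j, f j y • (Pi.single j 1 : Fin n → ℂ) :=
        pi_eq_sum_univ' _
      rw [h4, coordVec_sum] at h3
      simp only [coordVec_smul] at h3
      have h5 : ∀ {a b : X} (_ : a = b), (θ.1 a : Fin n → ℂ) = θ.1 b := by
        rintro a _ rfl; rfl
      exact h3.trans (h5 (φ.left_inv hy.2.1))
    rw [zero_smul]
    change θ.1 y - (∑ j, g j).1 y = 0
    rw [h1, h2, sub_self]
  have := Submodule.add_mem _ hr (Submodule.sum_mem _ fun j (_ : j ∈ Finset.univ) => hgv j)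
  rwa [sub_add_cancel] at this

end

/-! ### The extension of the metric -/

theorem IsPshOn.mono {n : ℕ} {Ω Ω' : Set (Fin n → ℂ)} {u : (Fin n → ℂ) → EReal} (hu : IsPshOn Ω u)
    (hΩ : Ω' ⊆ Ω) : IsPshOn Ω' u :=
  ⟨fun z hz => hu.lt_top z (hΩ hz), hu.usc.mono hΩ,
    fun a b hab => hu.submean a b fun t ht => hΩ (hab t ht)⟩

section

variable {n : ℕ} {X : Type*} [TopologicalSpace X] [ChartedSpace (Fin n → ℂ) X]
  [IsManifold 𝓘(ℂ, Fin n → ℂ) ω X] {D : Set X}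
  {h : ∀ x : X, TangentSpace 𝓘(ℂ, Fin n → ℂ) x → ℝ≥0∞}

/-- The metric `h` is locally bounded, near `D`, on logarithmic vector fields. -/
def BoundedOnLogFields (D : Set X) (h : ∀ x : X, TangentSpace 𝓘(ℂ, Fin n → ℂ) x → ℝ≥0∞) : Prop :=
  ∀ x, ∀ θ ∈ logGerms (n := n) D x, ∃ M : ℝ≥0∞, M ≠ ⊤ ∧ ∀ᶠ y in 𝓝[Dᶜ] x, h y (θ y) ≤ M

/-- The extension of `h` by upper limits along logarithmic vector fields. -/
def logMetric (D : Set X) (h : ∀ x : X, TangentSpace 𝓘(ℂ, Fin n → ℂ) x → ℝ≥0∞) (x : X)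
    (ξ : LogFiber (n := n) D x) : ℝ≥0∞ :=
  limsup (fun y => h y ((Submodule.Quotient.mk_surjective _ ξ).choose.1 y)) (𝓝[Dᶜ] x)

/-- On a generator f σ the norm is at most |f| times the local bound for σ, and f x = 0. This is the
first use of boundedness. -/
theorem tendsto_of_mem_logVanishing (hin : ∀ x ∈ Dᶜ, IsSingularHermitianInner (h x))
    (hb : BoundedOnLogFields D h) {x : X} {τ : logGerms (n := n) D x} (hτ : τ ∈ logVanishing D x) :
    Tendsto (fun y => h y (τ.1 y)) (𝓝[Dᶜ] x) (𝓝 0) := by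
  induction hτ using Submodule.span_induction with
  | mem τ hτ =>
    obtain ⟨W, f, hW, hxW, hf, hfx, σ, hσ, e⟩ := hτ
    obtain ⟨M, hM, hMσ⟩ := hb x σ hσ
    have hfc : Tendsto (fun y => ‖f y‖ₑ * M) (𝓝[Dᶜ] x) (𝓝 0) := by
      have h1 : ContinuousAt f x := (MDifferentiableOn.continuousOn hf).continuousAt
        (hW.mem_nhds hxW)
      have h2 : Tendsto (fun y => ‖f y‖ₑ) (𝓝[Dᶜ] x) (𝓝 0) := by
        have := h1.enorm.tendsto.mono_left (nhdsWithin_le_nhds (s := Dᶜ))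
        simpa [hfx] using this
      simpa using ENNReal.Tendsto.mul_const h2 (Or.inr hM)
    refine tendsto_of_tendsto_of_tendsto_of_le_of_le' tendsto_const_nhds hfc
      (Eventually.of_forall fun _ => zero_le) ?_
    filter_upwards [hMσ, nhdsWithin_le_nhds (hW.mem_nhds hxW), self_mem_nhdsWithin] with y hy hyW hyD
    rw [e y hyW]
    exact ((hin y hyD).smul_le _ _).trans (by gcongr)
  | zero =>
    refine tendsto_const_nhds.congr' ?_
    filter_upwards [self_mem_nhdsWithin] with y hy
    exact (hin y hy).map_zero.symm
  | add τ σ _ _ h1 h2 =>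
    refine tendsto_of_tendsto_of_tendsto_of_le_of_le' tendsto_const_nhds
      (by simpa using h1.add h2) (Eventually.of_forall fun _ => zero_le) ?_
    filter_upwards [self_mem_nhdsWithin] with y hy
    exact (hin y hy).triangle _ _
  | smul c τ _ h1 =>
    refine tendsto_of_tendsto_of_tendsto_of_le_of_le' tendsto_const_nhds
      (by simpa using ENNReal.Tendsto.const_mul h1 (Or.inr (enorm_ne_top (x := c))))
      (Eventually.of_forall fun _ => zero_le) ?_
    filter_upwards [self_mem_nhdsWithin] with y hy
    exact (hin y hy).smul_le _ _

/-- Two representatives differ by a germ whose norm tends to 0, so by the triangle inequality their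
upper limits agree. -/
theorem logMetric_mk (hin : ∀ x ∈ Dᶜ, IsSingularHermitianInner (h x))
    (hb : BoundedOnLogFields D h) {x : X} (θ : logGerms (n := n) D x) :
    logMetric D h x (Submodule.Quotient.mk θ) = limsup (fun y => h y (θ.1 y)) (𝓝[Dᶜ] x) := by
  have key : ∀ σ τ : logGerms (n := n) D x, σ - τ ∈ logVanishing D x →
      limsup (fun y => h y (σ.1 y)) (𝓝[Dᶜ] x) ≤ limsup (fun y => h y (τ.1 y)) (𝓝[Dᶜ] x) := by
    intro σ τ hστ
    have h0 : limsup (fun y => h y ((σ - τ).1 y)) (𝓝[Dᶜ] x) ≤ 0 := by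
      rcases (𝓝[Dᶜ] x).eq_or_neBot with hbot | hne
      · simp [hbot]
      · exact (tendsto_of_mem_logVanishing hin hb hστ).limsup_eq.le
    calc limsup (fun y => h y (σ.1 y)) (𝓝[Dᶜ] x)
        ≤ limsup (fun y => h y (τ.1 y) + h y ((σ - τ).1 y)) (𝓝[Dᶜ] x) := by
          refine limsup_le_limsup ?_
          filter_upwards [self_mem_nhdsWithin] with y hy
          have h1 := (hin y hy).triangle (τ.1 y) (σ.1 y - τ.1 y)
          rw [add_sub_cancel] at h1
          exact h1
      _ ≤ _ := (ennreal_limsup_add_le _ _ _).trans (by rw [nonpos_iff_eq_zero.1 h0, add_zero])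
  have hq := (Submodule.Quotient.mk_surjective (logVanishing (n := n) D x)
    (Submodule.Quotient.mk θ)).choose_spec
  have hq' := (Submodule.Quotient.eq _).1 hq
  have hq'' := (Submodule.Quotient.eq _).1 hq.symm
  exact (key _ _ hq').antisymm (key _ _ hq'')

/-- Near x the section comes from a single field θ, so its values at the nearby points off `D` are
those entering the upper limit at x. -/
theorem log_logMetric_eq_limsupExt (hin : ∀ x ∈ Dᶜ, IsSingularHermitianInner (h x))
    (hb : BoundedOnLogFields D h) {W : Set X} {s : ∀ x : X, LogFiber (n := n) D x}
    (hs : s ∈ logSections D W) {x : X} (hx : x ∈ W) :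
    ENNReal.log (logMetric D h x (s x)) =
      limsupExt D (fun y => ENNReal.log (h y (logToTangent D y (s y)))) x := by
  obtain ⟨θ, hθ⟩ := hs x hx
  obtain ⟨hxθ, e⟩ := hθ.self_of_nhds
  rw [e, logMetric_mk hin hb, ennreal_log_limsup, limsupExt]
  refine limsup_congr ?_
  filter_upwards [nhdsWithin_le_nhds hθ] with y hy
  obtain ⟨hyθ, e'⟩ := hy
  rw [e', logToTangent_mk]

theorem IsSemiNegativeMetric.isPshOn_logToTangent (hD : IsOpen Dᶜ)
    (hh : IsSemiNegativeMetric n holVectorFields Dᶜ h) {W : Set X} (hW : IsOpen W)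
    {s : ∀ x : X, LogFiber (n := n) D x} (hs : s ∈ logSections D W)
    {φ : OpenPartialHomeomorph X (Fin n → ℂ)} (hφ : φ ∈ holCharts n X) :
    IsPshOn ((φ.target ∩ φ.symm ⁻¹' W) \ φ.symm ⁻¹' D)
      ((fun y => ENNReal.log (h y (logToTangent D y (s y)))) ∘ φ.symm) := by
  have h1 := hh.psh (W ∩ Dᶜ) (hW.inter hD) inter_subset_right _
    (MDifferentiableOn.mono (logToTangent_mem_holVectorFields hs) inter_subset_left) φ hφ
  have e : (φ.target ∩ φ.symm ⁻¹' W) \ φ.symm ⁻¹' D = φ.target ∩ φ.symm ⁻¹' (W ∩ Dᶜ) := by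
    rw [preimage_inter, ← inter_assoc, preimage_compl, sdiff_eq]
  rwa [e]

/-- Off `D` the upper limit is the value itself, by upper semicontinuity of the log-norm of a
holomorphic field. -/
theorem logMetric_eq (hD : IsOpen Dᶜ) (hh : IsSemiNegativeMetric n holVectorFields Dᶜ h)
    (hb : BoundedOnLogFields D h) {x : X} (hx : x ∉ D) (ξ : LogFiber (n := n) D x) :
    logMetric D h x ξ = h x (logToTangent D x ξ) := by
  obtain ⟨⟨θ, hθ⟩, rfl⟩ := Submodule.Quotient.mk_surjective _ ξ
  obtain ⟨W, hW, hxW, hlog⟩ := id hθ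
  rw [← germSection_of_mem hθ]
  have hs := hlog.germSection_mem hW
  set φ := chartAt (Fin n → ℂ) x
  have hφ : φ ∈ holCharts n X := IsManifold.chart_mem_maximalAtlas x
  have hxs : x ∈ φ.source := mem_chart_source _ x
  apply ENNReal.log_injective
  rw [log_logMetric_eq_limsupExt hh.inner hb hs hxW]
  have h1 := limsupExt_eq (z := φ x) (hh.isPshOn_logToTangent hD hW hs hφ).usc
    ((φ.symm.isOpen_inter_preimage hW).mem_nhds ⟨φ.map_source hxs, by
      rwa [mem_preimage, φ.left_inv hxs]⟩) (by rwa [mem_preimage, φ.left_inv hxs])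
  rw [limsupExt_comp_symm (φ.map_source hxs), Function.comp_apply, φ.left_inv hxs] at h1
  exact h1

/-- The extension theorem across a hypersurface; boundedness on logarithmic fields supplies its
finiteness hypothesis. -/
theorem logMetric_isPshOnManifold (hD : IsNormalCrossingDivisor n D)
    (hh : IsSemiNegativeMetric n holVectorFields Dᶜ h) (hb : BoundedOnLogFields D h)
    {W : Set X} (hW : IsOpen W) {s : ∀ x : X, LogFiber (n := n) D x} (hs : s ∈ logSections D W) :
    IsPshOnManifold n W fun x => ENNReal.log (logMetric D h x (s x)) := by
  intro φ hφ
  have e : ∀ z ∈ φ.target ∩ φ.symm ⁻¹' W, limsupExt (φ.symm ⁻¹' D)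
      ((fun y => ENNReal.log (h y (logToTangent D y (s y)))) ∘ φ.symm) z =
        ENNReal.log (logMetric D h (φ.symm z) (s (φ.symm z))) := fun z hz => by
    rw [limsupExt_comp_symm hz.1, log_logMetric_eq_limsupExt hh.inner hb hs hz.2]
  refine (isPshOn_limsupExt (φ.symm.isOpen_inter_preimage hW)
    (hh.isPshOn_logToTangent hD.isOpen_compl hW hs hφ)
    (fun z hz => hD.isHypersurfaceAt hφ hz.1) fun z hz => ?_).congr e
  rw [e z hz, ENNReal.log_lt_top_iff]
  obtain ⟨θ, hθ⟩ := hs _ hz.2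
  obtain ⟨hxθ, e'⟩ := hθ.self_of_nhds
  obtain ⟨M, hM, hMθ⟩ := hb _ θ hxθ
  rw [e', logMetric_mk hh.inner hb]
  exact (limsup_le_of_le (h := hMθ)).trans_lt hM.lt_top

theorem logMetric_parallelogram_le (hD : IsNormalCrossingDivisor n D)
    (hh : IsSemiNegativeMetric n holVectorFields Dᶜ h) (hb : BoundedOnLogFields D h) {x : X}
    (ξ η : LogFiber (n := n) D x) :
    logMetric D h x (ξ + η) ^ 2 + logMetric D h x (ξ - η) ^ 2 ≤
      2 * logMetric D h x ξ ^ 2 + 2 * logMetric D h x η ^ 2 := by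
  have := hD.nhdsWithin_compl_neBot x
  obtain ⟨⟨θ, hθ⟩, rfl⟩ := Submodule.Quotient.mk_surjective _ ξ
  obtain ⟨⟨τ, hτ⟩, rfl⟩ := Submodule.Quotient.mk_surjective _ η
  have hadd := Submodule.add_mem _ hθ hτ
  have hsub := Submodule.sub_mem _ hθ hτ
  change logMetric D h x (Submodule.Quotient.mk ⟨θ + τ, hadd⟩) ^ 2 +
    logMetric D h x (Submodule.Quotient.mk ⟨θ - τ, hsub⟩) ^ 2 ≤ _
  -- the right-hand side as an upper limit
  have hmono : Monotone fun r : ℝ≥0∞ => 2 * r ^ 2 := fun a b hab => by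
    show 2 * a ^ 2 ≤ 2 * b ^ 2
    gcongr
  have hcont : Continuous fun r : ℝ≥0∞ => 2 * r ^ 2 :=
    (ENNReal.continuous_const_mul ENNReal.ofNat_ne_top).comp (ENNReal.continuous_pow 2)
  rw [logMetric_mk hh.inner hb ⟨θ, hθ⟩, logMetric_mk hh.inner hb ⟨τ, hτ⟩,
    hmono.map_limsup_of_continuousAt _ hcont.continuousAt,
    hmono.map_limsup_of_continuousAt _ hcont.continuousAt]
  refine le_trans ?_ (ennreal_limsup_add_le _ _ _)
  -- For K above the upper limit of 2h(θ)² + 2h(τ)², the parallelogram law off `D` bounds the sum of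
  -- squares by K on a punctured disc through x, and averaging over a circle carries the bound to x.
  refine le_of_forall_gt_imp_ge_of_dense fun K hK => ?_
  have hK' := eventually_lt_of_limsup_lt hK
  obtain ⟨φ, hφ, hxs, c, hc⟩ := hD.exists_chart_line x
  obtain ⟨W₁, hW₁, hx₁, hl₁⟩ := id hadd
  obtain ⟨W₂, hW₂, hx₂, hl₂⟩ := id hsub
  have h1 := logMetric_isPshOnManifold hD hh hb hW₁ (hl₁.germSection_mem hW₁) φ hφ
  have h2 := logMetric_isPshOnManifold hD hh hb hW₂ (hl₂.germSection_mem hW₂) φ hφ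
  set F₁ : X → ℝ≥0∞ := fun y => logMetric D h y (germSection D (θ + τ) y) with hF₁
  set F₂ : X → ℝ≥0∞ := fun y => logMetric D h y (germSection D (θ - τ) y) with hF₂
  set O := φ.target ∩ φ.symm ⁻¹' (W₁ ∩ W₂)
  have hOo : IsOpen O := φ.symm.isOpen_inter_preimage (hW₁.inter hW₂)
  have hxO : φ x ∈ O := ⟨φ.map_source hxs, by
    rw [mem_preimage, φ.left_inv hxs]; exact ⟨hx₁, hx₂⟩⟩
  have hline : Tendsto (fun t : ℂ => φ x + t • c) (𝓝[≠] 0) (𝓝[(φ.symm ⁻¹' D)ᶜ] (φ x)) := by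
    apply tendsto_nhdsWithin_iff.2 ⟨?_, hc⟩
    have : Continuous fun t : ℂ => φ x + t • c := by fun_prop
    simpa using (this.tendsto 0).mono_left nhdsWithin_le_nhds
  have hsymm : Tendsto φ.symm (𝓝[(φ.symm ⁻¹' D)ᶜ] (φ x)) (𝓝[Dᶜ] x) := by
    have h4 := φ.symm.map_nhdsWithin_preimage_eq (φ.map_source hxs) Dᶜ
    rw [φ.left_inv hxs] at h4
    exact h4.le
  have hmain := add_sq_le_of_punctured_disc (z := φ x) (c := c) (K := K) hOo
    (N₁ := F₁ ∘ φ.symm) (N₂ := F₂ ∘ φ.symm)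
    (h1.mono fun z hz => ⟨hz.1, hz.2.1⟩) (h2.mono fun z hz => ⟨hz.1, hz.2.2⟩) hxO ?_
  · rw [Function.comp_apply, Function.comp_apply, φ.left_inv hxs, hF₁, hF₂] at hmain
    simp only [germSection_of_mem hadd, germSection_of_mem hsub] at hmain
    exact hmain
  · filter_upwards [(hsymm.comp hline).eventually hK', hc,
      (hline.mono_right nhdsWithin_le_nhds).eventually (hOo.mem_nhds hxO)] with t ht htD htO
    have htD' : φ.symm (φ x + t • c) ∉ D := htD
    have m₁ : θ + τ ∈ logGerms D (φ.symm (φ x + t • c)) := ⟨W₁, hW₁, htO.2.1, hl₁⟩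
    have m₂ : θ - τ ∈ logGerms D (φ.symm (φ x + t • c)) := ⟨W₂, hW₂, htO.2.2, hl₂⟩
    simp only [Function.comp_apply, hF₁, hF₂]
    rw [germSection_of_mem m₁, germSection_of_mem m₂, logMetric_eq hD.isOpen_compl hh hb htD',
      logMetric_eq hD.isOpen_compl hh hb htD', logToTangent_mk, logToTangent_mk]
    refine le_trans (le_of_eq ?_) ht.le
    exact (hh.inner _ htD').parallelogram _ _

/-- Upper limits are only subadditive, which suffices for the triangle inequality but not for the
parallelogram law; there plurisubharmonicity is used. -/
theorem logMetric_inner (hD : IsNormalCrossingDivisor n D)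
    (hh : IsSemiNegativeMetric n holVectorFields Dᶜ h) (hb : BoundedOnLogFields D h) (x : X) :
    IsSingularHermitianInner (logMetric D h x) := by
  refine .of_parallelogram_le ?_ ?_ ?_ (logMetric_parallelogram_le hD hh hb)
  · refine (logMetric_mk hh.inner hb 0).trans ?_
    refine (limsup_congr (v := fun _ => 0) ?_).trans limsup_const_bot
    filter_upwards [self_mem_nhdsWithin] with y hy
    exact (hh.inner y hy).map_zero
  · intro c ξ hc
    obtain ⟨θ, rfl⟩ := Submodule.Quotient.mk_surjective _ ξ
    rw [← Submodule.Quotient.mk_smul, logMetric_mk hh.inner hb, logMetric_mk hh.inner hb,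
      ← ENNReal.limsup_const_mul_of_ne_top enorm_ne_top]
    refine limsup_congr ?_
    filter_upwards [self_mem_nhdsWithin] with y hy
    exact (hh.inner y hy).map_smul c _ hc
  · intro ξ η
    obtain ⟨θ, rfl⟩ := Submodule.Quotient.mk_surjective _ ξ
    obtain ⟨τ, rfl⟩ := Submodule.Quotient.mk_surjective _ η
    rw [← Submodule.Quotient.mk_add, logMetric_mk hh.inner hb, logMetric_mk hh.inner hb,
      logMetric_mk hh.inner hb]
    refine le_trans (limsup_le_limsup ?_) (ennreal_limsup_add_le _ _ _)
    filter_upwards [self_mem_nhdsWithin] with y hy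
    exact (hh.inner y hy).triangle _ _

theorem logMetric_isSemiNegativeMetric (hD : IsNormalCrossingDivisor n D)
    (hh : IsSemiNegativeMetric n holVectorFields Dᶜ h) (hb : BoundedOnLogFields D h) :
    IsSemiNegativeMetric n (logSections D) univ (logMetric D h) where
  inner x _ := logMetric_inner hD hh hb x
  ae_finitePosDef := by
    intro φ hφ
    -- The set `D` is itself null; off it, injectivity of the map to the tangent space transfers
    -- positive definiteness.
    refine measure_mono_null ?_ (measure_union_null (hD.isNullSet φ hφ) (hh.ae_finitePosDef φ hφ))
    rintro z ⟨hz, -, hzn⟩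
    by_cases hzD : φ.symm z ∈ D
    · exact Or.inl ⟨hz, hzD⟩
    · refine Or.inr ⟨hz, hzD, fun hfin => hzn ⟨fun ξ => ?_, fun ξ hξ => ?_⟩⟩
      · rw [logMetric_eq hD.isOpen_compl hh hb hzD]
        exact hfin.1 _
      · rw [logMetric_eq hD.isOpen_compl hh hb hzD] at hξ
        exact logToTangent_injective hD.isOpen_compl hzD
          ((hfin.2 _ hξ).trans (map_zero _).symm)
  psh W hW _ s hs := logMetric_isPshOnManifold hD hh hb hW hs

/-- A metric of semi-negative curvature on the logarithmic tangent bundle is determined by its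
restriction to the complement of `D`. -/
theorem IsSemiNegativeMetric.eq_of_eqOn_compl (hD : IsNormalCrossingDivisor n D)
    {k₁ k₂ : ∀ x : X, LogFiber (n := n) D x → ℝ≥0∞}
    (h₁ : IsSemiNegativeMetric n (logSections D) univ k₁)
    (h₂ : IsSemiNegativeMetric n (logSections D) univ k₂) (heq : ∀ x ∉ D, k₁ x = k₂ x) :
    k₁ = k₂ := by
  funext x ξ
  obtain ⟨⟨θ, hθ⟩, rfl⟩ := Submodule.Quotient.mk_surjective _ ξ
  obtain ⟨W, hW, hxW, hlog⟩ := id hθ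
  rw [← germSection_of_mem hθ]
  have hs := hlog.germSection_mem hW
  obtain ⟨φ, hφ, hxs, c, hc⟩ := hD.exists_chart_line x
  have hΩ := φ.symm.isOpen_inter_preimage hW
  have hx : φ x ∈ φ.target ∩ φ.symm ⁻¹' W := ⟨φ.map_source hxs, by
    rwa [mem_preimage, φ.left_inv hxs]⟩
  -- Both log-norms of the section through the given vector are recovered at x from their values off
  -- `D`, where they agree.
  have e₁ := (h₁.psh W hW (subset_univ _) _ hs φ hφ).eq_limsupExt hΩ hx hc
  have e₂ := (h₂.psh W hW (subset_univ _) _ hs φ hφ).eq_limsupExt hΩ hx hc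
  rw [Function.comp_apply, φ.left_inv hxs] at e₁ e₂
  apply ENNReal.log_injective
  rw [e₁, e₂]
  refine limsup_congr ?_
  filter_upwards [self_mem_nhdsWithin] with z hz
  simp only [Function.comp_apply, heq _ hz]

theorem existsUnique_logMetric (hD : IsNormalCrossingDivisor n D)
    (hh : IsSemiNegativeMetric n holVectorFields Dᶜ h) (hb : BoundedOnLogFields D h) :
    ∃! hlog : ∀ x : X, LogFiber (n := n) D x → ℝ≥0∞,
      IsSemiNegativeMetric n (logSections D) univ hlog ∧
      ∀ x ∉ D, ∀ ξ : LogFiber (n := n) D x, hlog x ξ = h x (logToTangent D x ξ) := by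
  have hlm := logMetric_isSemiNegativeMetric hD hh hb
  refine ⟨logMetric D h, ⟨hlm, fun x hx ξ => logMetric_eq hD.isOpen_compl hh hb hx ξ⟩, ?_⟩
  rintro k ⟨hk, hkD⟩
  refine hk.eq_of_eqOn_compl hD hlm fun x hx => funext fun ξ => ?_
  rw [hkD x hx, logMetric_eq hD.isOpen_compl hh hb hx]

end

end LogMetric

end

open LogMetric
theorem mainTheorem3 {n : ℕ} {X : Type*} [TopologicalSpace X] [T2Space X]
    [SecondCountableTopology X] [ChartedSpace (Fin n → ℂ) X]
    [IsManifold 𝓘(ℂ, Fin n → ℂ) ω X]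
    (D : Set X) (hD : IsNormalCrossingDivisor n D)
    (h : ∀ x : X, TangentSpace 𝓘(ℂ, Fin n → ℂ) x → ℝ≥0∞)
    (hh : IsSemiNegativeMetric n holVectorFields Dᶜ h)
    (Z : Set X) (hZ : IsAnalyticSubset n Dᶜ Z) (hdense : Dᶜ ⊆ closure (Dᶜ \ Z))
    (hsmooth : IsSmoothMetricOn (Dᶜ \ Z) h)
    (A : ℝ) (hA : 0 < A) (hcurv : HolSecCurvLE (Dᶜ \ Z) h (-A)) :
    ∃! hlog : ∀ x : X, LogFiber (n := n) D x → ℝ≥0∞,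
      IsSemiNegativeMetric n (logSections D) univ hlog ∧
      ∀ x ∉ D, ∀ ξ : LogFiber (n := n) D x, hlog x ξ = h x (logToTangent D x ξ) :=
  existsUnique_logMetric hD hh fun _ _ hθ =>
    logField_bounded hD hh hZ hdense hsmooth hA hcurv hθ
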